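/- Let $M$ be a smooth manifold (real, finite-dimensional, without boundary) with a generalized Kähler structure $(g,J_+,J_-)$: $g$ is a Riemannian metric, $J_+,J_-$ are integrable almost complex structures (i.e. each is induced by a holomorphic atlas), both compatible with $g$ ($g(J_\pm\cdot,J_\pm\cdot)=g(\cdot,\cdot)$), and the fundamental 2-forms $F_\pm=gJ_\pm$ satisfy $$d^c_+F_++d^c_-F_-=0,\qquad dd^c_+F_+=0,$$ where $d^c_\pm=i(\bar\partial_\pm-\partial_\pm)$ are the operators associated with $J_\pm$. Suppose that $[J_+,J_-]=0$, put $Q=J_+J_-$ and, for $\varepsilon=\pm1$, let $T_\varepsilon M=\ker(Q-\varepsilon\,\mathrm{id})\subset TM$. Then: 1. $TM=T_+M\oplus T_-M$, and this splitting is $g$-orthogonal. 2. For each sign $\varepsilon$, $T_\varepsilon M$ is a smooth sub-bundle of $TM$ which is involutive (closed under the Lie bracket of vector fields). For each $J\in\{J_+,J_-\}$ it is a $J$-holomorphic sub-bundle: it is $J$-invariant and preserved by the Cauchy–Riemann operator $\bar\partial_XY=\tfrac12([X,Y]+J[JX,Y])$ of $TM$. 3. For each sign $\varepsilon$ and each $J\in\{J_+,J_-\}$,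 $T_\varepsilon M$ is tangent to a $J$-holomorphic foliation: around every point there is a $J$-holomorphic chart $(\varphi_1,\varphi_2)$ with values in $\mathbb C^a\times\mathbb C^b$ such that $T_\varepsilon M=\ker d\varphi_2$ on its domain. Hence $T_+M$ and $T_-M$ define two transverse holomorphic foliations. 4. On the leaves of each of the two foliations $g$ restricts to a Kähler metric. More precisely, for each sign $\varepsilon$, each $J\in\{J_+,J_-\}$ and every immersion $\iota:L\to M$ of a smooth manifold with $d\iota(T_pL)=T_\varepsilon M_{\iota(p)}$ for all $p\in L$ (in particular for every leaf), $J$ induces an integrable almost complex structure $j$ on $L$ with $d\iota\circ j=J\circ d\iota$, and $(\iota^*g,j)$ is a Kähler structure, i.e. $\iota^*g$ is compatible with $j$ and its fundamental form is closed. -/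

import Mathlib

open scoped Manifold ContDiff Topology Bundle

noncomputable section

namespace GenKahler

section Forms

variable {E : Type*} [NormedAddCommGroup E] [NormedSpace ℝ E]
  (M : Type*) [TopologicalSpace M] [ChartedSpace E M]

/-- Differential `k`-forms on the manifold `M` modelled on `E` (smoothness is not bundled). -/
abbrev Form (E : Type*) [NormedAddCommGroup E] [NormedSpace ℝ E]
    (M : Type*) [TopologicalSpace M] [ChartedSpace E M] (k : ℕ) : Type _ :=
  ∀ x : M, (TangentSpace 𝓘(ℝ, E) x) [⋀^Fin k]→L[ℝ] ℝ

variable {M}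

/-- The differential at `x` of the preferred chart around `x`, with values in the model space. -/
def chartDiff (x : M) : TangentSpace 𝓘(ℝ, E) x →L[ℝ] E :=
  mfderiv 𝓘(ℝ, E) 𝓘(ℝ, E) (extChartAt 𝓘(ℝ, E) x) x

/-- The differential at `y` of the inverse of the preferred chart around `x`. -/
def chartSymmDiff (x : M) (y : E) :
    E →L[ℝ] TangentSpace 𝓘(ℝ, E) ((extChartAt 𝓘(ℝ, E) x).symm y) :=
  mfderiv 𝓘(ℝ, E) 𝓘(ℝ, E) (extChartAt 𝓘(ℝ, E) x).symm y

/-- The expression of a form in the preferred chart around `x`: its pull-back by the inverse of the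
chart, a form on (an open subset of) the model space. -/
def inChart {k : ℕ} (η : Form E M k) (x : M) : E → E [⋀^Fin k]→L[ℝ] ℝ := fun y =>
  (η ((extChartAt 𝓘(ℝ, E) x).symm y)).compContinuousLinearMap (chartSymmDiff x y)

/-- The exterior derivative on `M`: at `x`, compute the exterior derivative in the preferred chart
around `x` and pull it back by that chart. -/
def extD {k : ℕ} (η : Form E M k) : Form E M (k + 1) := fun x =>
  (extDeriv (inChart η x) (extChartAt 𝓘(ℝ, E) x x)).compContinuousLinearMap (chartDiff x)

end Forms

section Structures

variable (E : Type*) [NormedAddCommGroup E] [NormedSpace ℝ E]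
  (M : Type*) [TopologicalSpace M] [ChartedSpace E M] [IsManifold 𝓘(ℝ, E) ∞ M]

/-- Smooth Riemannian metrics on `M`. -/
abbrev RiemMetric : Type _ :=
  Bundle.ContMDiffRiemannianMetric 𝓘(ℝ, E) ∞ E (fun x : M => TangentSpace 𝓘(ℝ, E) x)

/-- Smooth almost complex structures on `M`. -/
structure AlmostComplex where
  /-- the endomorphism of each tangent space -/
  J (x : M) : TangentSpace 𝓘(ℝ, E) x →L[ℝ] TangentSpace 𝓘(ℝ, E) x
  smooth : ContMDiff 𝓘(ℝ, E) (𝓘(ℝ, E).prod 𝓘(ℝ, E →L[ℝ] E)) ∞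
    (fun x => Bundle.TotalSpace.mk' (E →L[ℝ] E)
      (E := fun x : M => TangentSpace 𝓘(ℝ, E) x →L[ℝ] TangentSpace 𝓘(ℝ, E) x) x (J x))
  sq (x : M) (v : TangentSpace 𝓘(ℝ, E) x) : J x (J x v) = -v

variable {E M}

/-- The differential at `y` of a map into a complex normed space `F`, with values in `F`. -/
def diff {F : Type*} [NormedAddCommGroup F] [NormedSpace ℂ F] (φ : M → F) (y : M) :
    TangentSpace 𝓘(ℝ, E) y →L[ℝ] F :=
  mfderiv 𝓘(ℝ, E) 𝓘(ℝ, F) φ y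

/-- `φ` is a `J`-holomorphic chart: a diffeomorphism from an open subset of `M` onto an open subset
of the complex space `F` whose differential intertwines `J` and multiplication by `i`. -/
structure IsHolomorphicChart (J : AlmostComplex E M)
    {F : Type*} [NormedAddCommGroup F] [NormedSpace ℂ F] (φ : OpenPartialHomeomorph M F) : Prop where
  smooth : ContMDiffOn 𝓘(ℝ, E) 𝓘(ℝ, F) ∞ φ φ.source
  smooth_symm : ContMDiffOn 𝓘(ℝ, F) 𝓘(ℝ, E) ∞ φ.symm φ.target
  holomorphic : ∀ y ∈ φ.source, ∀ v : TangentSpace 𝓘(ℝ, E) y,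
    diff φ y (J.J y v) = Complex.I • diff φ y v

/-- `J` is integrable: it is the almost complex structure of a complex manifold, that is, `M` is
covered by `J`-holomorphic charts with values in `ℂⁿ`. -/
def AlmostComplex.Integrable (J : AlmostComplex E M) : Prop :=
  ∀ x : M, ∃ (n : ℕ) (φ : OpenPartialHomeomorph M (Fin n → ℂ)),
    x ∈ φ.source ∧ IsHolomorphicChart J φ

/-- The metric `g` is compatible with `J`: `g(J·, J·) = g(·, ·)`. -/
def Compatible (g : RiemMetric E M) (J : AlmostComplex E M) : Prop :=
  ∀ (x : M) (v w : TangentSpace 𝓘(ℝ, E) x), g.inner x (J.J x v) (J.J x w) = g.inner x v w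

/-- The fundamental 2-form `F = gJ`, i.e. `F(v, w) = g(Jv, w)`, of a compatible pair `(g, J)`. -/
def fundamentalForm (g : RiemMetric E M) (J : AlmostComplex E M) (h : Compatible g J) :
    Form E M 2 := fun x =>
  { toFun := fun v => g.inner x (J.J x (v 0)) (v 1)
    map_update_add' := by
      intro inst v i a b
      rw [Subsingleton.elim inst (instDecidableEqFin 2)]
      fin_cases i <;> simp
    map_update_smul' := by
      intro inst v i c a
      rw [Subsingleton.elim inst (instDecidableEqFin 2)]
      fin_cases i <;> simp
    cont := by
      let B : E →L[ℝ] E →L[ℝ] ℝ := g.inner x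
      let A : E →L[ℝ] E := J.J x
      have h : Continuous fun v : Fin 2 → E => B (A (v 0)) (v 1) := by fun_prop
      exact h
    map_eq_zero_of_eq' := by
      intro v i j hij hne
      have h01 : v 0 = v 1 := by
        fin_cases i <;> fin_cases j <;> simp_all
      have h1 := h x (v 1) (J.J x (v 1))
      have h2 := g.symm x (J.J x (v 1)) (v 1)
      rw [J.sq, map_neg] at h1
      show g.inner x (J.J x (v 0)) (v 1) = 0
      rw [h01]
      linarith }

/-- The action of `J` on `k`-forms: the algebra automorphism which on 1-forms is
`(Jα)(v) = -α(Jv)`. -/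
def AlmostComplex.act (J : AlmostComplex E M) {k : ℕ} (η : Form E M k) : Form E M k := fun x =>
  (η x).compContinuousLinearMap (-(J.J x))

/-- The inverse of the action of `J` on `k`-forms: on 1-forms `(J⁻¹α)(v) = α(Jv)`. -/
def AlmostComplex.actInv (J : AlmostComplex E M) {k : ℕ} (η : Form E M k) : Form E M k := fun x =>
  (η x).compContinuousLinearMap (J.J x)

/-- The real operator `dᶜ = J ∘ d ∘ J⁻¹`. For integrable `J` this is `i(∂̄ - ∂)`, because `J` acts
on forms of type `(p,q)` as multiplication by `(-i)ᵖ iᑫ`. -/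
def AlmostComplex.dc (J : AlmostComplex E M) {k : ℕ} (η : Form E M k) : Form E M (k + 1) :=
  J.act (extD (J.actInv η))

/-- `(g, J)` is a Kähler structure: `J` is integrable, `g` is compatible with `J` and the
fundamental form is closed. -/
def IsKahler (g : RiemMetric E M) (J : AlmostComplex E M) : Prop :=
  J.Integrable ∧ ∃ h : Compatible g J, extD (fundamentalForm g J h) = 0

variable (E M) in
/-- Generalized Kähler structures `(g, J₊, J₋)`: `J₊` and `J₋` are integrable, `g` is compatible
with both, `dᶜ₊F₊ + dᶜ₋F₋ = 0` and `d dᶜ₊F₊ = 0`. -/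
structure GeneralizedKahler where
  /-- the Riemannian metric -/
  g : RiemMetric E M
  /-- the complex structure `J₊` -/
  Jp : AlmostComplex E M
  /-- the complex structure `J₋` -/
  Jm : AlmostComplex E M
  integrable_p : Jp.Integrable
  integrable_m : Jm.Integrable
  compatible_p : Compatible g Jp
  compatible_m : Compatible g Jm
  dc_add : Jp.dc (fundamentalForm g Jp compatible_p) +
    Jm.dc (fundamentalForm g Jm compatible_m) = 0
  d_dc : extD (Jp.dc (fundamentalForm g Jp compatible_p)) = 0

/-- The operator `Q = J₊J₋`. -/
def GeneralizedKahler.Q (K : GeneralizedKahler E M) (x : M) :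
    TangentSpace 𝓘(ℝ, E) x →ₗ[ℝ] TangentSpace 𝓘(ℝ, E) x :=
  (K.Jp.J x).toLinearMap ∘ₗ (K.Jm.J x).toLinearMap

/-- The eigenspaces of `Q` for the eigenvalue `ε`. -/
def GeneralizedKahler.T (K : GeneralizedKahler E M) (ε : ℝ) (x : M) :
    Submodule ℝ (TangentSpace 𝓘(ℝ, E) x) :=
  Module.End.eigenspace (K.Q x) ε

end Structures

section Distributions

variable {E : Type*} [NormedAddCommGroup E] [NormedSpace ℝ E]
  {M : Type*} [TopologicalSpace M] [ChartedSpace E M] [IsManifold 𝓘(ℝ, E) ∞ M]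

/-- `X` is a smooth vector field on the set `U`. -/
def SmoothFieldOn (X : ∀ x : M, TangentSpace 𝓘(ℝ, E) x) (U : Set M) : Prop :=
  ContMDiffOn 𝓘(ℝ, E) 𝓘(ℝ, E).tangent ∞ (fun x => (⟨x, X x⟩ : TangentBundle 𝓘(ℝ, E) M)) U

/-- `D` is a smooth sub-bundle of the tangent bundle: it has smooth local frames. -/
def IsSmoothSubbundle (D : ∀ x : M, Submodule ℝ (TangentSpace 𝓘(ℝ, E) x)) : Prop :=
  ∀ x : M, ∃ U : Set M, IsOpen U ∧ x ∈ U ∧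
    ∃ (r : ℕ) (s : Fin r → ∀ y : M, TangentSpace 𝓘(ℝ, E) y),
      (∀ i, SmoothFieldOn (s i) U) ∧
      ∀ y ∈ U, LinearIndependent ℝ (fun i => s i y) ∧
        Submodule.span ℝ (Set.range fun i => s i y) = D y

/-- `D` is involutive: the Lie bracket of two local smooth sections of `D` is a section of `D`. -/
def IsInvolutive (D : ∀ x : M, Submodule ℝ (TangentSpace 𝓘(ℝ, E) x)) : Prop :=
  ∀ U : Set M, IsOpen U → ∀ X Y : ∀ x : M, TangentSpace 𝓘(ℝ, E) x,
    SmoothFieldOn X U → SmoothFieldOn Y U → (∀ y ∈ U, X y ∈ D y) → (∀ y ∈ U, Y y ∈ D y) →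
    ∀ y ∈ U, VectorField.mlieBracket 𝓘(ℝ, E) X Y y ∈ D y

/-- The Cauchy-Riemann operator `∂̄_X Y = ½([X,Y] + J[JX,Y])` of the holomorphic structure which
an integrable `J` induces on the tangent bundle. -/
def AlmostComplex.dbar (J : AlmostComplex E M) (X Y : ∀ x : M, TangentSpace 𝓘(ℝ, E) x) (x : M) :
    TangentSpace 𝓘(ℝ, E) x :=
  (1 / 2 : ℝ) • (VectorField.mlieBracket 𝓘(ℝ, E) X Y x +
    J.J x (VectorField.mlieBracket 𝓘(ℝ, E) (fun y => J.J y (X y)) Y x))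

/-- `D` is a `J`-holomorphic sub-bundle of the tangent bundle: a smooth `J`-complex sub-bundle
which is preserved by the Cauchy-Riemann operator of `J`. -/
structure IsHolomorphicSubbundle (J : AlmostComplex E M)
    (D : ∀ x : M, Submodule ℝ (TangentSpace 𝓘(ℝ, E) x)) : Prop where
  smooth : IsSmoothSubbundle D
  invariant : ∀ x : M, ∀ v ∈ D x, J.J x v ∈ D x
  dbar_mem : ∀ U : Set M, IsOpen U → ∀ X Y : ∀ x : M, TangentSpace 𝓘(ℝ, E) x,
    SmoothFieldOn X U → SmoothFieldOn Y U → (∀ y ∈ U, Y y ∈ D y) →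
    ∀ y ∈ U, J.dbar X Y y ∈ D y

/-- `D` is tangent to a `J`-holomorphic foliation: around every point there is a `J`-holomorphic
chart `φ = (φ₁, φ₂)` with values in `ℂᵃ × ℂᵇ` in which `D` is the tangent distribution of the
plaques `φ₂ = const`. -/
def IsHolomorphicFoliation (J : AlmostComplex E M)
    (D : ∀ x : M, Submodule ℝ (TangentSpace 𝓘(ℝ, E) x)) : Prop :=
  ∀ x : M, ∃ (a b : ℕ) (φ : OpenPartialHomeomorph M ((Fin a → ℂ) × (Fin b → ℂ))),
    x ∈ φ.source ∧ IsHolomorphicChart J φ ∧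
      ∀ y ∈ φ.source, ∀ v : TangentSpace 𝓘(ℝ, E) y, v ∈ D y ↔ (diff φ y v).2 = 0

variable (E' : Type*) [NormedAddCommGroup E'] [NormedSpace ℝ E']
  {L : Type*} [TopologicalSpace L] [ChartedSpace E' L] [IsManifold 𝓘(ℝ, E') ∞ L]

/-- `ι : L → M` is an immersed integral manifold of `D`: an immersion whose tangent spaces are the
spaces of `D`. If `D` is tangent to a foliation, its leaves are such integral manifolds (they are
the maximal connected injectively immersed ones), and so are the open subsets of its leaves. -/
structure IsIntegralManifold (ι : L → M)
    (D : ∀ x : M, Submodule ℝ (TangentSpace 𝓘(ℝ, E) x)) : Prop where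
  smooth : ContMDiff 𝓘(ℝ, E') 𝓘(ℝ, E) ∞ ι
  injective : ∀ p : L, Function.Injective (mfderiv 𝓘(ℝ, E') 𝓘(ℝ, E) ι p)
  tangent : ∀ p : L, (mfderiv 𝓘(ℝ, E') 𝓘(ℝ, E) ι p).toLinearMap.range = D (ι p)

/-- `(g, J)` restricts along `ι : L → M` to a Kähler structure on `L`: the differential of `ι`
intertwines `J` with an almost complex structure `j` on `L`, the pull-back of `g` is a Riemannian
metric `h` on `L`, and `(h, j)` is Kähler. -/
def RestrictsToKahler (g : RiemMetric E M) (J : AlmostComplex E M) (ι : L → M) : Prop :=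
  ∃ (h : RiemMetric E' L) (j : AlmostComplex E' L),
    (∀ (p : L) (v w : TangentSpace 𝓘(ℝ, E') p),
      h.inner p v w = g.inner (ι p) (mfderiv 𝓘(ℝ, E') 𝓘(ℝ, E) ι p v)
        (mfderiv 𝓘(ℝ, E') 𝓘(ℝ, E) ι p w)) ∧
    (∀ (p : L) (v : TangentSpace 𝓘(ℝ, E') p),
      mfderiv 𝓘(ℝ, E') 𝓘(ℝ, E) ι p (j.J p v) =
        J.J (ι p) (mfderiv 𝓘(ℝ, E') 𝓘(ℝ, E) ι p v)) ∧
    IsKahler h j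

end Distributions

end GenKahler

end

/-!
On `ker (J₁J₂ - ε)` we have `J₂ = -εJ₁`, hence `F₂ = -εF₁` for the fundamental forms, while
`dᶜ₁F₁ = -dᶜ₂F₂` relates `dF₁` to `dF₂` by the product of the signs of the arguments. For `X, Y` in
one eigenbundle and `Z` in the other, the only term of `dF₁(X, Y, Z)` which these two comparisons do
not cancel is `F₁([X, Y], Z)`, so the eigenbundles are involutive. For three arguments in the same
eigenbundle they say `dF₁ = εdF₂` and `dF₂ = -εdF₁`, so `dF₁` vanishes on the leaves.

Both Nijenhuis tensors vanish, which makes the eigenbundles invariant under `∂̄`. In a holomorphic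
chart an eigenbundle then consists of the graphs of linear maps depending holomorphically on the
base point, and the holomorphic foliation is obtained by flowing along these graphs.
-/

noncomputable section

open Filter Metric Set VectorField

namespace GenKahler

/-! ### Smooth dependence of flows on parameters -/

section Superposition

universe u

variable {𝕜 : Type*} [RCLike 𝕜] {K : Type*} [TopologicalSpace K]
  {X Y : Type*} [NormedAddCommGroup X] [NormedSpace 𝕜 X] [NormedAddCommGroup Y] [NormedSpace 𝕜 Y]

open Classical in
/-- The superposition (Nemytskii) operator `γ ↦ G ∘ γ` on spaces of continuous maps. It has the
junk value `0` where `G ∘ γ` is not continuous, since `G` is usually regular on an open set only. -/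
def superposition (G : X → Y) (γ : C(K, X)) : C(K, Y) :=
  if h : Continuous (G ∘ γ) then ⟨G ∘ γ, h⟩ else 0

theorem superposition_apply {G : X → Y} {Ω : Set X} (hG : ContinuousOn G Ω) {γ : C(K, X)}
    (hγ : ∀ t, γ t ∈ Ω) (t : K) : superposition G γ t = G (γ t) := by
  have h : Continuous (G ∘ γ) := hG.comp_continuous γ.continuous hγ
  rw [superposition, dif_pos h]
  rfl

@[simp]
theorem superposition_const (G : X → Y) (x : X) :
    superposition G (ContinuousMap.const K x) = ContinuousMap.const K (G x) := by
  have h : Continuous (G ∘ ContinuousMap.const K x) := by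
    simpa only [Function.comp_def, ContinuousMap.const_apply] using continuous_const
  exact dif_pos h

variable [CompactSpace K]

theorem isOpen_setOf_forall_mem {Ω : Set X} (hΩ : IsOpen Ω) :
    IsOpen {γ : C(K, X) | ∀ t, γ t ∈ Ω} := by
  simpa only [MapsTo, mem_univ, true_implies] using
    ContinuousMap.isOpen_setOfPred_mapsTo (X := K) isCompact_univ hΩ

variable (𝕜 K X Y) in
/-- Pointwise evaluation of a continuous family of operators on a continuous map, as a bounded
bilinear operation. -/
def pointwiseEval : C(K, X →L[𝕜] Y) →L[𝕜] C(K, X) →L[𝕜] C(K, Y) :=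
  LinearMap.mkContinuous₂
    (LinearMap.mk₂ 𝕜
      (fun (A : C(K, X →L[𝕜] Y)) (γ : C(K, X)) => (⟨fun t => A t (γ t), by fun_prop⟩ : C(K, Y)))
      (fun _ _ _ => rfl) (fun _ _ _ => rfl) (fun _ _ _ => by ext; simp) (fun _ _ _ => by ext; simp))
    1 fun A γ => by
      rw [one_mul, ContinuousMap.norm_le _ (by positivity)]
      exact fun t => (A t).le_of_opNorm_le_of_le (A.norm_coe_le_norm t) (γ.norm_coe_le_norm t)

@[simp]
theorem pointwiseEval_apply (A : C(K, X →L[𝕜] Y)) (γ : C(K, X)) (t : K) :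
    pointwiseEval 𝕜 K X Y A γ t = A t (γ t) :=
  rfl

theorem exists_forall_norm_image_sub_sub_fderiv_le {G : X → Y} {Ω S : Set X} (hΩ : IsOpen Ω)
    (hG : ContDiffOn 𝕜 1 G Ω) (hS : IsCompact S) (hSΩ : S ⊆ Ω) {ε : ℝ} (hε : 0 < ε) :
    ∃ δ > 0, ∀ x ∈ S, ∀ y ∈ ball x δ, ‖G y - G x - fderiv 𝕜 G x (y - x)‖ ≤ ε * ‖y - x‖ := by
  let : NormedSpace ℝ X := NormedSpace.restrictScalars ℝ 𝕜 X
  have hG' : ContinuousOn (fderiv 𝕜 G) Ω := hG.continuousOn_fderiv_of_isOpen hΩ le_rfl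
  obtain ⟨δ₁, hδ₁, h₁⟩ := Metric.mem_uniformity_dist.1 <|
    hS.uniformContinuousAt_of_continuousAt (fderiv 𝕜 G)
      (fun x hx => hG'.continuousAt (hΩ.mem_nhds (hSΩ hx))) (dist_mem_uniformity hε)
  obtain ⟨δ₂, hδ₂, h₂⟩ := hS.exists_thickening_subset_open hΩ hSΩ
  refine ⟨min δ₁ δ₂, lt_min hδ₁ hδ₂, fun x hx y hy => ?_⟩
  refine (convex_ball x (min δ₁ δ₂)).norm_image_sub_le_of_norm_fderiv_le' (𝕜 := 𝕜)
    (fun z hz => ?_) (fun z hz => ?_) (mem_ball_self (lt_min hδ₁ hδ₂)) hy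
  · have hzΩ : z ∈ Ω := h₂ (mem_thickening_iff.2 ⟨x, hx, hz.trans_le (min_le_right _ _)⟩)
    exact (hG.contDiffAt (hΩ.mem_nhds hzΩ)).differentiableAt one_ne_zero
  · rw [← dist_eq_norm, dist_comm]
    exact (h₁ ((mem_ball'.1 hz).trans_le (min_le_left _ _)) hx).le

theorem hasFDerivAt_superposition {G : X → Y} {Ω : Set X} (hΩ : IsOpen Ω)
    (hG : ContDiffOn 𝕜 1 G Ω) {γ : C(K, X)} (hγ : ∀ t, γ t ∈ Ω) :
    HasFDerivAt (superposition G)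
      (pointwiseEval 𝕜 K X Y (superposition (fderiv 𝕜 G) γ)) γ := by
  have hG' : ContinuousOn (fderiv 𝕜 G) Ω := hG.continuousOn_fderiv_of_isOpen hΩ le_rfl
  refine HasFDerivAt.of_isLittleO <| Asymptotics.isLittleO_iff.2 fun ε hε => ?_
  obtain ⟨δ, hδ, h⟩ := exists_forall_norm_image_sub_sub_fderiv_le hΩ hG
    (isCompact_range γ.continuous) (range_subset_iff.2 hγ) hε
  filter_upwards [(isOpen_setOf_forall_mem hΩ).mem_nhds hγ, ball_mem_nhds γ hδ] with β hβ hβγ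
  refine (ContinuousMap.norm_le _ (by positivity)).2 fun t => ?_
  have hdist : dist (β t) (γ t) < δ := (ContinuousMap.dist_apply_le_dist t).trans_lt hβγ
  calc _ = ‖G (β t) - G (γ t) - fderiv 𝕜 G (γ t) (β t - γ t)‖ := by
        simp only [ContinuousMap.sub_apply, pointwiseEval_apply,
          superposition_apply hG.continuousOn hβ, superposition_apply hG.continuousOn hγ,
          superposition_apply hG' hγ]
    _ ≤ ε * ‖β t - γ t‖ := h _ (mem_range_self t) _ hdist
    _ ≤ ε * ‖β - γ‖ := by gcongr; exact (β - γ).norm_coe_le_norm t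

theorem contDiffOn_superposition {X Y : Type u} [NormedAddCommGroup X] [NormedSpace 𝕜 X]
    [NormedAddCommGroup Y] [NormedSpace 𝕜 Y] {G : X → Y} {Ω : Set X} (hΩ : IsOpen Ω)
    (hG : ContDiffOn 𝕜 ∞ G Ω) :
    ContDiffOn 𝕜 ∞ (superposition (K := K) G) {γ | ∀ t, γ t ∈ Ω} := by
  refine contDiffOn_infty.2 fun n => ?_
  have hderiv {Y : Type u} [NormedAddCommGroup Y] [NormedSpace 𝕜 Y] {G : X → Y}
      (hG : ContDiffOn 𝕜 ∞ G Ω) {γ : C(K, X)} (hγ : ∀ t, γ t ∈ Ω) :=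
    hasFDerivAt_superposition hΩ (hG.of_le (by simp)) hγ
  have hopen := isOpen_setOf_forall_mem (K := K) hΩ
  induction n generalizing Y with
  | zero =>
    exact contDiffOn_zero.2 fun γ hγ => (hderiv hG hγ).continuousAt.continuousWithinAt
  | succ n ih =>
    rw [Nat.cast_succ, contDiffOn_succ_iff_fderiv_of_isOpen hopen]
    refine ⟨fun γ hγ => (hderiv hG hγ).differentiableAt.differentiableWithinAt, by simp, ?_⟩
    refine ContDiffOn.congr ?_ fun γ hγ => (hderiv hG hγ).fderiv
    exact (pointwiseEval 𝕜 K X Y).contDiff.comp_contDiffOn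
      (ih (hG.fderiv_of_isOpen hΩ (by simp)))

end Superposition

section InverseFunction

variable {𝕜 E F : Type*} [RCLike 𝕜] [NormedAddCommGroup E] [NormedSpace 𝕜 E] [CompleteSpace E]
  [NormedAddCommGroup F] [NormedSpace 𝕜 F]

theorem exists_openPartialHomeomorph_of_hasFDerivAt {f : E → F} {U : Set E} (hU : IsOpen U)
    (hf : ContDiffOn 𝕜 ∞ f U) {x : E} (hx : x ∈ U) (f' : E ≃L[𝕜] F)
    (hf' : HasFDerivAt f (f' : E →L[𝕜] F) x) :
    ∃ Ψ : OpenPartialHomeomorph E F, x ∈ Ψ.source ∧ Ψ.source ⊆ U ∧ (∀ z, Ψ z = f z) ∧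
      ContDiffOn 𝕜 ∞ Ψ.symm Ψ.target := by
  have hfx : ContDiffAt 𝕜 ∞ f x := hf.contDiffAt (hU.mem_nhds hx)
  have hn : (∞ : WithTop ℕ∞) ≠ 0 := by simp
  let Ψ₀ := hfx.toOpenPartialHomeomorph f hf' hn
  have hxΨ₀ : x ∈ Ψ₀.source := hfx.mem_toOpenPartialHomeomorph_source hf' hn
  have hcont : ContinuousOn (fderiv 𝕜 f) U := hf.continuousOn_fderiv_of_isOpen hU (by simp)
  let S : Set E := U ∩ fderiv 𝕜 f ⁻¹' range ((↑) : (E ≃L[𝕜] F) → E →L[𝕜] F)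
  have hS : IsOpen S := hcont.isOpen_inter_preimage hU (ContinuousLinearEquiv.isOpen)
  have hxS : x ∈ S := ⟨hx, f', hf'.fderiv.symm⟩
  refine ⟨Ψ₀.restrOpen S hS, ⟨hxΨ₀, hxS⟩, fun z hz => hz.2.1, fun z => rfl, ?_⟩
  intro y hy
  have hyS := (Ψ₀.restrOpen S hS).map_target hy
  obtain ⟨L, hL⟩ := hyS.2.2
  have hd : HasFDerivAt f (L : E →L[𝕜] F) ((Ψ₀.restrOpen S hS).symm y) := by
    rw [hL]
    exact ((hf.contDiffAt (hU.mem_nhds hyS.2.1)).differentiableAt hn).hasFDerivAt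
  exact ((Ψ₀.restrOpen S hS).contDiffAt_symm hy hd
    (hf.contDiffAt (hU.mem_nhds hyS.2.1))).contDiffWithinAt

end InverseFunction

section Volterra

open scoped unitInterval

variable {𝕜 : Type*} [RCLike 𝕜] {X : Type*} [NormedAddCommGroup X] [NormedSpace ℝ X]
  [NormedSpace 𝕜 X] [IsScalarTower ℝ 𝕜 X]

variable (𝕜 X) in
/-- The Volterra operator `γ ↦ (t ↦ ∫₀ᵗ γ)`. -/
def volterra : C(I, X) →L[𝕜] C(I, X) :=
  LinearMap.mkContinuous
    { toFun γ := ⟨fun t => ∫ s in (0 : ℝ)..t, IccExtend zero_le_one γ s,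
        (intervalIntegral.continuous_primitive
          (fun _ _ => γ.continuous.Icc_extend'.intervalIntegrable _ _) 0).comp
          continuous_subtype_val⟩
      map_add' γ β := by
        ext t
        exact intervalIntegral.integral_add (γ.continuous.Icc_extend'.intervalIntegrable _ _)
          (β.continuous.Icc_extend'.intervalIntegrable _ _)
      map_smul' c γ := by
        ext t
        exact intervalIntegral.integral_smul c (IccExtend zero_le_one γ) }
    1 fun γ => by
      rw [one_mul, ContinuousMap.norm_le _ (norm_nonneg γ)]
      intro t
      have h := intervalIntegral.norm_integral_le_of_norm_le_const (a := 0) (b := (t : ℝ))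
        (f := IccExtend zero_le_one γ) fun s _ => γ.norm_coe_le_norm (projIcc 0 1 zero_le_one s)
      refine h.trans (mul_le_of_le_one_right (norm_nonneg γ) ?_)
      rw [sub_zero, abs_of_nonneg t.2.1]
      exact t.2.2

theorem volterra_apply (γ : C(I, X)) (t : I) :
    volterra 𝕜 X γ t = ∫ s in (0 : ℝ)..t, IccExtend zero_le_one γ s :=
  rfl

theorem volterra_zero (γ : C(I, X)) : volterra 𝕜 X γ 0 = 0 := by
  rw [volterra_apply]
  exact intervalIntegral.integral_same

theorem hasDerivWithinAt_volterra [CompleteSpace X] (γ : C(I, X)) {t : ℝ} (ht : t ∈ I) :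
    HasDerivWithinAt (IccExtend zero_le_one (volterra 𝕜 X γ)) (γ ⟨t, ht⟩) I t := by
  have hγ : Continuous (IccExtend zero_le_one γ) := γ.continuous.Icc_extend'
  have h := (hγ.integral_hasStrictDerivAt 0 t).hasDerivAt.hasDerivWithinAt (s := I)
  rw [IccExtend_of_mem _ _ ht] at h
  refine h.congr (fun s hs => ?_) ?_ <;> rw [IccExtend_of_mem _ _ ‹_›, volterra_apply]

theorem hasDerivWithinAt_const_add_volterra [CompleteSpace X] (x : X) (γ : C(I, X)) {t : ℝ}
    (ht : t ∈ I) :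
    HasDerivWithinAt (IccExtend zero_le_one (ContinuousMap.const I x + volterra 𝕜 X γ))
      (γ ⟨t, ht⟩) I t :=
  (hasDerivWithinAt_volterra γ ht).const_add x

end Volterra

section Flow

open scoped unitInterval

universe u

variable {𝕜 : Type*} [RCLike 𝕜] {P Y : Type u} [NormedAddCommGroup P] [NormedSpace 𝕜 P]
  [NormedAddCommGroup Y] [NormedSpace 𝕜 Y]

variable (𝕜 P Y) in
/-- The bounded operator `(p, γ) ↦ (t ↦ (p, γ t))`. -/
def withParameter : P × C(I, Y) →L[𝕜] C(I, P × Y) :=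
  ((ContinuousLinearMap.inl 𝕜 P Y).compLeftContinuous 𝕜 I ∘L
      (ContinuousLinearMap.const 𝕜 I : P →L[𝕜] C(I, P))).coprod
    ((ContinuousLinearMap.inr 𝕜 P Y).compLeftContinuous 𝕜 I)

@[simp]
theorem withParameter_apply (p : P) (γ : C(I, Y)) (t : I) :
    withParameter 𝕜 P Y (p, γ) t = (p, γ t) := by
  simp [withParameter]

@[simp]
theorem withParameter_const (p : P) (y : Y) :
    withParameter 𝕜 P Y (p, ContinuousMap.const I y) = ContinuousMap.const I (p, y) := by
  ext t <;> simp

theorem hasFDerivAt_superposition_withParameter {X : P × Y → Y} {Ω : Set (P × Y)} (hΩ : IsOpen Ω)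
    (hX : ContDiffOn 𝕜 ∞ X Ω) {p : P} {γ : C(I, Y)} (hγ : ∀ t, (p, γ t) ∈ Ω) :
    HasFDerivAt (superposition X ∘ withParameter 𝕜 P Y)
      (pointwiseEval 𝕜 I (P × Y) Y (superposition (fderiv 𝕜 X) (withParameter 𝕜 P Y (p, γ))) ∘L
        withParameter 𝕜 P Y) (p, γ) :=
  (hasFDerivAt_superposition hΩ (hX.of_le (by simp))
    (by simpa only [withParameter_apply] using hγ)).comp (p, γ) (withParameter 𝕜 P Y).hasFDerivAt

variable [NormedSpace ℝ Y] [IsScalarTower ℝ 𝕜 Y]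

variable (𝕜) in
/-- The defect of a curve `γ = x.2` in the integral equation `γ = y + ∫ X (p, γ)` of the field
`X (p, ·)`, together with the parameter and the initial value `(p, y) = x.1`. -/
def integralEquation (X : P × Y → Y) (x : (P × Y) × C(I, Y)) : (P × Y) × C(I, Y) :=
  (x.1, x.2 - ContinuousMap.const I x.1.2 -
    volterra 𝕜 Y (superposition X (withParameter 𝕜 P Y (x.1.1, x.2))))

theorem contDiffOn_integralEquation {X : P × Y → Y} {Ω : Set (P × Y)} (hΩ : IsOpen Ω)
    (hX : ContDiffOn 𝕜 ∞ X Ω) :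
    ContDiffOn 𝕜 ∞ (integralEquation 𝕜 X) {x | ∀ t, (x.1.1, x.2 t) ∈ Ω} := by
  have hconst : ContDiff 𝕜 ∞ fun x : (P × Y) × C(I, Y) => ContinuousMap.const I x.1.2 :=
    (ContinuousLinearMap.const 𝕜 I : Y →L[𝕜] C(I, Y)).contDiff.comp
      (contDiff_snd.comp contDiff_fst)
  have hpath : ContDiff 𝕜 ∞ fun x : (P × Y) × C(I, Y) => withParameter 𝕜 P Y (x.1.1, x.2) :=
    (withParameter 𝕜 P Y).contDiff.comp
      ((contDiff_fst.comp contDiff_fst).prodMk contDiff_snd)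
  refine contDiff_fst.contDiffOn.prodMk ((contDiff_snd.sub hconst).contDiffOn.sub ?_)
  refine (volterra 𝕜 Y).contDiff.comp_contDiffOn
    ((contDiffOn_superposition hΩ hX).comp hpath.contDiffOn fun x hx t => ?_)
  simpa using hx t

theorem hasFDerivAt_integralEquation {X : P × Y → Y} {Ω : Set (P × Y)} (hΩ : IsOpen Ω)
    (hX : ContDiffOn 𝕜 ∞ X Ω) {p₀ : P} {y₀ : Y} (h₀ : (p₀, y₀) ∈ Ω) (hX₀ : ∀ y, X (p₀, y) = 0) :
    ∃ R : P × Y →L[𝕜] C(I, Y), HasFDerivAt (integralEquation 𝕜 X)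
      ((ContinuousLinearEquiv.refl 𝕜 (P × Y)).skewProd (ContinuousLinearEquiv.refl 𝕜 C(I, Y)) R :
        (P × Y) × C(I, Y) →L[𝕜] (P × Y) × C(I, Y)) ((p₀, y₀), ContinuousMap.const I y₀) := by
  have hXd : HasFDerivAt X (fderiv 𝕜 X (p₀, y₀)) (p₀, y₀) :=
    ((hX.contDiffAt (hΩ.mem_nhds h₀)).differentiableAt (by simp)).hasFDerivAt
  have hvert (y : Y) : fderiv 𝕜 X (p₀, y₀) (0, y) = 0 := by
    have h := hXd.comp y₀ (hasFDerivAt_prodMk_right p₀ y₀)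
    rw [show X ∘ (fun y => (p₀, y)) = fun _ => 0 from funext hX₀] at h
    exact congr($(h.unique (hasFDerivAt_const 0 y₀)) y)
  let B : P × C(I, Y) →L[𝕜] C(I, Y) := volterra 𝕜 Y ∘L pointwiseEval 𝕜 I (P × Y) Y
    (superposition (fderiv 𝕜 X) (withParameter 𝕜 P Y (p₀, ContinuousMap.const I y₀))) ∘L
      withParameter 𝕜 P Y
  have hB (p : P) (γ : C(I, Y)) : B (p, γ) = B (p, 0) := by
    refine congrArg (volterra 𝕜 Y) (ContinuousMap.ext fun t => ?_)
    have h := map_add (fderiv 𝕜 X (p₀, y₀)) (p, 0) (0, γ t)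
    simpa [hvert] using h
  let k : P × Y →L[𝕜] C(I, Y) := .const 𝕜 I ∘L .snd 𝕜 P Y
  refine ⟨-k - B ∘L .inl 𝕜 P C(I, Y) ∘L .fst 𝕜 P Y, ?_⟩
  let J : (P × Y) × C(I, Y) →L[𝕜] P × C(I, Y) :=
    (.fst 𝕜 P Y ∘L .fst 𝕜 (P × Y) C(I, Y)).prod (.snd 𝕜 (P × Y) C(I, Y))
  have hvol := ((volterra 𝕜 Y).hasFDerivAt.comp _ <|
    hasFDerivAt_superposition_withParameter hΩ hX (γ := ContinuousMap.const I y₀) fun _ => h₀).comp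
      ((p₀, y₀), ContinuousMap.const I y₀) J.hasFDerivAt
  refine (hasFDerivAt_fst.prodMk ((hasFDerivAt_snd.sub
    (k.hasFDerivAt.comp _ hasFDerivAt_fst)).sub hvol)).congr_fderiv ?_
  refine ContinuousLinearMap.ext fun x => Prod.ext rfl ?_
  have h : x.2 - k x.1 - B (x.1.1, x.2) = x.2 + (-k x.1 - B (x.1.1, 0)) := by
    rw [hB]
    abel
  exact h

/- As `X (p₀, ·) = 0`, the derivative of `integralEquation` at the constant solution is unipotent,
so the inverse function theorem on `C(I, Y)` gives the flow and its smoothness at the same time. -/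
theorem exists_contDiffOn_flow [CompleteSpace P] [CompleteSpace Y] {X : P × Y → Y}
    {Ω : Set (P × Y)} (hΩ : IsOpen Ω) (hX : ContDiffOn 𝕜 ∞ X Ω) {p₀ : P} {y₀ : Y}
    (h₀ : (p₀, y₀) ∈ Ω) (hX₀ : ∀ y, X (p₀, y) = 0) :
    ∃ (U : Set (P × Y)) (c : P × Y → C(I, Y)), IsOpen U ∧ (p₀, y₀) ∈ U ∧ ContDiffOn 𝕜 ∞ c U ∧
      (∀ q ∈ U, ∀ t, (q.1, c q t) ∈ Ω) ∧ (∀ q ∈ U, c q = ContinuousMap.const I q.2 +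
        volterra 𝕜 Y (superposition X (withParameter 𝕜 P Y (q.1, c q)))) ∧
      c (p₀, y₀) = ContinuousMap.const I y₀ := by
  obtain ⟨R, hR⟩ := hasFDerivAt_integralEquation hΩ hX h₀ hX₀
  have hopen : IsOpen {x : (P × Y) × C(I, Y) | ∀ t, (x.1.1, x.2 t) ∈ Ω} := by
    simpa using (isOpen_setOf_forall_mem (K := I) hΩ).preimage
      ((withParameter 𝕜 P Y).continuous.comp ((continuous_fst.comp continuous_fst).prodMk
        (continuous_snd (X := P × Y) (Y := C(I, Y)))))
  obtain ⟨Ψ, hmem, hsub, hΨ, hsmooth⟩ := exists_openPartialHomeomorph_of_hasFDerivAt hopen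
    (contDiffOn_integralEquation hΩ hX) (fun _ => h₀) _ hR
  have hΨ₀ : Ψ ((p₀, y₀), ContinuousMap.const I y₀) = ((p₀, y₀), 0) := by
    simp [hΨ, integralEquation, hX₀, ContinuousMap.const_zero]
  have hfst {q : P × Y} (hq : (q, (0 : C(I, Y))) ∈ Ψ.target) : (Ψ.symm (q, 0)).1 = q := by
    have h := Ψ.right_inv hq
    rw [hΨ] at h
    exact congr(($h).1)
  refine ⟨(fun q => (q, 0)) ⁻¹' Ψ.target, fun q => (Ψ.symm (q, 0)).2,
    Ψ.open_target.preimage (by fun_prop), ?_, ?_, fun q hq t => ?_, fun q hq => ?_, ?_⟩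
  · exact mem_preimage.2 (hΨ₀ ▸ Ψ.map_source hmem)
  · exact (hsmooth.comp (contDiff_prodMk_left 0).contDiffOn fun _ hq => hq).snd
  · simpa [hfst hq] using hsub (Ψ.map_target hq) t
  · have h := Ψ.right_inv hq
    rw [hΨ, integralEquation, hfst hq] at h
    exact eq_add_of_sub_eq' (sub_eq_zero.1 congr(($h).2))
  · have h := Ψ.left_inv hmem
    rw [hΨ₀] at h
    exact congr(($h).2)

theorem fderiv_flow {X : P × Y → Y} {Ω U : Set (P × Y)} (hΩ : IsOpen Ω)
    (hX : ContDiffOn 𝕜 ∞ X Ω) (hU : IsOpen U) {c : P × Y → C(I, Y)} (hc : ContDiffOn 𝕜 ∞ c U)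
    (hcΩ : ∀ q ∈ U, ∀ t, (q.1, c q t) ∈ Ω)
    (hcX : ∀ q ∈ U, c q = ContinuousMap.const I q.2 +
      volterra 𝕜 Y (superposition X (withParameter 𝕜 P Y (q.1, c q))))
    {q : P × Y} (hq : q ∈ U) (v : P × Y) :
    fderiv 𝕜 c q v = ContinuousMap.const I v.2 +
      volterra 𝕜 Y (pointwiseEval 𝕜 I (P × Y) Y
        (superposition (fderiv 𝕜 X) (withParameter 𝕜 P Y (q.1, c q)))
        (withParameter 𝕜 P Y (v.1, fderiv 𝕜 c q v))) := by
  have hcd : HasFDerivAt c (fderiv 𝕜 c q) q :=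
    ((hc.contDiffAt (hU.mem_nhds hq)).differentiableAt (by simp)).hasFDerivAt
  have hvol := ((volterra 𝕜 Y).hasFDerivAt.comp _ <|
    hasFDerivAt_superposition_withParameter hΩ hX (hcΩ q hq)).comp q
      (hasFDerivAt_fst.prodMk hcd)
  have h := (((ContinuousLinearMap.const 𝕜 I : Y →L[𝕜] C(I, Y)).hasFDerivAt.comp q
    hasFDerivAt_snd).add hvol).congr_of_eventuallyEq
      (eventually_of_mem (hU.mem_nhds hq) hcX)
  exact congr($(hcd.unique h) v)

end Flow

/-! ### Frobenius' theorem for distributions of graphs -/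

section Frobenius

open scoped unitInterval

universe u

variable {𝕜 : Type*} [RCLike 𝕜] {V W : Type u}
  [NormedAddCommGroup V] [NormedSpace 𝕜 V] [NormedAddCommGroup W] [NormedSpace 𝕜 W]

/-- The field `u ↦ (u, A y u)` spanned by the distribution of graphs of `A y : V → W`. -/
def graphField (A : V × W → V →L[𝕜] W) (x : V × (V × W)) : V × W :=
  (x.1, A x.2 x.1)

theorem fderiv_graphField_apply {A : V × W → V →L[𝕜] W} {x : V × (V × W)}
    (hA : DifferentiableAt 𝕜 A x.2) (v : V) (ξ : V × W) :
    fderiv 𝕜 (graphField A) x (v, ξ) = (v, fderiv 𝕜 A x.2 ξ x.1 + A x.2 v) := by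
  have h : HasFDerivAt (graphField A) _ x :=
    hasFDerivAt_fst.prodMk ((hA.hasFDerivAt.comp x hasFDerivAt_snd).clm_apply hasFDerivAt_fst)
  rw [h.fderiv]
  simp [add_comm]

theorem contDiffOn_graphField {A : V × W → V →L[𝕜] W} {Ω : Set (V × W)}
    (hA : ContDiffOn 𝕜 ∞ A Ω) : ContDiffOn 𝕜 ∞ (graphField A) (univ ×ˢ Ω) :=
  contDiff_fst.contDiffOn.prodMk
    ((hA.comp contDiff_snd.contDiffOn fun _ hx => hx.2).clm_apply contDiff_fst.contDiffOn)

variable [NormedSpace ℝ V] [IsScalarTower ℝ 𝕜 V] [NormedSpace ℝ W] [IsScalarTower ℝ 𝕜 W]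

theorem eq_zero_of_hasDerivWithinAt_clm_apply {B : ℝ → W →L[ℝ] W} {a b : ℝ}
    (hB : ContinuousOn B (Icc a b)) {η : ℝ → W}
    (hη : ∀ t ∈ Icc a b, HasDerivWithinAt η (B t (η t)) (Icc a b) t) (h₀ : η a = 0) :
    ∀ t ∈ Icc a b, η t = 0 := by
  obtain ⟨C, hC⟩ := isCompact_Icc.exists_bound_of_continuousOn hB
  refine eq_zero_of_abs_deriv_le_mul_abs_self_of_eq_zero_right (K := C)
    (fun t ht => (hη t ht).continuousWithinAt) (fun t ht => ?_) h₀
    fun t ht => (B t).le_of_opNorm_le (hC t (Ico_subset_Icc_self ht)) (η t)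
  exact (hη t (Ico_subset_Icc_self ht)).mono_of_mem_nhdsWithin (Icc_mem_nhdsGE_of_mem ht)

/- By integrability, the defect `ξ.2 - A γ ξ.1` of a variation `ξ` of `γ` solves a linear
differential equation. -/
theorem snd_eq_of_hasDerivWithinAt {A : V × W → V →L[𝕜] W} {Ω : Set (V × W)} (hΩ : IsOpen Ω)
    (hA : ContDiffOn 𝕜 1 A Ω)
    (hint : ∀ z ∈ Ω, ∀ u v, fderiv 𝕜 A z (u, A z u) v = fderiv 𝕜 A z (v, A z v) u)
    {γ ξ : ℝ → V × W} {u v : V} (hγΩ : ∀ t ∈ I, γ t ∈ Ω)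
    (hγ : ∀ t ∈ I, HasDerivWithinAt γ (u, A (γ t) u) I t)
    (hξ : ∀ t ∈ I, HasDerivWithinAt ξ (v, fderiv 𝕜 A (γ t) (ξ t) u + A (γ t) v) I t)
    (h₀ : (ξ 0).2 = A (γ 0) (ξ 0).1) : ∀ t ∈ I, (ξ t).2 = A (γ t) (ξ t).1 := by
  set η : ℝ → W := fun t => (ξ t).2 - A (γ t) (ξ t).1 with hη
  have hηderiv : ∀ t ∈ I, HasDerivWithinAt η (fderiv 𝕜 A (γ t) (0, η t) u) I t := by
    intro t ht
    have hAd : HasFDerivAt A (fderiv 𝕜 A (γ t)) (γ t) :=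
      ((hA.contDiffAt (hΩ.mem_nhds (hγΩ t ht))).differentiableAt one_ne_zero).hasFDerivAt
    have hdefect : HasFDerivAt (fun x : (V × W) × (V × W) => x.2.2 - A x.1 x.2.1) _ (γ t, ξ t) :=
      hasFDerivAt_snd.snd.sub ((hAd.comp (γ t, ξ t) hasFDerivAt_fst).clm_apply hasFDerivAt_snd.fst)
    refine ((hdefect.restrictScalars ℝ).comp_hasDerivWithinAt t
      ((hγ t ht).prodMk (hξ t ht))).congr_deriv ?_
    have hsplit : ξ t = ((ξ t).1, A (γ t) (ξ t).1) + (0, η t) := by simp [hη]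
    have h := hint (γ t) (hγΩ t ht) u (ξ t).1
    have h' := congr(fderiv 𝕜 A (γ t) $hsplit u)
    rw [map_add, add_apply, ← h] at h'
    simp only [ContinuousLinearMap.restrictScalars_sub, ContinuousLinearMap.restrictScalars_add, h',
      sub_apply, add_apply, ContinuousLinearMap.coe_restrictScalars',
      ContinuousLinearMap.comp_apply, ContinuousLinearMap.coe_snd', ContinuousLinearMap.coe_fst',
      ContinuousLinearMap.flip_apply]
    abel
  have hcont : ContinuousOn (fun t => (ContinuousLinearMap.apply 𝕜 W u ∘L
      fderiv 𝕜 A (γ t) ∘L ContinuousLinearMap.inr 𝕜 V W).restrictScalars ℝ) I := by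
    refine (ContinuousLinearMap.restrictScalarsL 𝕜 W W ℝ ℝ).continuous.comp_continuousOn
      (continuousOn_const.clm_comp (ContinuousOn.clm_comp ?_ continuousOn_const))
    exact (hA.continuousOn_fderiv_of_isOpen hΩ le_rfl).comp
      (fun t ht => (hγ t ht).continuousWithinAt) hγΩ
  intro t ht
  exact sub_eq_zero.1 (eq_zero_of_hasDerivWithinAt_clm_apply hcont hηderiv (sub_eq_zero.2 h₀) t ht)

theorem variation_graphField_vertical {A : V × W → V →L[𝕜] W} (hA : DifferentiableAt 𝕜 A 0)
    {ξ : C(I, V × W)} {y : V × W}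
    (hξ : ξ = ContinuousMap.const I y + volterra 𝕜 (V × W) (pointwiseEval 𝕜 I _ _
      (superposition (fderiv 𝕜 (graphField A))
        (withParameter 𝕜 V (V × W) (0, ContinuousMap.const I 0)))
      (withParameter 𝕜 V (V × W) (0, ξ)))) :
    ξ = ContinuousMap.const I y := by
  have h : pointwiseEval 𝕜 I _ _ (superposition (fderiv 𝕜 (graphField A))
      (withParameter 𝕜 V (V × W) (0, ContinuousMap.const I 0)))
      (withParameter 𝕜 V (V × W) (0, ξ)) = 0 := by
    ext t : 1
    rw [pointwiseEval_apply, withParameter_const, superposition_const, ContinuousMap.const_apply,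
      withParameter_apply, fderiv_graphField_apply hA]
    simp
  rw [hξ, h, map_zero, add_zero]

theorem hasDerivWithinAt_integralCurve_graphField [CompleteSpace V] [CompleteSpace W]
    {A : V × W → V →L[𝕜] W} {Ω : Set (V × W)} (hA : ContDiffOn 𝕜 ∞ A Ω)
    {γ : C(I, V × W)} {u : V} {y : V × W} (hγΩ : ∀ t, γ t ∈ Ω)
    (hγ : γ = ContinuousMap.const I y + volterra 𝕜 (V × W)
      (superposition (graphField A) (withParameter 𝕜 V (V × W) (u, γ)))) {t : ℝ} (ht : t ∈ I) :
    HasDerivWithinAt (IccExtend zero_le_one γ) (u, A (IccExtend zero_le_one γ t) u) I t := by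
  have h := hasDerivWithinAt_const_add_volterra (𝕜 := 𝕜) y
    (superposition (graphField A) (withParameter 𝕜 V (V × W) (u, γ))) ht
  rw [← hγ, superposition_apply (contDiffOn_graphField hA).continuousOn
    (by simpa using hγΩ), withParameter_apply, graphField] at h
  rwa [IccExtend_of_mem _ _ ht]

theorem hasDerivWithinAt_variation_graphField [CompleteSpace V] [CompleteSpace W]
    {A : V × W → V →L[𝕜] W} {Ω : Set (V × W)} (hΩ : IsOpen Ω) (hA : ContDiffOn 𝕜 ∞ A Ω)
    {γ ξ : C(I, V × W)} {u v : V} {y : V × W} (hγΩ : ∀ t, γ t ∈ Ω)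
    (hξ : ξ = ContinuousMap.const I y + volterra 𝕜 (V × W) (pointwiseEval 𝕜 I _ _
      (superposition (fderiv 𝕜 (graphField A)) (withParameter 𝕜 V (V × W) (u, γ)))
      (withParameter 𝕜 V (V × W) (v, ξ)))) {t : ℝ} (ht : t ∈ I) :
    HasDerivWithinAt (IccExtend zero_le_one ξ)
      (v, fderiv 𝕜 A (IccExtend zero_le_one γ t) (IccExtend zero_le_one ξ t) u +
        A (IccExtend zero_le_one γ t) v) I t := by
  have h := hasDerivWithinAt_const_add_volterra (𝕜 := 𝕜) y (pointwiseEval 𝕜 I _ _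
    (superposition (fderiv 𝕜 (graphField A)) (withParameter 𝕜 V (V × W) (u, γ)))
    (withParameter 𝕜 V (V × W) (v, ξ))) ht
  have hX' := (contDiffOn_graphField hA).continuousOn_fderiv_of_isOpen
    (isOpen_univ.prod hΩ) (by simp)
  rw [← hξ, pointwiseEval_apply, superposition_apply hX' (by simpa using hγΩ),
    withParameter_apply, withParameter_apply, fderiv_graphField_apply
      ((hA.contDiffAt (hΩ.mem_nhds (hγΩ _))).differentiableAt (by simp))] at h
  rwa [IccExtend_of_mem _ _ ht, IccExtend_of_mem _ _ ht]

theorem variation_graphField_horizontal [CompleteSpace V] [CompleteSpace W]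
    {A : V × W → V →L[𝕜] W} {Ω : Set (V × W)} (hΩ : IsOpen Ω) (hA : ContDiffOn 𝕜 ∞ A Ω)
    (hint : ∀ z ∈ Ω, ∀ u v, fderiv 𝕜 A z (u, A z u) v = fderiv 𝕜 A z (v, A z v) u)
    {γ ξ : C(I, V × W)} {u v : V} {y : V × W} (hγΩ : ∀ t, γ t ∈ Ω)
    (hγ : γ = ContinuousMap.const I y + volterra 𝕜 (V × W)
      (superposition (graphField A) (withParameter 𝕜 V (V × W) (u, γ))))
    (hξ : ξ = ContinuousMap.const I 0 + volterra 𝕜 (V × W) (pointwiseEval 𝕜 I _ _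
      (superposition (fderiv 𝕜 (graphField A)) (withParameter 𝕜 V (V × W) (u, γ)))
      (withParameter 𝕜 V (V × W) (v, ξ)))) :
    ξ 1 = (v, A (γ 1) v) := by
  have hγ' := fun t ht => hasDerivWithinAt_integralCurve_graphField hA hγΩ hγ (t := t) ht
  have hξ' := fun t ht => hasDerivWithinAt_variation_graphField hΩ hA hγΩ hξ (t := t) ht
  have hξ₀ : ξ 0 = 0 := by
    rw [hξ, ContinuousMap.add_apply, volterra_zero, add_zero, ContinuousMap.const_apply]
  have hfst : (ξ 1).1 = v := by
    have h : ∀ t ∈ I, (IccExtend zero_le_one ξ t).1 - t • v = 0 := by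
      refine eq_zero_of_hasDerivWithinAt_clm_apply (B := 0) continuousOn_const (fun t ht => ?_) ?_
      · have h := (ContinuousLinearMap.fst ℝ V W).hasFDerivAt.comp_hasDerivWithinAt t (hξ' t ht)
        exact (h.sub ((hasDerivWithinAt_id t I).smul_const v)).congr_deriv (by simp)
      · simp [hξ₀]
    simpa [sub_eq_zero] using h 1 (right_mem_Icc.2 zero_le_one)
  have hsnd := snd_eq_of_hasDerivWithinAt hΩ (hA.of_le (by simp)) hint
    (fun t _ => hγΩ _) hγ' hξ' (by simp [hξ₀]) 1 (right_mem_Icc.2 zero_le_one)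
  exact Prod.ext hfst (by simpa [hfst] using hsnd)

/- The parametrization sends `(u, w)` to the time-one flow from `(0, w)` of the field
`y ↦ (u, A y u)`. -/
theorem exists_frobenius_parametrization [CompleteSpace V] [CompleteSpace W]
    {A : V × W → V →L[𝕜] W} {Ω : Set (V × W)} (hΩ : IsOpen Ω) (h₀ : (0 : V × W) ∈ Ω)
    (hA : ContDiffOn 𝕜 ∞ A Ω)
    (hint : ∀ z ∈ Ω, ∀ u v, fderiv 𝕜 A z (u, A z u) v = fderiv 𝕜 A z (v, A z v) u) :
    ∃ (U : Set (V × W)) (ψ : V × W → V × W), IsOpen U ∧ 0 ∈ U ∧ ContDiffOn 𝕜 ∞ ψ U ∧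
      MapsTo ψ U Ω ∧ ψ 0 = 0 ∧ (∀ w, fderiv 𝕜 ψ 0 (0, w) = (0, w)) ∧
      ∀ z ∈ U, ∀ v, fderiv 𝕜 ψ z (v, 0) = (v, A (ψ z) v) := by
  have hX := contDiffOn_graphField hA
  have hΩ' : IsOpen ((univ : Set V) ×ˢ Ω) := isOpen_univ.prod hΩ
  obtain ⟨U, c, hU, h₀U, hc, hcΩ, hcX, hc₀⟩ := exists_contDiffOn_flow (p₀ := (0 : V))
    (y₀ := (0 : V × W)) hΩ' hX (by simpa using h₀) (by simp [graphField])
  let j : V × W →L[𝕜] V × (V × W) :=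
    (ContinuousLinearMap.fst 𝕜 V W).prod (.inr 𝕜 V W ∘L .snd 𝕜 V W)
  let e : C(I, V × W) →L[𝕜] V × W := ContinuousMap.evalCLM 𝕜 1
  have hj₀ : (j 0) ∈ U := by rwa [map_zero]
  have hderiv {z : V × W} (hz : j z ∈ U) (v : V × W) :
      fderiv 𝕜 (e ∘ c ∘ j) z v = fderiv 𝕜 c (j z) (j v) 1 := by
    have hcd : HasFDerivAt c (fderiv 𝕜 c (j z)) (j z) :=
      ((hc.contDiffAt (hU.mem_nhds hz)).differentiableAt (by simp)).hasFDerivAt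
    rw [(e.hasFDerivAt.comp z (hcd.comp z j.hasFDerivAt)).fderiv]
    rfl
  refine ⟨j ⁻¹' U, e ∘ c ∘ j, hU.preimage j.continuous, hj₀,
    e.contDiff.comp_contDiffOn (hc.comp j.contDiff.contDiffOn fun _ hz => hz),
    fun z hz => (hcΩ _ hz 1).2, ?_, fun w => ?_, fun z hz v => ?_⟩
  · exact congr($hc₀ 1)
  · rw [hderiv hj₀]
    have hξ := fderiv_flow hΩ' hX hU hc hcΩ hcX h₀U (j (0, w))
    rw [hc₀] at hξ
    have hAd := (hA.contDiffAt (hΩ.mem_nhds h₀)).differentiableAt (by simp)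
    exact congr($(variation_graphField_vertical hAd hξ) 1)
  · rw [hderiv hz]
    exact variation_graphField_horizontal hΩ hA hint (fun t => (hcΩ _ hz t).2) (hcX _ hz)
      (fderiv_flow hΩ' hX hU hc hcΩ hcX hz (j (v, 0)))

theorem fderiv_symm_apply_fderiv {E F : Type*} [NormedAddCommGroup E] [NormedSpace 𝕜 E]
    [NormedAddCommGroup F] [NormedSpace 𝕜 F] (Ψ : OpenPartialHomeomorph E F) {x : E}
    (hx : x ∈ Ψ.source) (h : DifferentiableAt 𝕜 Ψ x) (h' : DifferentiableAt 𝕜 Ψ.symm (Ψ x))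
    (v : E) : fderiv 𝕜 Ψ.symm (Ψ x) (fderiv 𝕜 Ψ x v) = v := by
  have hid := (h'.hasFDerivAt.comp x h.hasFDerivAt).congr_of_eventuallyEq
    (Ψ.eventually_left_inverse hx |>.mono fun _ h => h.symm)
  exact congr($(hid.unique (hasFDerivAt_id x)) v)

theorem exists_frobenius_chart [CompleteSpace V] [CompleteSpace W]
    {A : V × W → V →L[𝕜] W} {Ω : Set (V × W)} (hΩ : IsOpen Ω) (h₀ : (0 : V × W) ∈ Ω)
    (hA : ContDiffOn 𝕜 ∞ A Ω)
    (hint : ∀ z ∈ Ω, ∀ u v, fderiv 𝕜 A z (u, A z u) v = fderiv 𝕜 A z (v, A z v) u) :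
    ∃ Φ : OpenPartialHomeomorph (V × W) (V × W), 0 ∈ Φ.source ∧ Φ.source ⊆ Ω ∧
      ContDiffOn 𝕜 ∞ Φ Φ.source ∧ ContDiffOn 𝕜 ∞ Φ.symm Φ.target ∧
      ∀ z ∈ Φ.source, ∀ v, (fderiv 𝕜 Φ z v).2 = 0 ↔ v.2 = A z v.1 := by
  obtain ⟨U, ψ, hU, h₀U, hψ, hψΩ, hψ₀, hvert, hhor⟩ :=
    exists_frobenius_parametrization hΩ h₀ hA hint
  have hψ' {z : V × W} (hz : z ∈ U) : DifferentiableAt 𝕜 ψ z :=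
    (hψ.contDiffAt (hU.mem_nhds hz)).differentiableAt (by simp)
  let L := ContinuousLinearEquiv.skewProd (.refl 𝕜 V) (.refl 𝕜 W) (A 0)
  have hL : HasFDerivAt ψ (L : V × W →L[𝕜] V × W) 0 := by
    refine (hψ' h₀U).hasFDerivAt.congr_fderiv (ContinuousLinearMap.ext fun v => ?_)
    rw [← Prod.fst_add_snd v, map_add, hhor 0 h₀U, hvert, hψ₀]
    simp [L, add_comm]
  obtain ⟨Ψ, h₀Ψ, hΨU, hΨψ, hΨsymm⟩ := exists_openPartialHomeomorph_of_hasFDerivAt hU hψ h₀U L hL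
  obtain rfl : (Ψ : V × W → V × W) = ψ := funext hΨψ
  refine ⟨Ψ.symm, hψ₀ ▸ Ψ.map_source h₀Ψ, fun z hz => ?_, hΨsymm, hψ.mono hΨU, fun z hz v => ?_⟩
  · exact Ψ.right_inv hz ▸ hψΩ (hΨU (Ψ.map_target hz))
  · obtain ⟨x, hx, rfl⟩ : ∃ x ∈ Ψ.source, Ψ x = z :=
      ⟨Ψ.symm z, Ψ.map_target hz, Ψ.right_inv hz⟩
    have hd : DifferentiableAt 𝕜 Ψ x := hψ' (hΨU hx)
    have hd' : DifferentiableAt 𝕜 Ψ.symm (Ψ x) :=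
      (hΨsymm.contDiffAt (Ψ.open_target.mem_nhds hz)).differentiableAt (by simp)
    have hsymm := fderiv_symm_apply_fderiv Ψ.symm hz hd' (by rwa [Ψ.symm_symm, Ψ.left_inv hx])
    rw [Ψ.symm_symm, Ψ.left_inv hx] at hsymm
    constructor <;> intro h
    · have hv := hsymm v
      rw [← Prod.mk.eta (p := fderiv 𝕜 Ψ.symm (Ψ x) v), h, hhor x (hΨU hx)] at hv
      rw [← hv]
    · have hv := fderiv_symm_apply_fderiv Ψ hx hd hd' (v.1, 0)
      rw [hhor x (hΨU hx), ← h, Prod.mk.eta] at hv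
      rw [hv]

end Frobenius

section ComplexLinear

universe u

variable {V W : Type*} [NormedAddCommGroup V] [NormedSpace ℂ V]
  [NormedAddCommGroup W] [NormedSpace ℂ W]

theorem complex_smul_eq (c : ℂ) (w : W) : c • w = c.re • w + c.im • Complex.I • w := by
  nth_rewrite 1 [← Complex.re_add_im c]
  rw [add_smul, mul_smul, Complex.coe_smul, Complex.coe_smul]

/-- A real linear map commuting with multiplication by `i`, regarded as a complex linear map. -/
def complexOfCommute (T : V →L[ℝ] W) (hT : ∀ v, T (Complex.I • v) = Complex.I • T v) :
    V →L[ℂ] W where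
  toFun := T
  map_add' := map_add T
  map_smul' c v := by
    rw [complex_smul_eq c v, map_add, map_smul, map_smul, hT, RingHom.id_apply, ← complex_smul_eq]
  cont := T.continuous

theorem differentiableAt_complex_of_fderiv {f : V → W} {x : V} (hf : DifferentiableAt ℝ f x)
    (h : ∀ v, fderiv ℝ f x (Complex.I • v) = Complex.I • fderiv ℝ f x v) :
    DifferentiableAt ℂ f x :=
  (differentiableAt_iff_restrictScalars ℝ hf).2 ⟨complexOfCommute (fderiv ℝ f x) h, rfl⟩

theorem fderiv_real_apply_eq_fderiv_complex_apply {f : V → W} {x : V}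
    (hf : DifferentiableAt ℂ f x) (v : V) : fderiv ℝ f x v = fderiv ℂ f x v :=
  congr($(hf.fderiv_restrictScalars ℝ) v)

/- The Cauchy-Riemann equations of `f`, differentiated: the second derivative is symmetric. -/
theorem fderiv_fderiv_apply_I_smul {f : V → W} {U : Set V} (hU : IsOpen U)
    (hf : ContDiffOn ℝ ∞ f U)
    (hCR : ∀ z ∈ U, ∀ v, fderiv ℝ f z (Complex.I • v) = Complex.I • fderiv ℝ f z v)
    {z : V} (hz : z ∈ U) (v w : V) :
    fderiv ℝ (fun z => fderiv ℝ f z v) z (Complex.I • w) =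
      Complex.I • fderiv ℝ (fun z => fderiv ℝ f z v) z w := by
  have hfz : ContDiffAt ℝ ∞ f z := hf.contDiffAt (hU.mem_nhds hz)
  have hsymm : IsSymmSndFDerivAt ℝ f z :=
    hfz.isSymmSndFDerivAt (by rw [minSmoothness_of_isRCLikeNormedField]; norm_cast)
  have hdd : DifferentiableAt ℝ (fderiv ℝ f) z :=
    (hfz.fderiv_right (m := 1) (by norm_cast)).differentiableAt one_ne_zero
  have happly (u : V) : HasFDerivAt (fun z => fderiv ℝ f z u)
      ((fderiv ℝ (fderiv ℝ f) z).flip u) z := by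
    simpa using hdd.hasFDerivAt.clm_apply (hasFDerivAt_const u z)
  have hI : (fderiv ℝ (fderiv ℝ f) z).flip (Complex.I • w) =
      Complex.I • (fderiv ℝ (fderiv ℝ f) z).flip w :=
    ((happly _).congr_of_eventuallyEq (eventually_of_mem (hU.mem_nhds hz)
      fun y hy => (hCR y hy w).symm)).unique ((happly w).const_smul Complex.I)
  have h := congr($hI v)
  simpa only [(happly v).fderiv, ContinuousLinearMap.flip_apply, smul_apply, hsymm.eq _ v]
    using h

theorem contDiffOn_complex_of_fderiv [FiniteDimensional ℂ V] {f : V → W} {U : Set V}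
    (hU : IsOpen U) (hf : ContDiffOn ℝ ∞ f U)
    (hCR : ∀ z ∈ U, ∀ v, fderiv ℝ f z (Complex.I • v) = Complex.I • fderiv ℝ f z v) :
    ContDiffOn ℂ ∞ f U := by
  refine contDiffOn_infty.2 fun n => ?_
  induction n generalizing f with
  | zero => exact contDiffOn_zero.2 hf.continuousOn
  | succ n ih =>
    have hd {z : V} (hz : z ∈ U) : DifferentiableAt ℂ f z :=
      differentiableAt_complex_of_fderiv
        ((hf.contDiffAt (hU.mem_nhds hz)).differentiableAt (by simp)) (hCR z hz)
    rw [Nat.cast_succ, contDiffOn_succ_iff_fderiv_of_isOpen hU]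
    refine ⟨fun z hz => (hd hz).differentiableWithinAt, by simp, contDiffOn_clm_apply.2 fun v => ?_⟩
    have hv : ContDiffOn ℝ ∞ (fun z => fderiv ℝ f z v) U :=
      (hf.fderiv_of_isOpen hU (by simp)).clm_apply contDiffOn_const
    exact (ih hv fun z hz => fderiv_fderiv_apply_I_smul hU hf hCR hz v).congr
      fun z hz => (fderiv_real_apply_eq_fderiv_complex_apply (hd hz) v).symm

theorem exists_holomorphic_frobenius_chart {V W : Type u} [NormedAddCommGroup V] [NormedSpace ℂ V]
    [FiniteDimensional ℂ V] [NormedAddCommGroup W] [NormedSpace ℂ W] [FiniteDimensional ℂ W]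
    {A : V × W → V →L[ℝ] W} {Ω : Set (V × W)} (hΩ : IsOpen Ω) (h₀ : (0 : V × W) ∈ Ω)
    (hA : ContDiffOn ℝ ∞ A Ω) (hAI : ∀ z ∈ Ω, ∀ v, A z (Complex.I • v) = Complex.I • A z v)
    (hCR : ∀ z ∈ Ω, ∀ c v, fderiv ℝ A z (Complex.I • c) v = Complex.I • fderiv ℝ A z c v)
    (hint : ∀ z ∈ Ω, ∀ u v, fderiv ℝ A z (u, A z u) v = fderiv ℝ A z (v, A z v) u) :
    ∃ Φ : OpenPartialHomeomorph (V × W) (V × W), 0 ∈ Φ.source ∧ Φ.source ⊆ Ω ∧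
      ContDiffOn ℂ ∞ Φ Φ.source ∧ ContDiffOn ℂ ∞ Φ.symm Φ.target ∧
      ∀ z ∈ Φ.source, ∀ v, (fderiv ℂ Φ z v).2 = 0 ↔ v.2 = A z v.1 := by
  classical
  let B : V × W → V →L[ℂ] W := fun z => if hz : z ∈ Ω then complexOfCommute (A z) (hAI z hz) else 0
  have hBA {z : V × W} (hz : z ∈ Ω) (v : V) : B z v = A z v := by
    simp only [B, dif_pos hz]
    rfl
  have hAv {z : V × W} (hz : z ∈ Ω) (v : V) :
      HasFDerivAt (fun z => A z v) ((fderiv ℝ A z).flip v) z := by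
    simpa using ((hA.contDiffAt (hΩ.mem_nhds hz)).differentiableAt
      (by simp)).hasFDerivAt.clm_apply (hasFDerivAt_const v z)
  have hB : ContDiffOn ℂ ∞ B Ω := contDiffOn_clm_apply.2 fun v => by
    refine (contDiffOn_complex_of_fderiv hΩ (hA.clm_apply contDiffOn_const) fun z hz c => ?_).congr
      fun z hz => hBA hz v
    rw [(hAv hz v).fderiv]
    exact hCR z hz c v
  have hBd {z : V × W} (hz : z ∈ Ω) (c : V × W) (v : V) : fderiv ℂ B z c v = fderiv ℝ A z c v := by
    have hBv : HasFDerivAt (fun z => B z v) ((fderiv ℂ B z).flip v) z := by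
      simpa using ((hB.contDiffAt (hΩ.mem_nhds hz)).differentiableAt
        (by simp)).hasFDerivAt.clm_apply (hasFDerivAt_const v z)
    exact congr($((hBv.restrictScalars ℝ).unique ((hAv hz v).congr_of_eventuallyEq
      (eventually_of_mem (hΩ.mem_nhds hz) fun y hy => hBA hy v))) c)
  obtain ⟨Φ, h₀Φ, hΦΩ, hΦ, hΦsymm, hker⟩ := exists_frobenius_chart hΩ h₀ hB fun z hz u v => by
    rw [hBd hz, hBd hz, hBA hz, hBA hz, hint z hz]
  exact ⟨Φ, h₀Φ, hΦΩ, hΦ, hΦsymm, fun z hz v => by rw [hker z hz, hBA (hΦΩ hz)]⟩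

end ComplexLinear

/-! ### Charts and vector fields -/

section Charts

/-- Vector fields on `M`, not assumed to be smooth. -/
abbrev TangentField (E : Type*) [NormedAddCommGroup E] [NormedSpace ℝ E]
    (M : Type*) [TopologicalSpace M] [ChartedSpace E M] : Type _ :=
  ∀ x : M, TangentSpace 𝓘(ℝ, E) x

variable {E : Type*} [NormedAddCommGroup E] [NormedSpace ℝ E]
  {M : Type*} [TopologicalSpace M] [ChartedSpace E M]
  {F : Type*} [NormedAddCommGroup F] [NormedSpace ℝ F]

/-- `φ` is a diffeomorphism from an open subset of `M` onto an open subset of `F`. -/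
structure IsSmoothChart (φ : OpenPartialHomeomorph M F) : Prop where
  smooth : ContMDiffOn 𝓘(ℝ, E) 𝓘(ℝ, F) ∞ φ φ.source
  smooth_symm : ContMDiffOn 𝓘(ℝ, F) 𝓘(ℝ, E) ∞ φ.symm φ.target

/-- The differential of a map into a real normed space, with values in that space. -/
def rdiff (φ : M → F) (y : M) : TangentSpace 𝓘(ℝ, E) y →L[ℝ] F :=
  mfderiv 𝓘(ℝ, E) 𝓘(ℝ, F) φ y

/-- `X` is a vector field which is smooth near `y`. -/
def SmoothFieldAt [IsManifold 𝓘(ℝ, E) ∞ M] (X : TangentField E M) (y : M) : Prop :=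
  ContMDiffAt 𝓘(ℝ, E) 𝓘(ℝ, E).tangent ∞ (fun x => (⟨x, X x⟩ : TangentBundle 𝓘(ℝ, E) M)) y

/-- The expression of a vector field in a chart. -/
def push (φ : OpenPartialHomeomorph M F) (X : TangentField E M) (z : F) : F :=
  rdiff φ (φ.symm z) (X (φ.symm z))

/-- The vector field with a given expression in a chart. -/
def pull (φ : OpenPartialHomeomorph M F) (Y : F → F) : TangentField E M :=
  mpullback 𝓘(ℝ, E) 𝓘(ℝ, F) φ Y

theorem mlieBracket_eq_lieBracket (V W : TangentField F F) :
    mlieBracket 𝓘(ℝ, F) V W = lieBracket ℝ V W := by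
  rw [← mlieBracketWithin_univ, mlieBracketWithin_eq_lieBracketWithin]
  exact lieBracketWithin_univ

theorem push_apply (φ : OpenPartialHomeomorph M F) (X : TangentField E M) {y : M}
    (hy : y ∈ φ.source) : push φ X (φ y) = rdiff φ y (X y) := by
  rw [push, φ.left_inv hy]

namespace IsSmoothChart

variable {φ : OpenPartialHomeomorph M F}

theorem mdifferentiable (hφ : IsSmoothChart (E := E) φ) :
    φ.MDifferentiable 𝓘(ℝ, E) 𝓘(ℝ, F) :=
  ⟨hφ.smooth.mdifferentiableOn (by simp), hφ.smooth_symm.mdifferentiableOn (by simp)⟩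

theorem isInvertible (hφ : IsSmoothChart (E := E) φ) {y : M} (hy : y ∈ φ.source) :
    (mfderiv 𝓘(ℝ, E) 𝓘(ℝ, F) φ y).IsInvertible :=
  ⟨hφ.mdifferentiable.mfderiv hy, rfl⟩

theorem isInvertible_symm (hφ : IsSmoothChart (E := E) φ) {z : F} (hz : z ∈ φ.target) :
    (mfderiv 𝓘(ℝ, F) 𝓘(ℝ, E) φ.symm z).IsInvertible :=
  ⟨hφ.mdifferentiable.symm.mfderiv hz, rfl⟩

theorem rdiff_injective (hφ : IsSmoothChart (E := E) φ) {y : M} (hy : y ∈ φ.source) :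
    Function.Injective (rdiff (E := E) φ y) :=
  (hφ.mdifferentiable.mfderiv hy).injective

theorem rdiff_surjective (hφ : IsSmoothChart (E := E) φ) {y : M} (hy : y ∈ φ.source) :
    Function.Surjective (rdiff (E := E) φ y) :=
  (hφ.mdifferentiable.mfderiv hy).surjective

theorem rdiff_pull (hφ : IsSmoothChart (E := E) φ) (Y : F → F) {y : M} (hy : y ∈ φ.source) :
    rdiff φ y (pull (E := E) φ Y y) = Y (φ y) :=
  ((hφ.isInvertible hy).inverse_apply_eq.1 rfl).symm

theorem push_pull (hφ : IsSmoothChart (E := E) φ) (Y : F → F) {z : F} (hz : z ∈ φ.target) :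
    push φ (pull (E := E) φ Y) z = Y z := by
  rw [push, hφ.rdiff_pull Y (φ.map_target hz), φ.right_inv hz]

theorem push_eq_mpullback (hφ : IsSmoothChart (E := E) φ) (X : TangentField E M) {z : F}
    (hz : z ∈ φ.target) : push φ X z = mpullback 𝓘(ℝ, F) 𝓘(ℝ, E) φ.symm X z := by
  obtain ⟨w, hw⟩ := (hφ.mdifferentiable.symm.mfderiv hz).surjective (X (φ.symm z))
  have hpush : push φ X z = w :=
    (congrArg (rdiff φ (φ.symm z)) hw.symm).trans
      congr($(hφ.mdifferentiable.comp_symm_deriv hz) w)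
  rw [hpush]
  exact ((hφ.isInvertible_symm hz).inverse_apply_eq.2 hw.symm).symm

variable [IsManifold 𝓘(ℝ, E) ∞ M]

theorem contDiffAt_push [CompleteSpace F] (hφ : IsSmoothChart (E := E) φ)
    {X : TangentField E M} {y : M} (hy : y ∈ φ.source) (hX : SmoothFieldAt X y) :
    ContDiffAt ℝ ∞ (push φ X) (φ y) := by
  have hz := φ.map_source hy
  have h : ContMDiffAt 𝓘(ℝ, F) 𝓘(ℝ, F).tangent ∞ (fun z => (⟨z,
      mpullback 𝓘(ℝ, F) 𝓘(ℝ, E) φ.symm X z⟩ : TangentBundle 𝓘(ℝ, F) F)) (φ y) := by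
    refine ContMDiffAt.mpullback_vectorField_preimage (n := ∞) ?_
      (hφ.smooth_symm.contMDiffAt (φ.open_target.mem_nhds hz)) (hφ.isInvertible_symm hz) (by simp)
    rw [φ.left_inv hy]
    exact hX
  exact (contMDiffAt_vectorSpace_iff_contDiffAt.1 h).congr_of_eventuallyEq
    (eventually_of_mem (φ.open_target.mem_nhds hz) fun z hz => hφ.push_eq_mpullback X hz)

theorem smoothFieldAt_pull [CompleteSpace E] (hφ : IsSmoothChart (E := E) φ) {Y : F → F} {y : M}
    (hy : y ∈ φ.source) (hY : ContDiffAt ℝ ∞ Y (φ y)) : SmoothFieldAt (E := E) (pull φ Y) y :=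
  ContMDiffAt.mpullback_vectorField_preimage (n := ∞) (contMDiffAt_vectorSpace_iff_contDiffAt.2 hY)
    (hφ.smooth.contMDiffAt (φ.open_source.mem_nhds hy)) (hφ.isInvertible hy) (by simp)

theorem rdiff_mlieBracket [CompleteSpace F] (hφ : IsSmoothChart (E := E) φ)
    {X Y : TangentField E M} {y : M} (hy : y ∈ φ.source) (hX : SmoothFieldAt X y)
    (hY : SmoothFieldAt Y y) :
    rdiff φ y (mlieBracket 𝓘(ℝ, E) X Y y) = lieBracket ℝ (push φ X) (push φ Y) (φ y) := by
  have hz := φ.map_source hy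
  have hminSmoothness : minSmoothness ℝ 2 ≤ (∞ : WithTop ℕ∞) := by
    rw [minSmoothness_of_isRCLikeNormedField]
    norm_cast
  have : IsManifold 𝓘(ℝ, E) (minSmoothness ℝ 2) M := IsManifold.of_le hminSmoothness
  have hpull := mpullback_mlieBracket (I := 𝓘(ℝ, F)) (I' := 𝓘(ℝ, E)) (f := φ.symm) (V := X)
    (W := Y) (x₀ := φ y) (n := ∞)
    (by rw [φ.left_inv hy]; exact ContMDiffAt.mdifferentiableAt hX (by simp))
    (by rw [φ.left_inv hy]; exact ContMDiffAt.mdifferentiableAt hY (by simp))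
    (hφ.smooth_symm.contMDiffAt (φ.open_target.mem_nhds hz)) hminSmoothness
  rw [← hφ.push_eq_mpullback _ hz, push_apply φ _ hy] at hpull
  rw [hpull, mlieBracket_eq_lieBracket]
  exact EventuallyEq.lieBracket_vectorField_eq
    (eventually_of_mem (φ.open_target.mem_nhds hz) fun z hz => (hφ.push_eq_mpullback X hz).symm)
    (eventually_of_mem (φ.open_target.mem_nhds hz) fun z hz => (hφ.push_eq_mpullback Y hz).symm)

end IsSmoothChart

end Charts

section Fields

variable {E : Type*} [NormedAddCommGroup E] [NormedSpace ℝ E]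
  {M : Type*} [TopologicalSpace M] [ChartedSpace E M] [IsManifold 𝓘(ℝ, E) ∞ M]

theorem SmoothFieldOn.smoothFieldAt {X : TangentField E M} {U : Set M}
    (hX : SmoothFieldOn X U) (hU : IsOpen U) {y : M} (hy : y ∈ U) : SmoothFieldAt X y :=
  ContMDiffOn.contMDiffAt hX (hU.mem_nhds hy)

theorem smoothFieldOn_of_forall {X : TangentField E M} {U : Set M}
    (hX : ∀ y ∈ U, SmoothFieldAt X y) : SmoothFieldOn X U :=
  fun y hy => ContMDiffAt.contMDiffWithinAt (hX y hy)

namespace SmoothFieldAt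

variable {X Y : TangentField E M} {y : M}

theorem add (hX : SmoothFieldAt X y) (hY : SmoothFieldAt Y y) :
    SmoothFieldAt (fun x => X x + Y x) y :=
  ContMDiffAt.add_section hX hY

theorem const_smul (c : ℝ) (hX : SmoothFieldAt X y) : SmoothFieldAt (fun x => c • X x) y :=
  ContMDiffAt.const_smul_section (a := c) hX

theorem mdifferentiableAt (hX : SmoothFieldAt X y) : MDifferentiableAt 𝓘(ℝ, E) 𝓘(ℝ, E).tangent
    (fun x => (⟨x, X x⟩ : TangentBundle 𝓘(ℝ, E) M)) y :=
  ContMDiffAt.mdifferentiableAt hX (by simp)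

theorem acs (J : AlmostComplex E M) (hX : SmoothFieldAt X y) :
    SmoothFieldAt (fun x => J.J x (X x)) y :=
  ContMDiffAt.clm_bundle_apply (J.smooth y) hX

theorem congr (hX : SmoothFieldAt X y) (h : Y =ᶠ[𝓝 y] X) : SmoothFieldAt Y y :=
  ContMDiffAt.congr_of_eventuallyEq hX (h.mono fun x hx => congrArg (Bundle.TotalSpace.mk x) hx)

theorem inner (g : RiemMetric E M) (hX : SmoothFieldAt X y) (hY : SmoothFieldAt Y y) :
    ContMDiffAt 𝓘(ℝ, E) 𝓘(ℝ, ℝ) ∞ (fun x => g.inner x (X x) (Y x)) y := by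
  have h : ContMDiffAt 𝓘(ℝ, E) (𝓘(ℝ, E).prod 𝓘(ℝ)) ∞
      (fun m => Bundle.TotalSpace.mk' ℝ (E := Bundle.Trivial M ℝ) m (g.inner m (X m) (Y m))) y :=
    ContMDiffAt.clm_bundle_apply₂ (F₁ := E) (F₂ := E) (g.contMDiff y) hX hY
  exact (Bundle.contMDiffAt_totalSpace.1 h).2

end SmoothFieldAt

theorem isSmoothChart_chartAt (x : M) : IsSmoothChart (E := E) (chartAt E x) :=
  ⟨contMDiffOn_chart, contMDiffOn_chart_symm⟩

theorem exists_smoothField [CompleteSpace E] (x : M) (v : TangentSpace 𝓘(ℝ, E) x) :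
    ∃ X : TangentField E M, X x = v ∧ ∀ᶠ y in 𝓝 x, SmoothFieldAt X y := by
  have hφ := isSmoothChart_chartAt (E := E) x
  have hx := mem_chart_source E x
  exact ⟨pull (chartAt E x) fun _ => rdiff (chartAt E x) x v,
    hφ.rdiff_injective hx (hφ.rdiff_pull _ hx),
    eventually_of_mem ((chartAt E x).open_source.mem_nhds hx)
      fun _ hy => hφ.smoothFieldAt_pull hy contDiffAt_const⟩

namespace IsHolomorphicChart

variable {F : Type*} [NormedAddCommGroup F] [NormedSpace ℂ F]
  {J : AlmostComplex E M} {φ : OpenPartialHomeomorph M F}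

theorem isSmoothChart (hφ : IsHolomorphicChart J φ) : IsSmoothChart (E := E) φ :=
  ⟨hφ.smooth, hφ.smooth_symm⟩

theorem rdiff_acs (hφ : IsHolomorphicChart J φ) {y : M} (hy : y ∈ φ.source)
    (v : TangentSpace 𝓘(ℝ, E) y) : rdiff φ y (J.J y v) = Complex.I • rdiff φ y v :=
  hφ.holomorphic y hy v

theorem push_acs (hφ : IsHolomorphicChart J φ) (X : TangentField E M) {y : M}
    (hy : y ∈ φ.source) :
    push φ (fun y => J.J y (X y)) =ᶠ[𝓝 (φ y)] fun z => Complex.I • push φ X z :=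
  eventually_of_mem (φ.open_target.mem_nhds (φ.map_source hy)) fun _ hz =>
    hφ.rdiff_acs (φ.map_target hz) _

theorem mlieBracket_acs_acs [CompleteSpace F] (hφ : IsHolomorphicChart J φ)
    {X Y : TangentField E M} {x : M} (hx : x ∈ φ.source) (hX : SmoothFieldAt X x)
    (hY : SmoothFieldAt Y x) :
    mlieBracket 𝓘(ℝ, E) (fun y => J.J y (X y)) (fun y => J.J y (Y y)) x =
      mlieBracket 𝓘(ℝ, E) X Y x + J.J x (mlieBracket 𝓘(ℝ, E) (fun y => J.J y (X y)) Y x) +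
        J.J x (mlieBracket 𝓘(ℝ, E) X (fun y => J.J y (Y y)) x) := by
  have hs := hφ.isSmoothChart
  have hpX := hφ.push_acs X hx
  have hpY := hφ.push_acs Y hx
  have hdX : DifferentiableAt ℝ (push φ X) (φ x) :=
    (hs.contDiffAt_push hx hX).differentiableAt (by simp)
  have hdY : DifferentiableAt ℝ (push φ Y) (φ x) :=
    (hs.contDiffAt_push hx hY).differentiableAt (by simp)
  apply hs.rdiff_injective hx
  rw [map_add, map_add, hφ.rdiff_acs hx, hφ.rdiff_acs hx,
    hs.rdiff_mlieBracket hx (hX.acs J) (hY.acs J), hs.rdiff_mlieBracket hx hX hY,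
    hs.rdiff_mlieBracket hx (hX.acs J) hY, hs.rdiff_mlieBracket hx hX (hY.acs J),
    hpX.lieBracket_vectorField_eq hpY, hpX.lieBracket_vectorField_eq EventuallyEq.rfl,
    (EventuallyEq.refl (𝓝 (φ x)) (push φ X)).lieBracket_vectorField_eq hpY]
  simp only [lieBracket, fderiv_fun_const_smul hdX, fderiv_fun_const_smul hdY, smul_apply,
    smul_sub, smul_smul, Complex.I_mul_I, neg_smul, one_smul]
  abel

end IsHolomorphicChart

theorem AlmostComplex.Integrable.mlieBracket_acs_acs {J : AlmostComplex E M}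
    (hJ : J.Integrable) {X Y : TangentField E M} {x : M} (hX : SmoothFieldAt X x)
    (hY : SmoothFieldAt Y x) :
    mlieBracket 𝓘(ℝ, E) (fun y => J.J y (X y)) (fun y => J.J y (Y y)) x =
      mlieBracket 𝓘(ℝ, E) X Y x + J.J x (mlieBracket 𝓘(ℝ, E) (fun y => J.J y (X y)) Y x) +
        J.J x (mlieBracket 𝓘(ℝ, E) X (fun y => J.J y (Y y)) x) := by
  obtain ⟨n, φ, hx, hφ⟩ := hJ x
  exact hφ.mlieBracket_acs_acs hx hX hY

end Fields

/-! ### Exterior derivatives -/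

section ChartedSpaces

variable {H H' L M : Type*} [TopologicalSpace H] [TopologicalSpace H'] [TopologicalSpace L]
  [TopologicalSpace M] [ChartedSpace H L] [ChartedSpace H' M]

theorem eventually_mem_chart_source {ι : L → M} (hι : Continuous ι) (p : L) :
    ∀ᶠ z in 𝓝 (chartAt H p p), z ∈ (chartAt H p).target ∧
      ι ((chartAt H p).symm z) ∈ (chartAt H' (ι p)).source := by
  have hopen := (chartAt H p).symm.isOpen_inter_preimage
    ((chartAt H' (ι p)).open_source.preimage hι)
  refine hopen.mem_nhds ⟨mem_chart_target H p, ?_⟩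
  rw [mem_preimage, mem_preimage, (chartAt H p).left_inv (mem_chart_source H p)]
  exact mem_chart_source H' (ι p)

end ChartedSpaces

section AlternatingMaps

variable {E : Type*} [NormedAddCommGroup E] [NormedSpace ℝ E]

theorem contDiffAt_continuousAlternatingMap_of_apply [FiniteDimensional ℝ E] {G : Type*}
    [NormedAddCommGroup G] [NormedSpace ℝ G] {k : ℕ} {n : WithTop ℕ∞}
    {f : G → E [⋀^Fin k]→L[ℝ] ℝ} {z : G}
    (hf : ∀ v : Fin k → E, ContDiffAt ℝ n (fun y => f y v) z) : ContDiffAt ℝ n f z := by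
  let b := Module.finBasis ℝ E
  let eval : (E [⋀^Fin k]→L[ℝ] ℝ) →ₗ[ℝ] ((Fin k → Fin (Module.finrank ℝ E)) → ℝ) :=
    { toFun := fun T s => T fun i => b (s i)
      map_add' := fun _ _ => rfl
      map_smul' := fun _ _ => rfl }
  have hinj : LinearMap.ker eval = ⊥ := LinearMap.ker_eq_bot.2 fun S T h => by
    have hST : S.toAlternatingMap.toMultilinearMap = T.toAlternatingMap.toMultilinearMap :=
      Module.Basis.ext_multilinear (fun _ => b) fun s => congrFun h s
    ext v
    exact congr($hST v)
  obtain ⟨r, hr⟩ := eval.exists_leftInverse_of_injective hinj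
  have hfr : f = fun y => LinearMap.toContinuousLinearMap r (eval (f y)) :=
    funext fun y => congr($hr (f y)).symm
  rw [hfr]
  exact (LinearMap.toContinuousLinearMap r).contDiff.contDiffAt.comp z
    (contDiffAt_pi.2 fun s => hf _)

theorem extDeriv_apply_vectorField_three {η : E → E [⋀^Fin 2]→L[ℝ] ℝ} {U V W : E → E} {x : E}
    (hη : DifferentiableAt ℝ η x) (hU : DifferentiableAt ℝ U x) (hV : DifferentiableAt ℝ V x)
    (hW : DifferentiableAt ℝ W x) :
    extDeriv η x ![U x, V x, W x] =
      fderiv ℝ (fun z => η z ![V z, W z]) x (U x) - fderiv ℝ (fun z => η z ![U z, W z]) x (V x)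
      + fderiv ℝ (fun z => η z ![U z, V z]) x (W x) - η x ![lieBracket ℝ U V x, W x]
      + η x ![lieBracket ℝ U W x, V x] - η x ![lieBracket ℝ V W x, U x] := by
  let X : Fin 3 → E → E := ![U, V, W]
  have hX : ∀ i, DifferentiableAt ℝ (X i) x := by
    intro i
    fin_cases i <;> assumption
  have hvalue : ![U x, V x, W x] = (X · x) := by
    funext i
    fin_cases i <;> rfl
  have hremove₀ (z : E) : (0 : Fin 3).removeNth (X · z) = ![V z, W z] := by
    funext i; fin_cases i <;> rfl
  have hremove₁ (z : E) : (1 : Fin 3).removeNth (X · z) = ![U z, W z] := by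
    funext i; fin_cases i <;> rfl
  have hremove₂ (z : E) : (2 : Fin 3).removeNth (X · z) = ![U z, V z] := by
    funext i; fin_cases i <;> rfl
  have hpair₀ (a b : E) : (0 : Fin 2).removeNth ![a, b] = ![b] := by
    funext i; fin_cases i; rfl
  have hpair₁ (a b : E) : (1 : Fin 2).removeNth ![a, b] = ![a] := by
    funext i; fin_cases i; rfl
  have hIci₀ : Finset.Ici (0 : Fin 2) = {0, 1} := by decide
  have hIci₁ : Finset.Ici (1 : Fin 2) = {1} := by decide
  have hinvariant : extDeriv η x (X · x) =
      (∑ i : Fin 3, (-1) ^ i.val • fderiv ℝ (fun z => η z (i.removeNth (X · z))) x (X i x)) -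
        ∑ i : Fin 2, ∑ j ≥ i, (-1) ^ (i + j : ℕ) •
          η x (Matrix.vecCons (lieBracket ℝ (X i.castSucc) (X j.succ) x)
            (j.removeNth (i.castSucc.removeNth (X · x)))) :=
    extDeriv_apply_vectorField hη hX
  rw [hvalue, hinvariant]
  simp only [Fin.sum_univ_three, Fin.sum_univ_two, hIci₀, hIci₁, Finset.sum_singleton,
    Finset.sum_pair (zero_ne_one' (Fin 2)), Fin.castSucc_zero, Fin.castSucc_one,
    Fin.succ_zero_eq_one, Fin.succ_one_eq_two, hremove₀, hremove₁, hremove₂, hpair₀, hpair₁,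
    Fin.val_zero, Fin.val_one, Fin.val_two, X, Matrix.cons_val_zero,
    Matrix.cons_val_one, Matrix.cons_val]
  ring

end AlternatingMaps

section ExteriorDerivative

variable {E : Type*} [NormedAddCommGroup E] [NormedSpace ℝ E]
  {M : Type*} [TopologicalSpace M] [ChartedSpace E M]

theorem Form.apply_congr {k : ℕ} (η : Form E M k) {y y' : M} (h : y = y') {w w' : Fin k → E}
    (hw : w = w') : η y w = η y' w' := by
  subst h hw
  rfl

theorem rdiff_eq_fderiv {F : Type*} [NormedAddCommGroup F] [NormedSpace ℝ F] {f : M → F} {x : M}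
    (hf : MDifferentiableAt 𝓘(ℝ, E) 𝓘(ℝ, F) f x) (v : TangentSpace 𝓘(ℝ, E) x) :
    rdiff f x v = fderiv ℝ (f ∘ (chartAt E x).symm) (chartAt E x x) v := by
  have h := hf.mfderiv
  rw [modelWithCornersSelf_coe, range_id, fderivWithin_univ] at h
  exact congr($h v)

variable [IsManifold 𝓘(ℝ, E) ∞ M]

theorem rdiff_chartAt_self (x : M) (v : TangentSpace 𝓘(ℝ, E) x) :
    rdiff (F := E) (chartAt E x) x v = v := by
  have h : rdiff (F := E) (chartAt E x) x = tangentCoordChange 𝓘(ℝ, E) x x x :=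
    mfderiv_chartAt_eq_tangentCoordChange (mem_chart_source E x)
  exact congr($h v).trans (tangentCoordChange_self (mem_extChartAt_source x))

theorem push_chartAt_self (x : M) (X : TangentField E M) :
    push (chartAt E x) X (chartAt E x x) = X x := by
  rw [push, (chartAt E x).left_inv (mem_chart_source E x), rdiff_chartAt_self]

theorem extD_eq_extDeriv_inChart {k : ℕ} (η : Form E M k) (x : M)
    (v : Fin (k + 1) → TangentSpace 𝓘(ℝ, E) x) :
    extD η x v = extDeriv (inChart η x) (chartAt E x x) v :=
  congrArg (extDeriv (inChart η x) (chartAt E x x)) (funext fun i => rdiff_chartAt_self x (v i))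

theorem chartSymmDiff_push (x : M) (X : TangentField E M) {z : E}
    (hz : z ∈ (chartAt E x).target) :
    chartSymmDiff x z (push (chartAt E x) X z) = X ((chartAt E x).symm z) := by
  have h := (isSmoothChart_chartAt (E := E) x).mdifferentiable.symm_comp_deriv
    ((chartAt E x).map_target hz)
  rw [(chartAt E x).right_inv hz] at h
  exact congr($h (X ((chartAt E x).symm z)))

theorem inChart_push {k : ℕ} (η : Form E M k) (x : M) (X : Fin k → TangentField E M) {z : E}
    (hz : z ∈ (chartAt E x).target) :
    inChart η x z (fun i => push (chartAt E x) (X i) z) =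
      η ((chartAt E x).symm z) fun i => X i ((chartAt E x).symm z) :=
  congrArg (η ((chartAt E x).symm z)) (funext fun i => chartSymmDiff_push x (X i) hz)

theorem inChart_push_pair (η : Form E M 2) (x : M) (X Y : TangentField E M) {z : E}
    (hz : z ∈ (chartAt E x).target) :
    inChart η x z ![push (chartAt E x) X z, push (chartAt E x) Y z] =
      η ((chartAt E x).symm z) ![X ((chartAt E x).symm z), Y ((chartAt E x).symm z)] := by
  convert inChart_push η x ![X, Y] hz using 2 <;> funext i <;> fin_cases i <;> rfl

/-- A form is smooth if its values on smooth vector fields are smooth functions. -/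
def IsSmoothForm {k : ℕ} (η : Form E M k) : Prop :=
  ∀ (X : Fin k → TangentField E M) (x : M), (∀ i, SmoothFieldAt (X i) x) →
    ContMDiffAt 𝓘(ℝ, E) 𝓘(ℝ, ℝ) ∞ (fun y => η y fun i => X i y) x

theorem isSmoothForm_fundamentalForm (g : RiemMetric E M) (J : AlmostComplex E M)
    (h : Compatible g J) : IsSmoothForm (fundamentalForm g J h) :=
  fun _ _ hX => ((hX 0).acs J).inner g (hX 1)

namespace IsSmoothForm

theorem contMDiffAt_apply_pair {η : Form E M 2} (hη : IsSmoothForm η) {X Y : TangentField E M}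
    {x : M} (hX : SmoothFieldAt X x) (hY : SmoothFieldAt Y x) :
    ContMDiffAt 𝓘(ℝ, E) 𝓘(ℝ, ℝ) ∞ (fun y => η y ![X y, Y y]) x := by
  convert hη ![X, Y] x fun i => by fin_cases i <;> assumption using 3 with y
  funext i
  fin_cases i <;> rfl

theorem fderiv_inChart_push {η : Form E M 2} (hη : IsSmoothForm η) {X Y : TangentField E M}
    {x : M} (hX : SmoothFieldAt X x) (hY : SmoothFieldAt Y x) (v : TangentSpace 𝓘(ℝ, E) x) :
    fderiv ℝ (fun z => inChart η x z ![push (chartAt E x) X z, push (chartAt E x) Y z])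
      (chartAt E x x) v = rdiff (fun y => η y ![X y, Y y]) x v := by
  have htarget := (chartAt E x).open_target.mem_nhds (mem_chart_target E x)
  have hmdiff := (hη.contMDiffAt_apply_pair hX hY).mdifferentiableAt (by simp)
  have hchart : (fun z => inChart η x z ![push (chartAt E x) X z, push (chartAt E x) Y z]) =ᶠ[
      𝓝 (chartAt E x x)] (fun y => η y ![X y, Y y]) ∘ (chartAt E x).symm :=
    eventually_of_mem htarget fun z hz => inChart_push_pair η x X Y hz
  rw [rdiff_eq_fderiv hmdiff, hchart.fderiv_eq]

variable [FiniteDimensional ℝ E]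

theorem differentiableAt_inChart {k : ℕ} {η : Form E M k} (hη : IsSmoothForm η) (x : M) :
    DifferentiableAt ℝ (inChart η x) (chartAt E x x) := by
  let φ := chartAt E x
  have hφ : IsSmoothChart (E := E) φ := isSmoothChart_chartAt x
  have hx : x ∈ φ.source := mem_chart_source E x
  have htarget := φ.open_target.mem_nhds (φ.map_source hx)
  refine (contDiffAt_continuousAlternatingMap_of_apply (n := ∞) fun v =>
    ?_).differentiableAt (by simp)
  have hη_const := hη (fun i => pull φ fun _ => v i) x
    fun i => hφ.smoothFieldAt_pull hx contDiffAt_const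
  have hη_symm := ContMDiffAt.comp (φ x) (by rwa [φ.left_inv hx])
    (hφ.smooth_symm.contMDiffAt htarget)
  refine (contMDiffAt_iff_contDiffAt.1 hη_symm).congr_of_eventuallyEq ?_
  filter_upwards [htarget] with z hz
  refine Eq.trans ?_ (inChart_push η x (fun i => pull φ fun _ => v i) hz)
  exact congrArg (inChart η x z) (funext fun i => (hφ.push_pull (fun _ => v i) hz).symm)

theorem extD_apply {η : Form E M 2} (hη : IsSmoothForm η) {x : M} {X Y Z : TangentField E M}
    (hX : SmoothFieldAt X x) (hY : SmoothFieldAt Y x) (hZ : SmoothFieldAt Z x) :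
    extD η x ![X x, Y x, Z x] =
      rdiff (fun y => η y ![Y y, Z y]) x (X x) - rdiff (fun y => η y ![X y, Z y]) x (Y x)
      + rdiff (fun y => η y ![X y, Y y]) x (Z x)
      - η x ![mlieBracket 𝓘(ℝ, E) X Y x, Z x] + η x ![mlieBracket 𝓘(ℝ, E) X Z x, Y x]
      - η x ![mlieBracket 𝓘(ℝ, E) Y Z x, X x] := by
  have hx := mem_chart_source E x
  have hφ := isSmoothChart_chartAt (E := E) x
  have hdiff {A : TangentField E M} (hA : SmoothFieldAt A x) :
      DifferentiableAt ℝ (push (chartAt E x) A) (chartAt E x x) :=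
    (hφ.contDiffAt_push hx hA).differentiableAt (by simp)
  have hbracket {A B : TangentField E M} (hA : SmoothFieldAt A x) (hB : SmoothFieldAt B x) :
      lieBracket ℝ (push (chartAt E x) A) (push (chartAt E x) B) (chartAt E x x) =
        mlieBracket 𝓘(ℝ, E) A B x := by
    rw [← hφ.rdiff_mlieBracket hx hA hB, rdiff_chartAt_self]
  have hinChart (A B : TangentField E M) :
      inChart η x (chartAt E x x) ![A x, B x] = η x ![A x, B x] := by
    have h := inChart_push_pair η x A B (mem_chart_target E x)
    rwa [(chartAt E x).left_inv hx, push_chartAt_self, push_chartAt_self] at h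
  have hextDeriv := extDeriv_apply_vectorField_three (hη.differentiableAt_inChart x) (hdiff hX)
    (hdiff hY) (hdiff hZ)
  simp only [push_chartAt_self, hbracket hX hY, hbracket hX hZ, hbracket hY hZ] at hextDeriv
  refine (extD_eq_extDeriv_inChart η x _).trans (hextDeriv.trans ?_)
  rw [hη.fderiv_inChart_push hY hZ, hη.fderiv_inChart_push hX hZ, hη.fderiv_inChart_push hX hY,
    hinChart (mlieBracket 𝓘(ℝ, E) X Y) Z, hinChart (mlieBracket 𝓘(ℝ, E) X Z) Y,
    hinChart (mlieBracket 𝓘(ℝ, E) Y Z) X]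

end IsSmoothForm

section PullBack

variable {E' : Type*} [NormedAddCommGroup E'] [NormedSpace ℝ E']
  {L : Type*} [TopologicalSpace L] [ChartedSpace E' L]

/-- The pull-back of a form. -/
def pullForm {k : ℕ} (ι : L → M) (η : Form E M k) : Form E' L k := fun p =>
  (η (ι p)).compContinuousLinearMap (mfderiv 𝓘(ℝ, E') 𝓘(ℝ, E) ι p)

variable [IsManifold 𝓘(ℝ, E') ∞ L] {ι : L → M}

theorem contDiffAt_chart_comp_chart_symm (hι : ContMDiff 𝓘(ℝ, E') 𝓘(ℝ, E) ∞ ι) (p : L) {z : E'}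
    (hz : z ∈ (chartAt E' p).target) (hιz : ι ((chartAt E' p).symm z) ∈ (chartAt E (ι p)).source) :
    ContDiffAt ℝ ∞ (chartAt E (ι p) ∘ ι ∘ (chartAt E' p).symm) z :=
  contMDiffAt_iff_contDiffAt.1 (((isSmoothChart_chartAt (ι p)).smooth.contMDiffAt
    ((chartAt E (ι p)).open_source.mem_nhds hιz)).comp z (hι.contMDiffAt.comp z
      ((isSmoothChart_chartAt p).smooth_symm.contMDiffAt ((chartAt E' p).open_target.mem_nhds hz))))

theorem eventually_mfderiv_chartSymmDiff (hι : ContMDiff 𝓘(ℝ, E') 𝓘(ℝ, E) ∞ ι) (p : L) :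
    ∀ᶠ z in 𝓝 (chartAt E' p p), ∀ v : E',
      mfderiv 𝓘(ℝ, E') 𝓘(ℝ, E) ι ((chartAt E' p).symm z) (chartSymmDiff p z v) =
        chartSymmDiff (ι p) ((chartAt E (ι p) ∘ ι ∘ (chartAt E' p).symm) z)
          (fderiv ℝ (chartAt E (ι p) ∘ ι ∘ (chartAt E' p).symm) z v) := by
  let ψ := chartAt E' p
  let φ := chartAt E (ι p)
  filter_upwards [(eventually_mem_chart_source (H := E') (H' := E) hι.continuous p).eventually_nhds]
    with z hnear v
  obtain ⟨hz, hιz⟩ := hnear.self_of_nhds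
  have hf : DifferentiableAt ℝ (φ ∘ ι ∘ ψ.symm) z :=
    (contDiffAt_chart_comp_chart_symm hι p hz hιz).differentiableAt (by simp)
  have hcomp_left := mfderiv_comp z (hι.mdifferentiableAt (by simp))
    ((isSmoothChart_chartAt (E := E') p).mdifferentiable.symm.mdifferentiableAt hz)
  have hcomp_right := mfderiv_comp (f := φ ∘ ι ∘ ψ.symm) z
    ((isSmoothChart_chartAt (E := E) (ι p)).mdifferentiable.symm.mdifferentiableAt
      (φ.map_source hιz)) hf.mdifferentiableAt
  have heq : ι ∘ ψ.symm =ᶠ[𝓝 z] φ.symm ∘ φ ∘ ι ∘ ψ.symm :=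
    hnear.mono fun y hy => (φ.left_inv hy.2).symm
  rw [mfderiv_eq_fderiv] at hcomp_right
  exact congr($hcomp_left v).symm.trans (congr($(heq.mfderiv_eq) v).trans congr($hcomp_right v))

variable [FiniteDimensional ℝ E]

theorem IsSmoothForm.extD_pullForm {k : ℕ} {η : Form E M k} (hη : IsSmoothForm η)
    (hι : ContMDiff 𝓘(ℝ, E') 𝓘(ℝ, E) ∞ ι) :
    extD (pullForm (E' := E') ι η) = pullForm ι (extD η) := by
  funext p
  let ψ := chartAt E' p
  let φ := chartAt E (ι p)
  let f : E' → E := φ ∘ ι ∘ ψ.symm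
  have hfp : f (ψ p) = φ (ι p) :=
    congrArg (fun q => φ (ι q)) (ψ.left_inv (mem_chart_source E' p))
  have hnear := eventually_mem_chart_source (H := E') (H' := E) hι.continuous p
  have hf : ContDiffAt ℝ ∞ f (ψ p) := contDiffAt_chart_comp_chart_symm hι p
    hnear.self_of_nhds.1 hnear.self_of_nhds.2
  have hinChart : inChart (pullForm (E' := E') ι η) p =ᶠ[𝓝 (ψ p)]
      fun z => (inChart η (ι p) (f z)).compContinuousLinearMap (fderiv ℝ f z) := by
    filter_upwards [hnear, eventually_mfderiv_chartSymmDiff hι p] with z hz hmfderiv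
    ext v
    exact η.apply_congr (φ.left_inv hz.2).symm (funext fun i => hmfderiv (v i))
  have hextDeriv : extDeriv (inChart (pullForm (E' := E') ι η) p) (ψ p) =
      (extDeriv (inChart η (ι p)) (φ (ι p))).compContinuousLinearMap (fderiv ℝ f (ψ p)) := by
    rw [hinChart.extDeriv_eq, extDeriv_pullback (r := ∞)
      (by rw [hfp]; exact hη.differentiableAt_inChart (ι p)) hf (by simp; norm_cast), hfp]
  have hmfderiv (v : TangentSpace 𝓘(ℝ, E') p) :
      fderiv ℝ f (ψ p) v = mfderiv 𝓘(ℝ, E') 𝓘(ℝ, E) ι p v := by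
    have h := (hι.mdifferentiableAt (x := p) (by simp)).mfderiv
    rw [modelWithCornersSelf_coe, range_id, fderivWithin_univ] at h
    exact congr($h v).symm
  ext v
  rw [extD_eq_extDeriv_inChart, hextDeriv]
  exact (congrArg (extDeriv (inChart η (ι p)) (φ (ι p))) (funext fun i => hmfderiv (v i))).trans
    (extD_eq_extDeriv_inChart η (ι p) _).symm

end PullBack

end ExteriorDerivative

/-! ### Commuting complex structures -/

section Rdiff

variable {E : Type*} [NormedAddCommGroup E] [NormedSpace ℝ E]
  {M : Type*} [TopologicalSpace M] [ChartedSpace E M]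

theorem rdiff_eq_zero_of_eventuallyEq {f : M → ℝ} {x : M} (h : f =ᶠ[𝓝 x] fun _ => 0) :
    rdiff (E := E) f x = 0 :=
  h.mfderiv_eq.trans mfderiv_const

theorem rdiff_const_mul {f : M → ℝ} {x : M} (hf : MDifferentiableAt 𝓘(ℝ, E) 𝓘(ℝ, ℝ) f x) (c : ℝ) :
    rdiff (E := E) (fun y => c * f y) x = c • rdiff f x :=
  const_smul_mfderiv hf c

end Rdiff

section Eigenbundles

variable {E : Type*} [NormedAddCommGroup E] [NormedSpace ℝ E]
  {M : Type*} [TopologicalSpace M] [ChartedSpace E M] [IsManifold 𝓘(ℝ, E) ∞ M]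

/-- Commutation of two almost complex structures. -/
def AlmostComplex.Commute (J₁ J₂ : AlmostComplex E M) : Prop :=
  ∀ (x : M) (v : TangentSpace 𝓘(ℝ, E) x), J₁.J x (J₂.J x v) = J₂.J x (J₁.J x v)

/-- The eigenspaces of `J₁J₂`. -/
def eigenbundle (J₁ J₂ : AlmostComplex E M) (ε : ℝ) (x : M) :
    Submodule ℝ (TangentSpace 𝓘(ℝ, E) x) :=
  Module.End.eigenspace ((J₁.J x).toLinearMap ∘ₗ (J₂.J x).toLinearMap) ε

/-- The projection onto `eigenbundle J₁ J₂ ε` along `eigenbundle J₁ J₂ (-ε)`, for `ε = ±1`. -/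
def eigenproj (J₁ J₂ : AlmostComplex E M) (ε : ℝ) (x : M) (v : TangentSpace 𝓘(ℝ, E) x) :
    TangentSpace 𝓘(ℝ, E) x :=
  (1 / 2 : ℝ) • (v + ε • J₁.J x (J₂.J x v))

theorem SmoothFieldAt.eigenproj {X : TangentField E M} {x : M} (hX : SmoothFieldAt X x)
    (J₁ J₂ : AlmostComplex E M) (ε : ℝ) : SmoothFieldAt (fun y => eigenproj J₁ J₂ ε y (X y)) x :=
  (hX.add (((hX.acs J₂).acs J₁).const_smul ε)).const_smul (1 / 2)

variable {g : RiemMetric E M} {J₁ J₂ : AlmostComplex E M} {ε : ℝ} {x : M}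

theorem mem_eigenbundle {v : TangentSpace 𝓘(ℝ, E) x} :
    v ∈ eigenbundle J₁ J₂ ε x ↔ J₁.J x (J₂.J x v) = ε • v :=
  Module.End.mem_eigenspace_iff

theorem mem_eigenbundle_iff_eq_neg_smul {v : TangentSpace 𝓘(ℝ, E) x} :
    v ∈ eigenbundle J₁ J₂ ε x ↔ J₂.J x v = -ε • J₁.J x v := by
  rw [mem_eigenbundle]
  constructor
  · intro h
    rw [neg_smul, ← map_smul, ← h, J₁.sq, neg_neg]
  · intro h
    rw [h, map_smul, J₁.sq, smul_neg, neg_smul, neg_neg]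

theorem eigenbundle_swap (hc : J₁.Commute J₂) : eigenbundle J₂ J₁ ε = eigenbundle J₁ J₂ ε := by
  funext x
  ext v
  rw [mem_eigenbundle, mem_eigenbundle, hc x v]

theorem acs_mem_eigenbundle (hc : J₁.Commute J₂) {v : TangentSpace 𝓘(ℝ, E) x}
    (hv : v ∈ eigenbundle J₁ J₂ ε x) : J₁.J x v ∈ eigenbundle J₁ J₂ ε x := by
  rw [mem_eigenbundle] at hv ⊢
  rw [← hc, hv, map_smul]

theorem eigenproj_of_mem (hε : ε * ε = 1) {v : TangentSpace 𝓘(ℝ, E) x}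
    (hv : v ∈ eigenbundle J₁ J₂ ε x) : eigenproj J₁ J₂ ε x v = v := by
  rw [eigenproj, mem_eigenbundle.1 hv, smul_smul, hε]
  module

theorem eigenproj_add_eigenproj (v : TangentSpace 𝓘(ℝ, E) x) :
    eigenproj J₁ J₂ ε x v + eigenproj J₁ J₂ (-ε) x v = v := by
  rw [eigenproj, eigenproj]
  module

theorem eigenproj_mem (hc : J₁.Commute J₂) (hε : ε * ε = 1) (v : TangentSpace 𝓘(ℝ, E) x) :
    eigenproj J₁ J₂ ε x v ∈ eigenbundle J₁ J₂ ε x := by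
  have hsq : J₁.J x (J₂.J x (J₁.J x (J₂.J x v))) = v := by
    rw [← hc, J₁.sq, J₂.sq, neg_neg]
  rw [mem_eigenbundle, eigenproj]
  simp only [map_smul, map_add, hsq]
  rw [smul_comm ε, smul_add ε, smul_smul, hε, one_smul, add_comm]

theorem isCompl_eigenbundle (hc : J₁.Commute J₂) (hε : ε * ε = 1) :
    IsCompl (eigenbundle J₁ J₂ ε x) (eigenbundle J₁ J₂ (-ε) x) := by
  have hε' : -ε * -ε = 1 := by rw [neg_mul_neg, hε]
  refine IsCompl.of_eq ((Submodule.eq_bot_iff _).2 fun v hv => ?_)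
    ((Submodule.eq_top_iff').2 fun v => ?_)
  · have hsum := eigenproj_add_eigenproj (J₁ := J₁) (J₂ := J₂) (ε := ε) v
    rw [eigenproj_of_mem hε hv.1, eigenproj_of_mem hε' hv.2] at hsum
    exact add_eq_left.1 hsum
  · rw [← eigenproj_add_eigenproj (J₁ := J₁) (J₂ := J₂) (ε := ε) v]
    exact Submodule.add_mem_sup (eigenproj_mem hc hε v) (eigenproj_mem hc hε' v)

theorem Compatible.inner_acs_left (h : Compatible g J₁) (v w : TangentSpace 𝓘(ℝ, E) x) :
    g.inner x (J₁.J x v) w = -g.inner x v (J₁.J x w) := by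
  have h' := h x v (J₁.J x w)
  rw [J₁.sq, map_neg] at h'
  linarith

theorem inner_eq_zero_of_mem_eigenbundle (h₁ : Compatible g J₁) (h₂ : Compatible g J₂)
    (hε : ε * ε = 1) {v w : TangentSpace 𝓘(ℝ, E) x} (hv : v ∈ eigenbundle J₁ J₂ ε x)
    (hw : w ∈ eigenbundle J₁ J₂ (-ε) x) : g.inner x v w = 0 := by
  have h := (h₁ x (J₂.J x v) (J₂.J x w)).trans (h₂ x v w)
  rw [mem_eigenbundle.1 hv, mem_eigenbundle.1 hw] at h
  simp only [map_smul, smul_apply, smul_eq_mul] at h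
  linear_combination (-1 / 2 : ℝ) * h - (1 / 2 : ℝ) * g.inner x v w * hε

theorem mem_eigenbundle_of_inner_eq_zero (hc : J₁.Commute J₂) (h₁ : Compatible g J₁)
    (h₂ : Compatible g J₂) (hε : ε * ε = 1) {v : TangentSpace 𝓘(ℝ, E) x}
    (hv : ∀ w ∈ eigenbundle J₁ J₂ (-ε) x, g.inner x v w = 0) : v ∈ eigenbundle J₁ J₂ ε x := by
  have hplus := eigenproj_mem hc hε v
  have hminus := eigenproj_mem hc (by rw [neg_mul_neg, hε] : -ε * -ε = 1) v
  have hsum := eigenproj_add_eigenproj (J₁ := J₁) (J₂ := J₂) (ε := ε) v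
  have hnorm := hv _ hminus
  nth_rewrite 1 [← hsum] at hnorm
  rw [map_add, add_apply, inner_eq_zero_of_mem_eigenbundle h₁ h₂ hε hplus hminus, zero_add] at hnorm
  have hzero : eigenproj J₁ J₂ (-ε) x v = 0 := by
    by_contra hne
    exact (g.pos x _ hne).ne' hnorm
  rw [hzero, add_zero] at hsum
  rwa [← hsum]

end Eigenbundles

theorem SmoothFieldAt.dbar_add_left {E : Type*} [NormedAddCommGroup E] [NormedSpace ℝ E]
    [CompleteSpace E] {M : Type*} [TopologicalSpace M] [ChartedSpace E M] [IsManifold 𝓘(ℝ, E) ∞ M]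
    {J : AlmostComplex E M} {X₁ X₂ Y : TangentField E M} {x : M} (hX₁ : SmoothFieldAt X₁ x)
    (hX₂ : SmoothFieldAt X₂ x) :
    J.dbar (fun y => X₁ y + X₂ y) Y x = J.dbar X₁ Y x + J.dbar X₂ Y x := by
  have hbracket := mlieBracket_add_left (W := Y) hX₁.mdifferentiableAt hX₂.mdifferentiableAt
  have hbracket_acs := mlieBracket_add_left (W := Y) (hX₁.acs J).mdifferentiableAt
    (hX₂.acs J).mdifferentiableAt
  have hacs : (fun y => J.J y (X₁ y + X₂ y)) = (fun y => J.J y (X₁ y)) + fun y => J.J y (X₂ y) :=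
    funext fun y => map_add (J.J y) _ _
  rw [AlmostComplex.dbar, AlmostComplex.dbar, AlmostComplex.dbar, hacs, hbracket_acs, map_add]
  exact (congrArg (fun v => (1 / 2 : ℝ) • (v + _)) hbracket).trans (by module)

section CommutingPairs

variable {E : Type*} [NormedAddCommGroup E] [NormedSpace ℝ E]
  {M : Type*} [TopologicalSpace M] [ChartedSpace E M] [IsManifold 𝓘(ℝ, E) ∞ M]
  {g : RiemMetric E M} {J J₁ J₂ : AlmostComplex E M} {ε : ℝ} {x : M}

theorem actInv_fundamentalForm (h : Compatible g J) :
    J.actInv (fundamentalForm g J h) = fundamentalForm g J h := by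
  funext x
  ext v
  exact h x (J.J x (v 0)) (v 1)

theorem dc_fundamentalForm_apply (h : Compatible g J) (u v w : TangentSpace 𝓘(ℝ, E) x) :
    J.dc (fundamentalForm g J h) x ![u, v, w] =
      -extD (fundamentalForm g J h) x ![J.J x u, J.J x v, J.J x w] := by
  have hneg : (fun i => (-(J.J x)) (![u, v, w] i)) =
      fun i => (-1 : ℝ) • ![J.J x u, J.J x v, J.J x w] i := by
    funext i
    fin_cases i <;> simp
  rw [AlmostComplex.dc, actInv_fundamentalForm]
  change extD (fundamentalForm g J h) x (fun i => (-(J.J x)) (![u, v, w] i)) = _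
  rw [hneg, ContinuousAlternatingMap.map_smul_univ, Fin.prod_univ_three, smul_eq_mul]
  ring

/-- Two commuting integrable complex structures compatible with `g` whose fundamental forms satisfy
`dᶜ₁F₁ + dᶜ₂F₂ = 0`. -/
structure IsCommutingPair (g : RiemMetric E M) (J₁ J₂ : AlmostComplex E M) : Prop where
  integrable_left : J₁.Integrable
  integrable_right : J₂.Integrable
  compatible_left : Compatible g J₁
  compatible_right : Compatible g J₂
  comm : J₁.Commute J₂
  dc_add : J₁.dc (fundamentalForm g J₁ compatible_left) +
    J₂.dc (fundamentalForm g J₂ compatible_right) = 0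

theorem GeneralizedKahler.isCommutingPair (K : GeneralizedKahler E M) (hc : K.Jp.Commute K.Jm) :
    IsCommutingPair K.g K.Jp K.Jm :=
  ⟨K.integrable_p, K.integrable_m, K.compatible_p, K.compatible_m, hc, K.dc_add⟩

namespace IsCommutingPair

theorem symm (h : IsCommutingPair g J₁ J₂) : IsCommutingPair g J₂ J₁ :=
  ⟨h.integrable_right, h.integrable_left, h.compatible_right, h.compatible_left,
    fun x v => (h.comm x v).symm, (add_comm _ _).trans h.dc_add⟩

theorem fundamentalForm_eq_of_mem_left (h : IsCommutingPair g J₁ J₂) {v : TangentSpace 𝓘(ℝ, E) x}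
    (hv : v ∈ eigenbundle J₁ J₂ ε x) (w : TangentSpace 𝓘(ℝ, E) x) :
    fundamentalForm g J₂ h.compatible_right x ![v, w] =
      -ε * fundamentalForm g J₁ h.compatible_left x ![v, w] := by
  change g.inner x (J₂.J x v) w = -ε * g.inner x (J₁.J x v) w
  rw [mem_eigenbundle_iff_eq_neg_smul.1 hv, map_smul, smul_apply, smul_eq_mul]

theorem fundamentalForm_eq_of_mem_right (h : IsCommutingPair g J₁ J₂)
    (v : TangentSpace 𝓘(ℝ, E) x) {w : TangentSpace 𝓘(ℝ, E) x} (hw : w ∈ eigenbundle J₁ J₂ ε x) :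
    fundamentalForm g J₂ h.compatible_right x ![v, w] =
      -ε * fundamentalForm g J₁ h.compatible_left x ![v, w] := by
  change g.inner x (J₂.J x v) w = -ε * g.inner x (J₁.J x v) w
  rw [h.compatible_right.inner_acs_left, h.compatible_left.inner_acs_left,
    mem_eigenbundle_iff_eq_neg_smul.1 hw, map_smul, smul_eq_mul]
  ring

theorem fundamentalForm_eq_zero (h : IsCommutingPair g J₁ J₂) (hε : ε * ε = 1)
    {v w : TangentSpace 𝓘(ℝ, E) x} (hv : v ∈ eigenbundle J₁ J₂ ε x)
    (hw : w ∈ eigenbundle J₁ J₂ (-ε) x) :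
    fundamentalForm g J₁ h.compatible_left x ![v, w] = 0 :=
  inner_eq_zero_of_mem_eigenbundle h.compatible_left h.compatible_right hε
    (acs_mem_eigenbundle h.comm hv) hw

theorem extD_fundamentalForm_eq (h : IsCommutingPair g J₁ J₂) {a b c : ℝ}
    {u v w : TangentSpace 𝓘(ℝ, E) x} (hu : u ∈ eigenbundle J₁ J₂ a x)
    (hv : v ∈ eigenbundle J₁ J₂ b x) (hw : w ∈ eigenbundle J₁ J₂ c x) :
    extD (fundamentalForm g J₁ h.compatible_left) x ![u, v, w] =
      a * b * c * extD (fundamentalForm g J₂ h.compatible_right) x ![u, v, w] := by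
  have hdc : J₁.dc (fundamentalForm g J₁ h.compatible_left) x ![J₁.J x u, J₁.J x v, J₁.J x w] +
      J₂.dc (fundamentalForm g J₂ h.compatible_right) x ![J₁.J x u, J₁.J x v, J₁.J x w] = 0 :=
    congr($(h.dc_add) x ![J₁.J x u, J₁.J x v, J₁.J x w])
  have hscale : ![J₂.J x (J₁.J x u), J₂.J x (J₁.J x v), J₂.J x (J₁.J x w)] =
      fun i => ![a, b, c] i • ![u, v, w] i := by
    rw [← h.comm, ← h.comm, ← h.comm, mem_eigenbundle.1 hu, mem_eigenbundle.1 hv,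
      mem_eigenbundle.1 hw]
    funext i
    fin_cases i <;> rfl
  have hneg : ![-u, -v, -w] = fun i => (-1 : ℝ) • ![u, v, w] i := by
    funext i
    fin_cases i <;> simp
  rw [dc_fundamentalForm_apply, dc_fundamentalForm_apply, J₁.sq, J₁.sq, J₁.sq, hneg, hscale,
    ContinuousAlternatingMap.map_smul_univ, ContinuousAlternatingMap.map_smul_univ,
    Fin.prod_univ_three, Fin.prod_univ_three, smul_eq_mul, smul_eq_mul] at hdc
  simp only [Matrix.cons_val_zero, Matrix.cons_val_one, Matrix.cons_val] at hdc
  linear_combination hdc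

variable [FiniteDimensional ℝ E] {X Y Z : TangentField E M}

/- The sign of `F₂ = ∓F₁` differs on the two eigenbundles, so that in `dF₁ = ±dF₂` the term
`F₁([X, Y], Z)` is the only one which does not cancel. -/
theorem fundamentalForm_mlieBracket_eq_zero (h : IsCommutingPair g J₁ J₂) (hε : ε * ε = 1)
    (hX : SmoothFieldAt X x) (hY : SmoothFieldAt Y x) (hZ : SmoothFieldAt Z x)
    (hXmem : ∀ᶠ y in 𝓝 x, X y ∈ eigenbundle J₁ J₂ ε y)
    (hYmem : ∀ᶠ y in 𝓝 x, Y y ∈ eigenbundle J₁ J₂ ε y)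
    (hZmem : ∀ᶠ y in 𝓝 x, Z y ∈ eigenbundle J₁ J₂ (-ε) y) :
    fundamentalForm g J₁ h.compatible_left x ![mlieBracket 𝓘(ℝ, E) X Y x, Z x] = 0 := by
  let F₁ := fundamentalForm g J₁ h.compatible_left
  let F₂ := fundamentalForm g J₂ h.compatible_right
  have hsmooth₁ : IsSmoothForm F₁ := isSmoothForm_fundamentalForm g J₁ h.compatible_left
  have hsmooth₂ : IsSmoothForm F₂ := isSmoothForm_fundamentalForm g J₂ h.compatible_right
  have hvanish₁ {A : TangentField E M} (hA : ∀ᶠ y in 𝓝 x, A y ∈ eigenbundle J₁ J₂ ε y) :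
      rdiff (E := E) (fun y => F₁ y ![A y, Z y]) x = 0 := by
    refine rdiff_eq_zero_of_eventuallyEq ?_
    filter_upwards [hA, hZmem] with y hAy hZy using h.fundamentalForm_eq_zero hε hAy hZy
  have hvanish₂ {A : TangentField E M} (hA : ∀ᶠ y in 𝓝 x, A y ∈ eigenbundle J₁ J₂ ε y) :
      rdiff (E := E) (fun y => F₂ y ![A y, Z y]) x = 0 := by
    refine rdiff_eq_zero_of_eventuallyEq ?_
    filter_upwards [hA, hZmem] with y hAy hZy
    rw [h.fundamentalForm_eq_of_mem_left hAy, h.fundamentalForm_eq_zero hε hAy hZy, mul_zero]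
  have hpair : rdiff (fun y => F₂ y ![X y, Y y]) x (Z x) =
      -ε * rdiff (fun y => F₁ y ![X y, Y y]) x (Z x) := by
    have hEq : (fun y => F₂ y ![X y, Y y]) =ᶠ[𝓝 x] fun y => -ε * F₁ y ![X y, Y y] :=
      hXmem.mono fun y hy => h.fundamentalForm_eq_of_mem_left hy _
    have hmul := rdiff_const_mul
      ((hsmooth₁.contMDiffAt_apply_pair hX hY).mdifferentiableAt (by simp)) (-ε)
    exact congr($(hEq.mfderiv_eq.trans hmul) (Z x))
  have hdF₁ := hsmooth₁.extD_apply hX hY hZ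
  have hdF₂ := hsmooth₂.extD_apply hX hY hZ
  rw [hvanish₁ hXmem, hvanish₁ hYmem, zero_apply, zero_apply] at hdF₁
  rw [hvanish₂ hXmem, hvanish₂ hYmem, hpair, zero_apply, zero_apply,
    h.fundamentalForm_eq_of_mem_right _ hZmem.self_of_nhds,
    h.fundamentalForm_eq_of_mem_right _ hXmem.self_of_nhds,
    h.fundamentalForm_eq_of_mem_right _ hYmem.self_of_nhds] at hdF₂
  have hdF := h.extD_fundamentalForm_eq hXmem.self_of_nhds hYmem.self_of_nhds hZmem.self_of_nhds
  simp only [F₁, F₂] at hdF₁ hdF₂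
  rcases mul_self_eq_one_iff.1 hε with rfl | rfl <;> linarith

theorem mlieBracket_mem (h : IsCommutingPair g J₁ J₂) (hε : ε * ε = 1)
    (hX : SmoothFieldAt X x) (hY : SmoothFieldAt Y x)
    (hXmem : ∀ᶠ y in 𝓝 x, X y ∈ eigenbundle J₁ J₂ ε y)
    (hYmem : ∀ᶠ y in 𝓝 x, Y y ∈ eigenbundle J₁ J₂ ε y) :
    mlieBracket 𝓘(ℝ, E) X Y x ∈ eigenbundle J₁ J₂ ε x := by
  have hε' : -ε * -ε = 1 := by rw [neg_mul_neg, hε]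
  have hacs : J₁.J x (mlieBracket 𝓘(ℝ, E) X Y x) ∈ eigenbundle J₁ J₂ ε x := by
    refine mem_eigenbundle_of_inner_eq_zero h.comm h.compatible_left h.compatible_right hε
      fun w hw => ?_
    obtain ⟨Z, rfl, hZ⟩ := exists_smoothField x w
    rw [← eigenproj_of_mem hε' hw]
    exact h.fundamentalForm_mlieBracket_eq_zero hε hX hY (hZ.self_of_nhds.eigenproj J₁ J₂ (-ε))
      hXmem hYmem (.of_forall fun y => eigenproj_mem h.comm hε' (Z y))
  have hneg := (eigenbundle J₁ J₂ ε x).neg_mem (acs_mem_eigenbundle h.comm hacs)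
  rwa [J₁.sq, neg_neg] at hneg

theorem isInvolutive (h : IsCommutingPair g J₁ J₂) (hε : ε * ε = 1) :
    IsInvolutive (eigenbundle J₁ J₂ ε) := fun _ hU _ _ hX hY hXmem hYmem _ hy =>
  h.mlieBracket_mem hε (hX.smoothFieldAt hU hy) (hY.smoothFieldAt hU hy)
    (mem_of_superset (hU.mem_nhds hy) hXmem) (mem_of_superset (hU.mem_nhds hy) hYmem)

theorem dbar_mem_of_mem (h : IsCommutingPair g J₁ J₂) (hε : ε * ε = 1)
    (hX : SmoothFieldAt X x) (hY : SmoothFieldAt Y x)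
    (hXmem : ∀ᶠ y in 𝓝 x, X y ∈ eigenbundle J₁ J₂ ε y)
    (hYmem : ∀ᶠ y in 𝓝 x, Y y ∈ eigenbundle J₁ J₂ ε y) :
    J₁.dbar X Y x ∈ eigenbundle J₁ J₂ ε x :=
  Submodule.smul_mem _ _ (Submodule.add_mem _ (h.mlieBracket_mem hε hX hY hXmem hYmem)
    (acs_mem_eigenbundle h.comm (h.mlieBracket_mem hε (hX.acs J₁) hY
      (hXmem.mono fun _ hy => acs_mem_eigenbundle h.comm hy) hYmem)))

/- The sum of the two Nijenhuis identities: `[J₂X, J₂Y] = -[J₁X, J₁Y]`, as `J₂X = εJ₁X` and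
`J₂Y = -εJ₁Y`. -/
theorem mlieBracket_add_mlieBracket (h : IsCommutingPair g J₁ J₂) (hε : ε * ε = 1)
    (hX : SmoothFieldAt X x) (hY : SmoothFieldAt Y x)
    (hXmem : ∀ᶠ y in 𝓝 x, X y ∈ eigenbundle J₁ J₂ (-ε) y)
    (hYmem : ∀ᶠ y in 𝓝 x, Y y ∈ eigenbundle J₁ J₂ ε y) :
    (2 : ℝ) • mlieBracket 𝓘(ℝ, E) X Y x +
      (J₁.J x + ε • J₂.J x) (mlieBracket 𝓘(ℝ, E) (fun y => J₁.J y (X y)) Y x) +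
      (J₁.J x - ε • J₂.J x) (mlieBracket 𝓘(ℝ, E) X (fun y => J₁.J y (Y y)) x) = 0 := by
  have hJ₂X : (fun y => J₂.J y (X y)) =ᶠ[𝓝 x] (ε • fun y => J₁.J y (X y)) := by
    filter_upwards [hXmem] with y hy
    rw [mem_eigenbundle_iff_eq_neg_smul.1 hy, neg_neg]
    rfl
  have hJ₂Y : (fun y => J₂.J y (Y y)) =ᶠ[𝓝 x] (-ε • fun y => J₁.J y (Y y)) :=
    hYmem.mono fun y hy => mem_eigenbundle_iff_eq_neg_smul.1 hy
  have hJ₁X := (hX.acs J₁).mdifferentiableAt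
  have hJ₁Y := (hY.acs J₁).mdifferentiableAt
  have hnijenhuis₁ := h.integrable_left.mlieBracket_acs_acs hX hY
  have hnijenhuis₂ := h.integrable_right.mlieBracket_acs_acs hX hY
  rw [hJ₂X.mlieBracket_vectorField_eq hJ₂Y,
    hJ₂X.mlieBracket_vectorField_eq (EventuallyEq.refl (𝓝 x) Y),
    (EventuallyEq.refl (𝓝 x) X).mlieBracket_vectorField_eq hJ₂Y,
    mlieBracket_const_smul_left hJ₁X, mlieBracket_const_smul_right hJ₁Y,
    mlieBracket_const_smul_left hJ₁X, mlieBracket_const_smul_right hJ₁Y, smul_smul, mul_neg, hε,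
    map_smul, map_smul] at hnijenhuis₂
  simp only [add_apply, sub_apply, smul_apply]
  linear_combination (norm := module) -hnijenhuis₁ - hnijenhuis₂

theorem dbar_mem_of_mem_neg (h : IsCommutingPair g J₁ J₂) (hε : ε * ε = 1)
    (hX : SmoothFieldAt X x) (hY : SmoothFieldAt Y x)
    (hXmem : ∀ᶠ y in 𝓝 x, X y ∈ eigenbundle J₁ J₂ (-ε) y)
    (hYmem : ∀ᶠ y in 𝓝 x, Y y ∈ eigenbundle J₁ J₂ ε y) :
    J₁.dbar X Y x ∈ eigenbundle J₁ J₂ ε x := by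
  let A := mlieBracket 𝓘(ℝ, E) (fun y => J₁.J y (X y)) Y x
  let B := mlieBracket 𝓘(ℝ, E) X (fun y => J₁.J y (Y y)) x
  have hrelation := h.mlieBracket_add_mlieBracket hε hX hY hXmem hYmem
  simp only [add_apply, sub_apply, smul_apply] at hrelation
  have hdbar : mlieBracket 𝓘(ℝ, E) X Y x + J₁.J x A = J₁.J x (eigenproj J₁ J₂ ε x (A - B)) := by
    simp only [A, B, eigenproj, map_smul, map_add, map_sub, J₁.sq]
    linear_combination (norm := module) (1 / 2 : ℝ) • hrelation
  rw [AlmostComplex.dbar, hdbar]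
  exact Submodule.smul_mem _ _ (acs_mem_eigenbundle h.comm (eigenproj_mem h.comm hε _))

theorem dbar_mem (h : IsCommutingPair g J₁ J₂) (hε : ε * ε = 1) (hX : SmoothFieldAt X x)
    (hY : SmoothFieldAt Y x) (hYmem : ∀ᶠ y in 𝓝 x, Y y ∈ eigenbundle J₁ J₂ ε y) :
    J₁.dbar X Y x ∈ eigenbundle J₁ J₂ ε x := by
  have hε' : -ε * -ε = 1 := by rw [neg_mul_neg, hε]
  have hplus := hX.eigenproj J₁ J₂ ε
  have hminus := hX.eigenproj J₁ J₂ (-ε)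
  have hsum : J₁.dbar X Y x = J₁.dbar (fun y => eigenproj J₁ J₂ ε y (X y)) Y x +
      J₁.dbar (fun y => eigenproj J₁ J₂ (-ε) y (X y)) Y x := by
    rw [← hplus.dbar_add_left hminus]
    simp only [eigenproj_add_eigenproj]
  rw [hsum]
  exact Submodule.add_mem _
    (h.dbar_mem_of_mem hε hplus hY (.of_forall fun y => eigenproj_mem h.comm hε _) hYmem)
    (h.dbar_mem_of_mem_neg hε hminus hY (.of_forall fun y => eigenproj_mem h.comm hε' _) hYmem)

end IsCommutingPair

end CommutingPairs

/-! ### Distributions and foliations -/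

section SmoothDistributions

variable {E : Type*} [NormedAddCommGroup E] [NormedSpace ℝ E]
  {M : Type*} [TopologicalSpace M] [ChartedSpace E M] [IsManifold 𝓘(ℝ, E) ∞ M]

/-- `D` is a smooth distribution, whose rank may jump: each of its vectors extends to a smooth local
section of `D`. -/
def IsSmoothDistribution (D : ∀ x : M, Submodule ℝ (TangentSpace 𝓘(ℝ, E) x)) : Prop :=
  ∀ (x : M), ∀ v ∈ D x, ∃ X : TangentField E M,
    X x = v ∧ ∀ᶠ y in 𝓝 x, SmoothFieldAt X y ∧ X y ∈ D y

theorem eventually_linearIndependent [CompleteSpace E] {κ : Type*} [Finite κ]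
    {s : κ → TangentField E M} {x : M} (hs : ∀ i, SmoothFieldAt (s i) x)
    (hind : LinearIndependent ℝ fun i => s i x) :
    ∀ᶠ y in 𝓝 x, LinearIndependent ℝ fun i => s i y := by
  have hφ := isSmoothChart_chartAt (E := E) x
  have hx := mem_chart_source E x
  have hcont : ContinuousAt (fun z i => push (chartAt E x) (s i) z) (chartAt E x x) :=
    continuousAt_pi.2 fun i => (hφ.contDiffAt_push hx (hs i)).continuousAt
  have hpush {y : M} (hy : y ∈ (chartAt E x).source) :
      (LinearIndependent ℝ fun i => push (chartAt E x) (s i) (chartAt E x y)) ↔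
        LinearIndependent ℝ fun i => s i y := by
    rw [funext fun i => push_apply (chartAt E x) (s i) hy]
    exact LinearMap.linearIndependent_iff (rdiff (chartAt E x) y).toLinearMap
      (LinearMap.ker_eq_bot.2 (hφ.rdiff_injective hy))
  filter_upwards [(chartAt E x).open_source.mem_nhds hx, ((chartAt E x).continuousAt hx).eventually
    (hcont.eventually ((hpush hx).2 hind).eventually)] with y hy hyind
  exact (hpush hy).1 hyind

namespace IsSmoothDistribution

variable [FiniteDimensional ℝ E] {D D' : ∀ x : M, Submodule ℝ (TangentSpace 𝓘(ℝ, E) x)}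

theorem exists_linearIndependent (hD : IsSmoothDistribution D) (x : M) :
    ∃ s : Fin (Module.finrank ℝ (D x)) → TangentField E M, ∀ᶠ y in 𝓝 x,
      (∀ i, SmoothFieldAt (s i) y) ∧ (∀ i, s i y ∈ D y) ∧ LinearIndependent ℝ fun i => s i y := by
  have : FiniteDimensional ℝ (TangentSpace 𝓘(ℝ, E) x) := inferInstanceAs (FiniteDimensional ℝ E)
  let b := Module.finBasis ℝ (D x)
  choose s hsx hs using fun i => hD x (b i) (b i).2
  have hs' := eventually_all.2 hs
  have hind : LinearIndependent ℝ fun i => s i x := by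
    simp only [hsx]
    exact b.linearIndependent.map' (D x).subtype (D x).ker_subtype
  refine ⟨s, ?_⟩
  filter_upwards [hs', eventually_linearIndependent (fun i => (hs'.self_of_nhds i).1)
    hind] with y hy hyind
  exact ⟨fun i => (hy i).1, fun i => (hy i).2, hyind⟩

theorem eventually_finrank_le (hD : IsSmoothDistribution D) (x : M) :
    ∀ᶠ y in 𝓝 x, Module.finrank ℝ (D x) ≤ Module.finrank ℝ (D y) := by
  obtain ⟨s, hs⟩ := hD.exists_linearIndependent x
  filter_upwards [hs] with y ⟨_, hmem, hind⟩
  have : FiniteDimensional ℝ (TangentSpace 𝓘(ℝ, E) y) := inferInstanceAs (FiniteDimensional ℝ E)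
  rw [← Fintype.card_fin (Module.finrank ℝ (D x)), ← finrank_span_eq_card hind]
  exact Submodule.finrank_mono (Submodule.span_le.2 (range_subset_iff.2 hmem))

/- The ranks of `D` and `D'` are lower semicontinuous and have a constant sum, so they are locally
constant. -/
theorem isSmoothSubbundle (hD : IsSmoothDistribution D) (hD' : IsSmoothDistribution D')
    (hcompl : ∀ x, IsCompl (D x) (D' x)) : IsSmoothSubbundle D := by
  intro x
  have hfin (y : M) : FiniteDimensional ℝ (TangentSpace 𝓘(ℝ, E) y) :=
    inferInstanceAs (FiniteDimensional ℝ E)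
  have hrank (y : M) : Module.finrank ℝ (D y) + Module.finrank ℝ (D' y) = Module.finrank ℝ E :=
    Submodule.finrank_add_eq_of_isCompl (hcompl y)
  obtain ⟨s, hs⟩ := hD.exists_linearIndependent x
  obtain ⟨U, hU, hUo, hxU⟩ := eventually_nhds_iff.1 (hs.and (hD'.eventually_finrank_le x))
  refine ⟨U, hUo, hxU, _, s, fun i => smoothFieldOn_of_forall fun y hy => (hU y hy).1.1 i,
    fun y hy => ?_⟩
  obtain ⟨⟨_, hmem, hind⟩, hle⟩ := hU y hy
  refine ⟨hind, Submodule.eq_of_le_of_finrank_le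
    (Submodule.span_le.2 (range_subset_iff.2 hmem)) ?_⟩
  have hx := hrank x
  have hy := hrank y
  rw [finrank_span_eq_card hind, Fintype.card_fin]
  lia

end IsSmoothDistribution

end SmoothDistributions

section LocalGraphs

theorem exists_graph_of_isInvertible {Z H V W : Type*} [NormedAddCommGroup Z] [NormedSpace ℝ Z]
    [NormedAddCommGroup H] [NormedSpace ℝ H] [CompleteSpace H] [NormedAddCommGroup V]
    [NormedSpace ℝ V] [NormedAddCommGroup W] [NormedSpace ℝ W] {S : Z → H →L[ℝ] V × W} {z₀ : Z}
    (hS : ∀ᶠ z in 𝓝 z₀, ContDiffAt ℝ ∞ S z)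
    (h₀ : (ContinuousLinearMap.fst ℝ V W ∘L S z₀).IsInvertible) :
    ∃ A : Z → V →L[ℝ] W, ∀ᶠ z in 𝓝 z₀, ContDiffAt ℝ ∞ A z ∧
      ∀ w, w ∈ range (S z) ↔ w.2 = A z w.1 := by
  obtain ⟨e₀, he₀⟩ := h₀
  have hinv : ∀ᶠ z in 𝓝 z₀, (ContinuousLinearMap.fst ℝ V W ∘L S z).IsInvertible := by
    have htendsto : Tendsto (fun z => ContinuousLinearMap.fst ℝ V W ∘L S z) (𝓝 z₀)
        (𝓝 (e₀ : H →L[ℝ] V)) := by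
      rw [he₀]
      exact continuousAt_const.clm_comp hS.self_of_nhds.continuousAt
    exact htendsto.eventually e₀.nhds
  refine ⟨fun z => ContinuousLinearMap.snd ℝ V W ∘L S z ∘L
    (ContinuousLinearMap.fst ℝ V W ∘L S z).inverse, ?_⟩
  filter_upwards [hS, hinv] with z hSz hz
  have hfst : ContDiffAt ℝ ∞ (fun z => ContinuousLinearMap.fst ℝ V W ∘L S z) z :=
    contDiffAt_const.clm_comp hSz
  refine ⟨contDiffAt_const.clm_comp (hSz.clm_comp (hz.contDiffAt_map_inverse.fun_comp z hfst)),
    fun w => ?_⟩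
  obtain ⟨e, he⟩ := hz
  have he_apply (h : H) : e h = (S z h).1 := congr($he h)
  rw [← he, ContinuousLinearMap.inverse_equiv]
  constructor
  · rintro ⟨h, rfl⟩
    change _ = (S z (e.symm (S z h).1)).2
    rw [← he_apply, e.symm_apply_apply]
  · exact fun hw => ⟨e.symm w.1, Prod.ext (by rw [← he_apply, e.apply_symm_apply]) hw.symm⟩

variable {E : Type*} [NormedAddCommGroup E] [NormedSpace ℝ E]
  {M : Type*} [TopologicalSpace M] [ChartedSpace E M]
  {V W : Type*} [NormedAddCommGroup V] [NormedSpace ℝ V] [NormedAddCommGroup W] [NormedSpace ℝ W]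
  {D : ∀ x : M, Submodule ℝ (TangentSpace 𝓘(ℝ, E) x)} {φ : OpenPartialHomeomorph M (V × W)}

/-- Over the open set `Ω`, the chart `φ` maps `D` to the graphs of the linear maps `A z : V → W`. -/
structure IsLocalGraph (D : ∀ x : M, Submodule ℝ (TangentSpace 𝓘(ℝ, E) x))
    (φ : OpenPartialHomeomorph M (V × W)) (Ω : Set (V × W)) (A : V × W → V →L[ℝ] W) : Prop where
  isOpen : IsOpen Ω
  subset_target : Ω ⊆ φ.target
  contDiffOn : ContDiffOn ℝ ∞ A Ω
  mem_iff : ∀ y ∈ φ.source, φ y ∈ Ω → ∀ v : TangentSpace 𝓘(ℝ, E) y,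
    v ∈ D y ↔ (rdiff φ y v).2 = A (φ y) (rdiff φ y v).1

/-- The combinations of the vectors of a frame, in a chart. -/
def frameMap (φ : OpenPartialHomeomorph M (V × W)) {r : ℕ} (s : Fin r → TangentField E M)
    (z : V × W) : (Fin r → ℝ) →L[ℝ] V × W :=
  ∑ i, (ContinuousLinearMap.proj (R := ℝ) (φ := fun _ => ℝ) i).smulRight (push φ (s i) z)

theorem frameMap_apply {r : ℕ} (s : Fin r → TangentField E M) {y : M} (hy : y ∈ φ.source)
    (c : Fin r → ℝ) : frameMap φ s (φ y) c = rdiff φ y (∑ i, c i • s i y) := by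
  simp only [frameMap, sum_apply, ContinuousLinearMap.smulRight_apply,
    ContinuousLinearMap.proj_apply, push_apply φ _ hy, map_sum, map_smul]

theorem bijective_fst_frameMap (hφ : IsSmoothChart (E := E) φ) {x : M} (hx : x ∈ φ.source)
    (hDx : ∀ v : TangentSpace 𝓘(ℝ, E) x, v ∈ D x ↔ (rdiff φ x v).2 = 0) {r : ℕ}
    {s : Fin r → TangentField E M} (hind : LinearIndependent ℝ fun i => s i x)
    (hspan : Submodule.span ℝ (range fun i => s i x) = D x) :
    Function.Bijective (ContinuousLinearMap.fst ℝ V W ∘L frameMap φ s (φ x)) := by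
  have hmem (c : Fin r → ℝ) : ∑ i, c i • s i x ∈ D x := by
    rw [← hspan]
    exact Submodule.sum_mem _ fun i _ =>
      Submodule.smul_mem _ _ (Submodule.subset_span (mem_range_self i))
  refine ⟨(injective_iff_map_eq_zero _).2 fun c hc => ?_, fun v => ?_⟩
  · change (frameMap φ s (φ x) c).1 = 0 at hc
    rw [frameMap_apply s hx] at hc
    exact funext (Fintype.linearIndependent_iff.1 hind c (hφ.rdiff_injective hx
      ((Prod.ext hc ((hDx _).1 (hmem c))).trans (map_zero _).symm)))
  · obtain ⟨t, ht⟩ := hφ.rdiff_surjective hx (v, 0)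
    have htD : t ∈ D x := (hDx t).2 (by rw [ht])
    rw [← hspan, Submodule.mem_span_range_iff_exists_fun] at htD
    obtain ⟨c, rfl⟩ := htD
    exact ⟨c, congrArg Prod.fst ((frameMap_apply s hx c).trans ht)⟩

theorem IsSmoothSubbundle.exists_isLocalGraph [IsManifold 𝓘(ℝ, E) ∞ M] [CompleteSpace V]
    [CompleteSpace W]
    (hD : IsSmoothSubbundle D) (hφ : IsSmoothChart (E := E) φ) {x : M} (hx : x ∈ φ.source)
    (hDx : ∀ v : TangentSpace 𝓘(ℝ, E) x, v ∈ D x ↔ (rdiff φ x v).2 = 0) :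
    ∃ (Ω : Set (V × W)) (A : V × W → V →L[ℝ] W), φ x ∈ Ω ∧ IsLocalGraph D φ Ω A := by
  obtain ⟨U, hU, hxU, r, s, hs, hframe⟩ := hD x
  have hU' : ∀ᶠ z in 𝓝 (φ x), z ∈ φ.target ∧ φ.symm z ∈ U :=
    (φ.open_target.eventually_mem (φ.map_source hx)).and
      ((φ.tendsto_symm hx).eventually (hU.eventually_mem hxU))
  have hmem {y : M} (hy : y ∈ φ.source) (hyU : y ∈ U) (v : TangentSpace 𝓘(ℝ, E) y) :
      v ∈ D y ↔ rdiff φ y v ∈ range (frameMap φ s (φ y)) := by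
    rw [← (hframe y hyU).2, Submodule.mem_span_range_iff_exists_fun]
    simp only [mem_range, frameMap_apply s hy, (hφ.rdiff_injective hy).eq_iff]
  have hsmooth : ∀ᶠ z in 𝓝 (φ x), ContDiffAt ℝ ∞ (frameMap φ s) z := by
    filter_upwards [hU'] with z ⟨hz, hzU⟩
    have hpush (i : Fin r) : ContDiffAt ℝ ∞ (push φ (s i)) z := φ.right_inv hz ▸
      hφ.contDiffAt_push (φ.map_target hz) ((hs i).smoothFieldAt hU hzU)
    exact ContDiffAt.sum fun i _ => contDiffAt_const.smulRight (hpush i)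
  obtain ⟨hind, hspan⟩ := hframe x hxU
  let e := (LinearEquiv.ofBijective _
    (bijective_fst_frameMap hφ hx hDx hind hspan)).toContinuousLinearEquiv
  have hinv : (ContinuousLinearMap.fst ℝ V W ∘L frameMap φ s (φ x)).IsInvertible :=
    ⟨e, ContinuousLinearMap.ext fun c => rfl⟩
  obtain ⟨A, hA⟩ := exists_graph_of_isInvertible hsmooth hinv
  obtain ⟨Ω, hΩ, hΩo, hxΩ⟩ := _root_.eventually_nhds_iff.1 (hU'.and hA)
  refine ⟨Ω, A, hxΩ, hΩo, fun z hz => (hΩ z hz).1.1, fun z hz => (hΩ z hz).2.1.contDiffWithinAt,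
    fun y hy hyΩ v => ?_⟩
  obtain ⟨⟨_, hyU⟩, _, hgraph⟩ := hΩ _ hyΩ
  rw [φ.left_inv hy] at hyU
  rw [hmem hy hyU, hgraph]

end LocalGraphs

section HolomorphicCharts

theorem exists_prod_equiv_snd_eq_zero_iff {n : ℕ} (V : Submodule ℂ (Fin n → ℂ)) :
    ∃ (a b : ℕ) (T : (Fin n → ℂ) ≃L[ℂ] (Fin a → ℂ) × (Fin b → ℂ)), ∀ w, (T w).2 = 0 ↔ w ∈ V := by
  obtain ⟨W, hW⟩ := V.exists_isCompl
  let eV := (Module.finBasis ℂ V).equivFun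
  let eW := (Module.finBasis ℂ W).equivFun
  refine ⟨_, _, ((V.prodEquivOfIsCompl W hW).symm.trans
    (eV.prodCongr eW)).toContinuousLinearEquiv, fun w => ?_⟩
  change eW ((V.prodEquivOfIsCompl W hW).symm w).2 = 0 ↔ _
  rw [LinearEquiv.map_eq_zero_iff, Submodule.prodEquivOfIsCompl_symm_apply_snd_eq_zero]

variable {E : Type*} [NormedAddCommGroup E] [NormedSpace ℝ E]
  {M : Type*} [TopologicalSpace M] [ChartedSpace E M]
  {F : Type*} [NormedAddCommGroup F] [NormedSpace ℂ F]
  {F' : Type*} [NormedAddCommGroup F'] [NormedSpace ℂ F'] {φ : OpenPartialHomeomorph M F}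

theorem rdiff_trans (hφ : IsSmoothChart (E := E) φ) {Φ : OpenPartialHomeomorph F F'}
    (hΦ : ContDiffOn ℂ ∞ Φ Φ.source) {y : M} (hy : y ∈ (φ.trans Φ).source)
    (v : TangentSpace 𝓘(ℝ, E) y) :
    rdiff (φ.trans Φ) y v = fderiv ℂ Φ (φ y) (rdiff φ y v) := by
  rw [OpenPartialHomeomorph.trans_source] at hy
  have hd : DifferentiableAt ℂ Φ (φ y) :=
    (hΦ.contDiffAt (Φ.open_source.mem_nhds hy.2)).differentiableAt (by simp)
  have hcomp := mfderiv_comp (I := 𝓘(ℝ, E)) (I' := 𝓘(ℝ, F)) (I'' := 𝓘(ℝ, F')) y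
    (hd.restrictScalars ℝ).mdifferentiableAt (hφ.mdifferentiable.mdifferentiableAt hy.1)
  rw [mfderiv_eq_fderiv, hd.fderiv_restrictScalars ℝ] at hcomp
  exact congr($hcomp v)

variable [IsManifold 𝓘(ℝ, E) ∞ M] {J : AlmostComplex E M}

namespace IsHolomorphicChart

theorem trans (hφ : IsHolomorphicChart J φ) {Φ : OpenPartialHomeomorph F F'}
    (hΦ : ContDiffOn ℂ ∞ Φ Φ.source) (hΦsymm : ContDiffOn ℂ ∞ Φ.symm Φ.target) :
    IsHolomorphicChart J (φ.trans Φ) where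
  smooth := by
    rw [OpenPartialHomeomorph.trans_source]
    exact (contMDiffOn_iff_contDiffOn.2 (hΦ.restrict_scalars ℝ)).comp
      (hφ.smooth.mono inter_subset_left) inter_subset_right
  smooth_symm := by
    rw [OpenPartialHomeomorph.trans_target]
    exact hφ.smooth_symm.comp (contMDiffOn_iff_contDiffOn.2
      ((hΦsymm.restrict_scalars ℝ).mono inter_subset_left)) inter_subset_right
  holomorphic := by
    intro y hy v
    change rdiff (φ.trans Φ) y (J.J y v) = Complex.I • rdiff (φ.trans Φ) y v
    rw [rdiff_trans hφ.isSmoothChart hΦ hy, rdiff_trans hφ.isSmoothChart hΦ hy,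
      hφ.rdiff_acs (OpenPartialHomeomorph.trans_source φ Φ ▸ hy).1, map_smul]

theorem exists_affine_change (hφ : IsHolomorphicChart J φ) (T : F ≃L[ℂ] F') (c : F) :
    ∃ ψ : OpenPartialHomeomorph M F', ψ.source = φ.source ∧ IsHolomorphicChart J ψ ∧
      (∀ y, ψ y = T (φ y - c)) ∧
      ∀ y ∈ φ.source, ∀ v : TangentSpace 𝓘(ℝ, E) y, rdiff ψ y v = T (rdiff φ y v) := by
  let Φ : OpenPartialHomeomorph F F' :=
    ((Homeomorph.subRight c).trans T.toHomeomorph).toOpenPartialHomeomorph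
  have hΦ : ContDiff ℂ ∞ Φ := T.contDiff.comp (contDiff_id.sub contDiff_const)
  have hΦsymm : ContDiff ℂ ∞ Φ.symm := T.symm.contDiff.add contDiff_const
  have hfderiv (z : F) : fderiv ℂ Φ z = T :=
    (T.hasFDerivAt.comp z ((hasFDerivAt_id z).sub_const c)).fderiv
  have hsource : (φ.trans Φ).source = φ.source := by
    rw [OpenPartialHomeomorph.trans_source]
    exact inter_univ _
  refine ⟨φ.trans Φ, hsource, hφ.trans hΦ.contDiffOn hΦsymm.contDiffOn, fun y => rfl,
    fun y hy v => ?_⟩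
  rw [rdiff_trans hφ.isSmoothChart hΦ.contDiffOn (hsource ▸ hy), hfderiv]
  rfl

theorem exists_complex_submodule (hφ : IsHolomorphicChart J φ) {x : M} (hx : x ∈ φ.source)
    {D : Submodule ℝ (TangentSpace 𝓘(ℝ, E) x)} (hD : ∀ v ∈ D, J.J x v ∈ D) :
    ∃ V : Submodule ℂ F, ∀ v, rdiff φ x v ∈ V ↔ v ∈ D := by
  let V : Submodule ℂ F :=
    { (D.map (rdiff φ x).toLinearMap).toAddSubmonoid with
      smul_mem' := by
        rintro c _ ⟨v, hv, rfl⟩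
        refine ⟨c.re • v + c.im • J.J x v,
          D.add_mem (D.smul_mem _ hv) (D.smul_mem _ (hD v hv)), ?_⟩
        change rdiff φ x _ = c • rdiff φ x v
        rw [map_add, map_smul, map_smul, hφ.rdiff_acs hx, ← complex_smul_eq] }
  exact ⟨V, fun v => (hφ.isSmoothChart.rdiff_injective hx).mem_set_image⟩

end IsHolomorphicChart

theorem AlmostComplex.Integrable.exists_adapted_chart (hJ : J.Integrable) {x : M}
    {D : Submodule ℝ (TangentSpace 𝓘(ℝ, E) x)} (hD : ∀ v ∈ D, J.J x v ∈ D) :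
    ∃ (a b : ℕ) (φ : OpenPartialHomeomorph M ((Fin a → ℂ) × (Fin b → ℂ))),
      x ∈ φ.source ∧ IsHolomorphicChart J φ ∧ φ x = 0 ∧ ∀ v, v ∈ D ↔ (rdiff φ x v).2 = 0 := by
  obtain ⟨n, φ, hx, hφ⟩ := hJ x
  obtain ⟨V, hV⟩ := hφ.exists_complex_submodule hx hD
  obtain ⟨a, b, T, hT⟩ := exists_prod_equiv_snd_eq_zero_iff V
  obtain ⟨ψ, hsource, hψ, hψ_apply, hψ_rdiff⟩ := hφ.exists_affine_change T (φ x)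
  refine ⟨a, b, ψ, hsource ▸ hx, hψ, ?_, fun v => ?_⟩
  · rw [hψ_apply, sub_self, map_zero]
  · rw [hψ_rdiff x hx, hT, hV]

end HolomorphicCharts

section Foliations

variable {E : Type*} [NormedAddCommGroup E] [NormedSpace ℝ E]
  {M : Type*} [TopologicalSpace M] [ChartedSpace E M]

theorem IsSmoothChart.rdiff_mlieBracket_pull [IsManifold 𝓘(ℝ, E) ∞ M] [CompleteSpace E]
    {F : Type*} [NormedAddCommGroup F] [NormedSpace ℝ F] [CompleteSpace F]
    {φ : OpenPartialHomeomorph M F} (hφ : IsSmoothChart (E := E) φ) {X Y : F → F} {y : M}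
    (hy : y ∈ φ.source) (hX : ContDiffAt ℝ ∞ X (φ y)) (hY : ContDiffAt ℝ ∞ Y (φ y)) :
    rdiff φ y (mlieBracket 𝓘(ℝ, E) (pull φ X) (pull φ Y) y) = lieBracket ℝ X Y (φ y) := by
  have hpush (Z : F → F) : push φ (pull (E := E) φ Z) =ᶠ[𝓝 (φ y)] Z :=
    eventually_of_mem (φ.open_target.mem_nhds (φ.map_source hy)) fun z hz => hφ.push_pull Z hz
  rw [hφ.rdiff_mlieBracket hy (hφ.smoothFieldAt_pull hy hX) (hφ.smoothFieldAt_pull hy hY),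
    (hpush X).lieBracket_vectorField_eq (hpush Y)]

namespace IsHolomorphicChart

variable [IsManifold 𝓘(ℝ, E) ∞ M] {F : Type*} [NormedAddCommGroup F] [NormedSpace ℂ F]
  {J : AlmostComplex E M} {φ : OpenPartialHomeomorph M F}

theorem acs_pull (hφ : IsHolomorphicChart J φ) (X : F → F) {y : M} (hy : y ∈ φ.source) :
    J.J y (pull φ X y) = pull φ (fun z => Complex.I • X z) y :=
  hφ.isSmoothChart.rdiff_injective hy (by
    rw [hφ.rdiff_acs hy, hφ.isSmoothChart.rdiff_pull X hy, hφ.isSmoothChart.rdiff_pull _ hy])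

theorem rdiff_dbar_pull [CompleteSpace E] [CompleteSpace F] (hφ : IsHolomorphicChart J φ)
    {X Y : F → F} {y : M} (hy : y ∈ φ.source) (hX : ContDiffAt ℝ ∞ X (φ y))
    (hY : ContDiffAt ℝ ∞ Y (φ y)) :
    rdiff φ y (J.dbar (pull φ X) (pull φ Y) y) = (1 / 2 : ℝ) • (lieBracket ℝ X Y (φ y) +
      Complex.I • lieBracket ℝ (fun z => Complex.I • X z) Y (φ y)) := by
  have hacs : (fun y => J.J y (pull φ X y)) =ᶠ[𝓝 y] pull φ fun z => Complex.I • X z :=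
    eventually_of_mem (φ.open_source.mem_nhds hy) fun _ hy' => hφ.acs_pull X hy'
  rw [AlmostComplex.dbar, map_smul, map_add, hφ.rdiff_acs hy,
    hacs.mlieBracket_vectorField_eq (EventuallyEq.refl (𝓝 y) (pull φ Y)),
    hφ.isSmoothChart.rdiff_mlieBracket_pull hy hX hY,
    hφ.isSmoothChart.rdiff_mlieBracket_pull hy (hX.const_smul Complex.I) hY]

end IsHolomorphicChart

/-- The field on `V × W` which lifts the constant field `c` on `V` and is tangent to the graphs of
the linear maps `A z`. -/
def graphLift {V W : Type*} [NormedAddCommGroup V] [NormedSpace ℝ V] [NormedAddCommGroup W]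
    [NormedSpace ℝ W] (A : V × W → V →L[ℝ] W) (c : V) (z : V × W) : V × W :=
  (c, A z c)

namespace IsLocalGraph

section Real

variable {V W : Type*} [NormedAddCommGroup V] [NormedSpace ℝ V] [NormedAddCommGroup W]
  [NormedSpace ℝ W] {D : ∀ x : M, Submodule ℝ (TangentSpace 𝓘(ℝ, E) x)}
  {φ : OpenPartialHomeomorph M (V × W)} {Ω : Set (V × W)} {A : V × W → V →L[ℝ] W}

theorem exists_apply_eq (h : IsLocalGraph D φ Ω A) {z : V × W} (hz : z ∈ Ω) :
    ∃ y ∈ φ.source, φ y = z :=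
  ⟨φ.symm z, φ.map_target (h.subset_target hz), φ.right_inv (h.subset_target hz)⟩

theorem isOpen_inter_preimage (h : IsLocalGraph D φ Ω A) : IsOpen (φ.source ∩ φ ⁻¹' Ω) :=
  φ.isOpen_inter_preimage h.isOpen

theorem contDiffAt_graphLift (h : IsLocalGraph D φ Ω A) (c : V) {z : V × W} (hz : z ∈ Ω) :
    ContDiffAt ℝ ∞ (graphLift A c) z :=
  contDiffAt_const.prodMk
    ((h.contDiffOn.contDiffAt (h.isOpen.mem_nhds hz)).clm_apply contDiffAt_const)

theorem fderiv_graphLift (h : IsLocalGraph D φ Ω A) (c : V) {z : V × W} (hz : z ∈ Ω)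
    (w : V × W) : fderiv ℝ (graphLift A c) z w = (0, fderiv ℝ A z w c) := by
  have hA : DifferentiableAt ℝ A z :=
    (h.contDiffOn.contDiffAt (h.isOpen.mem_nhds hz)).differentiableAt (by simp)
  have hlift : HasFDerivAt (graphLift A c) _ z :=
    (hasFDerivAt_const c z).prodMk (hA.hasFDerivAt.clm_apply (hasFDerivAt_const c z))
  rw [hlift.fderiv]
  simp

theorem pull_graphLift_mem (h : IsLocalGraph D φ Ω A) (hφ : IsSmoothChart (E := E) φ) (c : V)
    {y : M} (hy : y ∈ φ.source ∩ φ ⁻¹' Ω) : pull φ (graphLift A c) y ∈ D y := by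
  rw [h.mem_iff y hy.1 hy.2, hφ.rdiff_pull _ hy.1, graphLift]

variable [IsManifold 𝓘(ℝ, E) ∞ M] [CompleteSpace E]

theorem smoothFieldOn_pull_graphLift (h : IsLocalGraph D φ Ω A) (hφ : IsSmoothChart (E := E) φ)
    (c : V) : SmoothFieldOn (E := E) (pull φ (graphLift A c)) (φ.source ∩ φ ⁻¹' Ω) :=
  smoothFieldOn_of_forall fun _ hy =>
    hφ.smoothFieldAt_pull hy.1 (h.contDiffAt_graphLift c hy.2)

theorem fderiv_comm_of_isInvolutive [CompleteSpace V] [CompleteSpace W]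
    (h : IsLocalGraph D φ Ω A) (hφ : IsSmoothChart (E := E) φ) (hD : IsInvolutive D) {z : V × W}
    (hz : z ∈ Ω) (u v : V) : fderiv ℝ A z (u, A z u) v = fderiv ℝ A z (v, A z v) u := by
  obtain ⟨y, hy, rfl⟩ := h.exists_apply_eq hz
  have hbracket := hD _ h.isOpen_inter_preimage _ _ (h.smoothFieldOn_pull_graphLift hφ u)
    (h.smoothFieldOn_pull_graphLift hφ v) (fun _ => h.pull_graphLift_mem hφ u)
    (fun _ => h.pull_graphLift_mem hφ v) y ⟨hy, hz⟩
  rw [h.mem_iff y hy hz, hφ.rdiff_mlieBracket_pull hy (h.contDiffAt_graphLift u hz)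
    (h.contDiffAt_graphLift v hz), lieBracket, h.fderiv_graphLift v hz, h.fderiv_graphLift u hz,
    Prod.mk_sub_mk, sub_zero, map_zero] at hbracket
  exact sub_eq_zero.1 hbracket

end Real

section Complex

variable [IsManifold 𝓘(ℝ, E) ∞ M] {V W : Type*} [NormedAddCommGroup V] [NormedSpace ℂ V]
  [NormedAddCommGroup W] [NormedSpace ℂ W] {D : ∀ x : M, Submodule ℝ (TangentSpace 𝓘(ℝ, E) x)}
  {φ : OpenPartialHomeomorph M (V × W)} {Ω : Set (V × W)} {A : V × W → V →L[ℝ] W}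
  {J : AlmostComplex E M}

theorem map_I_smul (h : IsLocalGraph D φ Ω A) (hφ : IsHolomorphicChart J φ)
    (hD : ∀ x, ∀ v ∈ D x, J.J x v ∈ D x) {z : V × W} (hz : z ∈ Ω) (v : V) :
    A z (Complex.I • v) = Complex.I • A z v := by
  obtain ⟨y, hy, rfl⟩ := h.exists_apply_eq hz
  have hmem := hD y _ (h.pull_graphLift_mem hφ.isSmoothChart v ⟨hy, hz⟩)
  rw [h.mem_iff y hy hz, hφ.rdiff_acs hy, hφ.isSmoothChart.rdiff_pull _ hy] at hmem
  exact hmem.symm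

theorem fderiv_I_smul [CompleteSpace E] [CompleteSpace V] [CompleteSpace W]
    (h : IsLocalGraph D φ Ω A) (hφ : IsHolomorphicChart J φ) (hD : IsHolomorphicSubbundle J D)
    {z : V × W} (hz : z ∈ Ω) (c : V × W) (v : V) :
    fderiv ℝ A z (Complex.I • c) v = Complex.I • fderiv ℝ A z c v := by
  obtain ⟨y, hy, rfl⟩ := h.exists_apply_eq hz
  have hs := hφ.isSmoothChart
  have hdbar := hD.dbar_mem _ h.isOpen_inter_preimage (pull φ fun _ => c) _
    (smoothFieldOn_of_forall fun y hy => hs.smoothFieldAt_pull hy.1 contDiffAt_const)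
    (h.smoothFieldOn_pull_graphLift hs v) (fun _ => h.pull_graphLift_mem hs v) y ⟨hy, hz⟩
  rw [h.mem_iff y hy hz, hφ.rdiff_dbar_pull hy contDiffAt_const (h.contDiffAt_graphLift v hz)]
    at hdbar
  simp only [lieBracket, h.fderiv_graphLift v hz, fderiv_fun_const, Pi.zero_apply, zero_apply,
    sub_zero, Prod.smul_mk, Prod.mk_add_mk, smul_zero, add_zero, map_zero] at hdbar
  have hsum := (smul_eq_zero.1 hdbar).resolve_left (by norm_num)
  have hIsum := congrArg (Complex.I • ·) hsum
  simp only [smul_add, smul_smul, Complex.I_mul_I, neg_smul, one_smul, smul_zero] at hIsum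
  exact (add_neg_eq_zero.1 hIsum).symm

end Complex

end IsLocalGraph

variable [IsManifold 𝓘(ℝ, E) ∞ M] [CompleteSpace E] {J : AlmostComplex E M}
  {D : ∀ x : M, Submodule ℝ (TangentSpace 𝓘(ℝ, E) x)}

theorem IsHolomorphicSubbundle.isHolomorphicFoliation (hD : IsHolomorphicSubbundle J D)
    (hJ : J.Integrable) (hinv : IsInvolutive D) : IsHolomorphicFoliation J D := by
  intro x
  obtain ⟨a, b, φ, hx, hφ, hφx, hDx⟩ := hJ.exists_adapted_chart (hD.invariant x)
  have hs := hφ.isSmoothChart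
  obtain ⟨Ω, A, hxΩ, h⟩ := hD.smooth.exists_isLocalGraph hs hx hDx
  rw [hφx] at hxΩ
  obtain ⟨Φ, h0Φ, hΦΩ, hΦ, hΦsymm, hker⟩ := exists_holomorphic_frobenius_chart h.isOpen hxΩ
    h.contDiffOn (fun _ hz => h.map_I_smul hφ hD.invariant hz)
    (fun _ hz => h.fderiv_I_smul hφ hD hz) (fun _ hz => h.fderiv_comm_of_isInvolutive hs hinv hz)
  refine ⟨a, b, φ.trans Φ, ?_, hφ.trans hΦ hΦsymm, fun y hy v => ?_⟩
  · rw [OpenPartialHomeomorph.trans_source]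
    exact ⟨hx, by rwa [mem_preimage, hφx]⟩
  · change _ ↔ (rdiff (φ.trans Φ) y v).2 = 0
    rw [rdiff_trans hs hΦ hy]
    rw [OpenPartialHomeomorph.trans_source] at hy
    rw [hker _ hy.2, h.mem_iff y hy.1 (hΦΩ hy.2)]

end Foliations

section EigenbundlesSmooth

variable {E : Type*} [NormedAddCommGroup E] [NormedSpace ℝ E]
  {M : Type*} [TopologicalSpace M] [ChartedSpace E M] [IsManifold 𝓘(ℝ, E) ∞ M]
  {g : RiemMetric E M} {J₁ J₂ : AlmostComplex E M} {ε : ℝ} {x : M}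

theorem isSmoothDistribution_eigenbundle [CompleteSpace E] (hc : J₁.Commute J₂) (hε : ε * ε = 1) :
    IsSmoothDistribution (eigenbundle J₁ J₂ ε) := by
  intro x v hv
  obtain ⟨X, rfl, hX⟩ := exists_smoothField x v
  exact ⟨fun y => eigenproj J₁ J₂ ε y (X y), eigenproj_of_mem hε hv,
    hX.mono fun y hy => ⟨hy.eigenproj J₁ J₂ ε, eigenproj_mem hc hε (X y)⟩⟩

variable [FiniteDimensional ℝ E]

theorem isSmoothSubbundle_eigenbundle (hc : J₁.Commute J₂) (hε : ε * ε = 1) :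
    IsSmoothSubbundle (eigenbundle J₁ J₂ ε) :=
  (isSmoothDistribution_eigenbundle hc hε).isSmoothSubbundle
    (isSmoothDistribution_eigenbundle hc (by rw [neg_mul_neg, hε]))
    fun _ => isCompl_eigenbundle hc hε

namespace IsCommutingPair

theorem isHolomorphicSubbundle (h : IsCommutingPair g J₁ J₂) (hε : ε * ε = 1) :
    IsHolomorphicSubbundle J₁ (eigenbundle J₁ J₂ ε) where
  smooth := isSmoothSubbundle_eigenbundle h.comm hε
  invariant _ _ hv := acs_mem_eigenbundle h.comm hv
  dbar_mem _ hU _ _ hX hY hYmem _ hy :=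
    h.dbar_mem hε (hX.smoothFieldAt hU hy) (hY.smoothFieldAt hU hy)
      (mem_of_superset (hU.mem_nhds hy) hYmem)

theorem isHolomorphicFoliation (h : IsCommutingPair g J₁ J₂) (hε : ε * ε = 1) :
    IsHolomorphicFoliation J₁ (eigenbundle J₁ J₂ ε) :=
  (h.isHolomorphicSubbundle hε).isHolomorphicFoliation h.integrable_left (h.isInvolutive hε)

theorem extD_fundamentalForm_right_eq (h : IsCommutingPair g J₁ J₂) {X Y Z : TangentField E M}
    (hX : ∀ᶠ y in 𝓝 x, SmoothFieldAt X y ∧ X y ∈ eigenbundle J₁ J₂ ε y)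
    (hY : ∀ᶠ y in 𝓝 x, SmoothFieldAt Y y ∧ Y y ∈ eigenbundle J₁ J₂ ε y)
    (hZ : ∀ᶠ y in 𝓝 x, SmoothFieldAt Z y ∧ Z y ∈ eigenbundle J₁ J₂ ε y) :
    extD (fundamentalForm g J₂ h.compatible_right) x ![X x, Y x, Z x] =
      -ε * extD (fundamentalForm g J₁ h.compatible_left) x ![X x, Y x, Z x] := by
  have hsmooth₁ := isSmoothForm_fundamentalForm g J₁ h.compatible_left
  have hsmooth₂ := isSmoothForm_fundamentalForm g J₂ h.compatible_right
  have hpair {A B : TangentField E M}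
      (hA : ∀ᶠ y in 𝓝 x, SmoothFieldAt A y ∧ A y ∈ eigenbundle J₁ J₂ ε y)
      (hB : SmoothFieldAt B x) (w : TangentSpace 𝓘(ℝ, E) x) :
      rdiff (fun y => fundamentalForm g J₂ h.compatible_right y ![A y, B y]) x w =
        -ε * rdiff (fun y => fundamentalForm g J₁ h.compatible_left y ![A y, B y]) x w := by
    have hEq : (fun y => fundamentalForm g J₂ h.compatible_right y ![A y, B y]) =ᶠ[𝓝 x]
        fun y => -ε * fundamentalForm g J₁ h.compatible_left y ![A y, B y] :=
      hA.mono fun y hy => h.fundamentalForm_eq_of_mem_left hy.2 (B y)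
    have hmul := rdiff_const_mul ((hsmooth₁.contMDiffAt_apply_pair hA.self_of_nhds.1
      hB).mdifferentiableAt (by simp)) (-ε)
    exact congr($(hEq.mfderiv_eq.trans hmul) w)
  have hXx := hX.self_of_nhds
  have hYx := hY.self_of_nhds
  have hZx := hZ.self_of_nhds
  rw [hsmooth₁.extD_apply hXx.1 hYx.1 hZx.1, hsmooth₂.extD_apply hXx.1 hYx.1 hZx.1,
    hpair hY hZx.1, hpair hX hZx.1, hpair hX hYx.1, h.fundamentalForm_eq_of_mem_right _ hXx.2,
    h.fundamentalForm_eq_of_mem_right _ hYx.2, h.fundamentalForm_eq_of_mem_right _ hZx.2]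
  ring

theorem extD_fundamentalForm_eq_zero (h : IsCommutingPair g J₁ J₂) (hε : ε * ε = 1)
    {u v w : TangentSpace 𝓘(ℝ, E) x} (hu : u ∈ eigenbundle J₁ J₂ ε x)
    (hv : v ∈ eigenbundle J₁ J₂ ε x) (hw : w ∈ eigenbundle J₁ J₂ ε x) :
    extD (fundamentalForm g J₁ h.compatible_left) x ![u, v, w] = 0 := by
  have hD := isSmoothDistribution_eigenbundle h.comm hε
  have hdc := h.extD_fundamentalForm_eq hu hv hw
  obtain ⟨X, rfl, hX⟩ := hD x u hu
  obtain ⟨Y, rfl, hY⟩ := hD x v hv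
  obtain ⟨Z, rfl, hZ⟩ := hD x w hw
  rw [h.extD_fundamentalForm_right_eq hX hY hZ] at hdc
  rcases mul_self_eq_one_iff.1 hε with rfl | rfl <;> linarith

end IsCommutingPair

end EigenbundlesSmooth

/-! ### Restriction to the leaves -/

section Sections

variable {E : Type*} [NormedAddCommGroup E] [NormedSpace ℝ E]
  {M : Type*} [TopologicalSpace M] [ChartedSpace E M]

theorem contMDiffAt_clm_of_apply {V G : Type*} [NormedAddCommGroup V] [NormedSpace ℝ V]
    [FiniteDimensional ℝ V] [NormedAddCommGroup G] [NormedSpace ℝ G] {f : M → V →L[ℝ] G} {x : M}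
    (h : ∀ c : V, ContMDiffAt 𝓘(ℝ, E) 𝓘(ℝ, G) ∞ (fun y => f y c) x) :
    ContMDiffAt 𝓘(ℝ, E) 𝓘(ℝ, V →L[ℝ] G) ∞ f x := by
  let e₁ : V ≃L[ℝ] (Fin (Module.finrank ℝ V) → ℝ) :=
    ContinuousLinearEquiv.ofFinrankEq (Module.finrank_fin_fun ℝ).symm
  let e₂ := (e₁.arrowCongr (1 : G ≃L[ℝ] G)).trans
    (ContinuousLinearEquiv.piRing (Fin (Module.finrank ℝ V)))
  rw [← Function.id_comp f, ← e₂.symm_comp_self]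
  exact e₂.symm.contDiff.contMDiff.contMDiffAt.comp x
    (contMDiffAt_pi_space.2 fun i => h (e₁.symm (Pi.single i 1)))

variable [IsManifold 𝓘(ℝ, E) ∞ M]

theorem smoothFieldAt_trivializationAt_symm (x : M) (c : E) :
    SmoothFieldAt (fun y =>
      (trivializationAt E (fun y : M => TangentSpace 𝓘(ℝ, E) y) x).symm y c) x := by
  refine (Bundle.contMDiffAt_section x).2 (contMDiffAt_const (c := c) |>.congr_of_eventuallyEq ?_)
  filter_upwards [(trivializationAt E (fun y : M => TangentSpace 𝓘(ℝ, E) y) x).open_baseSet.mem_nhds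
    (FiberBundle.mem_baseSet_trivializationAt' x)] with y hy
  rw [Bundle.Trivialization.apply_mk_symm _ hy]

variable [FiniteDimensional ℝ E]

theorem contMDiffAt_endomorphism
    {A : ∀ x : M, TangentSpace 𝓘(ℝ, E) x →L[ℝ] TangentSpace 𝓘(ℝ, E) x} {x : M}
    (hA : ∀ X : TangentField E M, SmoothFieldAt X x → SmoothFieldAt (fun y => A y (X y)) x) :
    ContMDiffAt 𝓘(ℝ, E) (𝓘(ℝ, E).prod 𝓘(ℝ, E →L[ℝ] E)) ∞
      (fun x => Bundle.TotalSpace.mk' (E →L[ℝ] E)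
        (E := fun x : M => TangentSpace 𝓘(ℝ, E) x →L[ℝ] TangentSpace 𝓘(ℝ, E) x) x (A x)) x := by
  rw [contMDiffAt_hom_bundle]
  refine ⟨contMDiffAt_id, contMDiffAt_clm_of_apply fun c => ?_⟩
  have hAc := (Bundle.contMDiffAt_section x).1 (hA _ (smoothFieldAt_trivializationAt_symm x c))
  refine hAc.congr_of_eventuallyEq ?_
  filter_upwards [(trivializationAt E (fun y : M => TangentSpace 𝓘(ℝ, E) y) x).open_baseSet.mem_nhds
    (FiberBundle.mem_baseSet_trivializationAt' x)] with y hy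
  exact congr($(ContinuousLinearMap.inCoordinates_eq hy hy) c)

theorem contMDiffAt_bilinear
    {B : ∀ x : M, TangentSpace 𝓘(ℝ, E) x →L[ℝ] TangentSpace 𝓘(ℝ, E) x →L[ℝ] ℝ} {x : M}
    (hB : ∀ X Y : TangentField E M, SmoothFieldAt X x → SmoothFieldAt Y x →
      ContMDiffAt 𝓘(ℝ, E) 𝓘(ℝ, ℝ) ∞ (fun y => B y (X y) (Y y)) x) :
    ContMDiffAt 𝓘(ℝ, E) (𝓘(ℝ, E).prod 𝓘(ℝ, E →L[ℝ] E →L[ℝ] ℝ)) ∞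
      (fun x => Bundle.TotalSpace.mk' (E →L[ℝ] E →L[ℝ] ℝ)
        (E := fun x : M => TangentSpace 𝓘(ℝ, E) x →L[ℝ] TangentSpace 𝓘(ℝ, E) x →L[ℝ] ℝ) x (B x))
      x := by
  rw [contMDiffAt_hom_bundle]
  refine ⟨contMDiffAt_id, contMDiffAt_clm_of_apply fun c => contMDiffAt_clm_of_apply fun d => ?_⟩
  refine (hB _ _ (smoothFieldAt_trivializationAt_symm x c)
    (smoothFieldAt_trivializationAt_symm x d)).congr_of_eventuallyEq ?_
  filter_upwards [(trivializationAt E (fun y : M => TangentSpace 𝓘(ℝ, E) y) x).open_baseSet.mem_nhds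
    (FiberBundle.mem_baseSet_trivializationAt' x)] with y hy
  refine (inCoordinates_apply_eq₂ (F₃ := ℝ) (E₃ := Bundle.Trivial M ℝ) (x₀ := x) (x := y)
    hy hy (mem_univ _)).trans ?_
  exact LinearMap.congr_fun (Bundle.Trivial.linearMapAt_trivialization ℝ M ℝ y) _

end Sections

section Leaves

variable {E : Type*} [NormedAddCommGroup E] [NormedSpace ℝ E]
  {M : Type*} [TopologicalSpace M] [ChartedSpace E M]
  {E' : Type*} [NormedAddCommGroup E'] [NormedSpace ℝ E']
  {L : Type*} [TopologicalSpace L] [ChartedSpace E' L]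
  {D : ∀ x : M, Submodule ℝ (TangentSpace 𝓘(ℝ, E) x)} {ι : L → M}
  {V W : Type*} [NormedAddCommGroup V] [NormedSpace ℝ V] [NormedAddCommGroup W] [NormedSpace ℝ W]

theorem rdiff_fst_comp {φ : OpenPartialHomeomorph M (V × W)} (hφ : IsSmoothChart (E := E) φ)
    (hι : ContMDiff 𝓘(ℝ, E') 𝓘(ℝ, E) ∞ ι) {q : L} (hq : ι q ∈ φ.source)
    (v : TangentSpace 𝓘(ℝ, E') q) :
    rdiff (fun q => (φ (ι q)).1) q v =
      (rdiff (E := E) φ (ι q) (mfderiv 𝓘(ℝ, E') 𝓘(ℝ, E) ι q v)).1 := by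
  have hφq : MDifferentiableAt 𝓘(ℝ, E) 𝓘(ℝ, V × W) φ (ι q) :=
    hφ.mdifferentiable.mdifferentiableAt hq
  have hιq : MDifferentiableAt 𝓘(ℝ, E') 𝓘(ℝ, E) ι q := hι.mdifferentiableAt (by simp)
  have hfst : MDifferentiableAt 𝓘(ℝ, V × W) 𝓘(ℝ, V) (ContinuousLinearMap.fst ℝ V W)
    ((φ ∘ ι) q) := (ContinuousLinearMap.fst ℝ V W).differentiableAt.mdifferentiableAt
  have hcomp := mfderiv_comp q hfst (hφq.comp q hιq)
  rw [mfderiv_eq_fderiv, ContinuousLinearMap.fderiv, mfderiv_comp q hφq hιq] at hcomp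
  exact congr($hcomp v)

namespace IsIntegralManifold

theorem mfderiv_mem (hι : IsIntegralManifold E' ι D) {q : L}
    (v : TangentSpace 𝓘(ℝ, E') q) : mfderiv 𝓘(ℝ, E') 𝓘(ℝ, E) ι q v ∈ D (ι q) := by
  rw [← hι.tangent q]
  exact ⟨v, rfl⟩

theorem bijective_rdiff_fst_comp (hι : IsIntegralManifold E' ι D)
    {φ : OpenPartialHomeomorph M (V × W)} (hφ : IsSmoothChart (E := E) φ) {p : L}
    (hp : ι p ∈ φ.source)
    (hD : ∀ v : TangentSpace 𝓘(ℝ, E) (ι p), v ∈ D (ι p) ↔ (rdiff φ (ι p) v).2 = 0) :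
    Function.Bijective (rdiff (E := E') (fun q => (φ (ι q)).1) p) := by
  constructor
  · refine (injective_iff_map_eq_zero _).2 fun v hv => ?_
    rw [rdiff_fst_comp hφ hι.smooth hp] at hv
    refine (injective_iff_map_eq_zero _).1 (hι.injective p) v ?_
    exact (injective_iff_map_eq_zero _).1 (hφ.rdiff_injective hp) _
      (Prod.ext hv ((hD _).1 (hι.mfderiv_mem v)))
  · intro u
    obtain ⟨w, hw⟩ := hφ.rdiff_surjective hp (u, 0)
    have hwD : w ∈ D (ι p) := (hD w).2 (by rw [hw])
    rw [← hι.tangent p] at hwD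
    obtain ⟨v, rfl⟩ := hwD
    exact ⟨v, (rdiff_fst_comp hφ hι.smooth hp v).trans (congrArg Prod.fst hw)⟩

theorem exists_mfderiv_apply_eq_acs [FiniteDimensional ℝ E'] [IsManifold 𝓘(ℝ, E) ∞ M]
    {J : AlmostComplex E M} (hι : IsIntegralManifold E' ι D)
    (hDJ : ∀ x, ∀ v ∈ D x, J.J x v ∈ D x) (p : L) :
    ∃ T : TangentSpace 𝓘(ℝ, E') p →L[ℝ] TangentSpace 𝓘(ℝ, E') p, ∀ v,
      mfderiv 𝓘(ℝ, E') 𝓘(ℝ, E) ι p (T v) = J.J (ι p) (mfderiv 𝓘(ℝ, E') 𝓘(ℝ, E) ι p v) := by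
  let S : E' →ₗ[ℝ] E := (mfderiv 𝓘(ℝ, E') 𝓘(ℝ, E) ι p).toLinearMap
  let A : E →ₗ[ℝ] E := (J.J (ι p)).toLinearMap
  obtain ⟨R, hR⟩ := S.exists_leftInverse_of_injective (LinearMap.ker_eq_bot.2 (hι.injective p))
  let T : E' →L[ℝ] E' := LinearMap.toContinuousLinearMap (R ∘ₗ A ∘ₗ S)
  refine ⟨T, fun v => ?_⟩
  have hmem : J.J (ι p) (mfderiv 𝓘(ℝ, E') 𝓘(ℝ, E) ι p v) ∈ D (ι p) := hDJ _ _ (hι.mfderiv_mem v)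
  rw [← hι.tangent p] at hmem
  obtain ⟨w, hw : S w = A (S v)⟩ := hmem
  have hRw : R (A (S v)) = w := by
    rw [← hw]
    exact congr($hR w)
  exact (congrArg S hRw).trans hw

end IsIntegralManifold

variable [IsManifold 𝓘(ℝ, E') ∞ L]

theorem exists_isSmoothChart_of_bijective_rdiff [FiniteDimensional ℝ E'] {ψ : L → V} {U : Set L}
    (hU : IsOpen U) (hψ : ContMDiffOn 𝓘(ℝ, E') 𝓘(ℝ, V) ∞ ψ U) {p : L} (hp : p ∈ U)
    (hbij : Function.Bijective (rdiff (E := E') ψ p)) :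
    ∃ κ : OpenPartialHomeomorph L V, p ∈ κ.source ∧ κ.source ⊆ U ∧
      IsSmoothChart (E := E') κ ∧ EqOn κ ψ κ.source := by
  let χ := chartAt E' p
  have hχ := isSmoothChart_chartAt (E := E') p
  have hpχ : p ∈ χ.source := mem_chart_source E' p
  let S : Set E' := χ.target ∩ χ.symm ⁻¹' U
  have hS : IsOpen S := χ.symm.isOpen_inter_preimage hU
  have hpS : χ p ∈ S := ⟨χ.map_source hpχ, by rwa [mem_preimage, χ.left_inv hpχ]⟩
  have hψχ : ContDiffOn ℝ ∞ (ψ ∘ χ.symm) S := contMDiffOn_iff_contDiffOn.1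
    (hψ.comp (hχ.smooth_symm.mono inter_subset_left) fun _ h => h.2)
  have hψp : MDifferentiableAt 𝓘(ℝ, E') 𝓘(ℝ, V) ψ p :=
    (hψ.contMDiffAt (hU.mem_nhds hp)).mdifferentiableAt (by simp)
  let A : E' →L[ℝ] V := rdiff (E := E') ψ p
  let T : E' ≃L[ℝ] V := (LinearEquiv.ofBijective A.toLinearMap hbij).toContinuousLinearEquiv
  have hT : HasFDerivAt (ψ ∘ χ.symm) (T : E' →L[ℝ] V) (χ p) := by
    have hfderiv : (T : E' →L[ℝ] V) = fderiv ℝ (ψ ∘ χ.symm) (χ p) :=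
      ContinuousLinearMap.ext fun v => rdiff_eq_fderiv hψp v
    rw [hfderiv]
    exact ((hψχ.contDiffAt (hS.mem_nhds hpS)).differentiableAt (by simp)).hasFDerivAt
  obtain ⟨Ψ, hpΨ, hΨS, hΨψ, hΨsymm⟩ := exists_openPartialHomeomorph_of_hasFDerivAt hS hψχ hpS T hT
  have hsource : (χ.trans Ψ).source = χ.source ∩ χ ⁻¹' Ψ.source := χ.trans_source Ψ
  have hsub : (χ.trans Ψ).source ⊆ U := fun q hq => by
    rw [hsource] at hq
    have hqU := (hΨS hq.2).2
    rwa [mem_preimage, χ.left_inv hq.1] at hqU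
  have heq : EqOn (χ.trans Ψ) ψ (χ.trans Ψ).source := fun q hq => by
    rw [hsource] at hq
    exact (hΨψ (χ q)).trans (congrArg ψ (χ.left_inv hq.1))
  refine ⟨χ.trans Ψ, hsource ▸ ⟨hpχ, hpΨ⟩, hsub, ⟨(hψ.mono hsub).congr heq, ?_⟩, heq⟩
  rw [OpenPartialHomeomorph.trans_target]
  exact hχ.smooth_symm.comp (contMDiffOn_iff_contDiffOn.2 (hΨsymm.mono inter_subset_left))
    inter_subset_right

/-- `κ` is a chart of the immersed manifold `ι : L → M` adapted to the foliated chart `φ` of `M`: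
up to additive constants, `φ ∘ ι` is `(κ, 0)`. -/
structure IsLeafChart (ι : L → M) (φ : OpenPartialHomeomorph M (V × W))
    (κ : OpenPartialHomeomorph L V) : Prop where
  isSmoothChart : IsSmoothChart (E := E') κ
  mem_source : ∀ q ∈ κ.source, ι q ∈ φ.source
  rdiff_eq : ∀ q ∈ κ.source, ∀ v : TangentSpace 𝓘(ℝ, E') q,
    rdiff (E := E) φ (ι q) (mfderiv 𝓘(ℝ, E') 𝓘(ℝ, E) ι q v) = (rdiff κ q v, 0)

theorem IsIntegralManifold.exists_isLeafChart [FiniteDimensional ℝ E']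
    (hι : IsIntegralManifold E' ι D) {φ : OpenPartialHomeomorph M (V × W)}
    (hφ : IsSmoothChart (E := E) φ)
    (hD : ∀ y ∈ φ.source, ∀ v : TangentSpace 𝓘(ℝ, E) y, v ∈ D y ↔ (rdiff φ y v).2 = 0)
    {p : L} (hp : ι p ∈ φ.source) :
    ∃ κ : OpenPartialHomeomorph L V, p ∈ κ.source ∧ IsLeafChart (E := E) (E' := E') ι φ κ := by
  have hsmooth : ContMDiffOn 𝓘(ℝ, E') 𝓘(ℝ, V) ∞ (fun q => (φ (ι q)).1) (ι ⁻¹' φ.source) :=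
    (ContinuousLinearMap.fst ℝ V W).contMDiff.comp_contMDiffOn
      (hφ.smooth.comp hι.smooth.contMDiffOn fun _ h => h)
  obtain ⟨κ, hpκ, hsub, hκ, heq⟩ := exists_isSmoothChart_of_bijective_rdiff
    (φ.open_source.preimage hι.smooth.continuous) hsmooth hp
    (hι.bijective_rdiff_fst_comp hφ hp (hD _ hp))
  refine ⟨κ, hpκ, hκ, hsub, fun q hq v => Prod.ext ?_ ((hD _ (hsub hq) _).1 (hι.mfderiv_mem v))⟩
  rw [← rdiff_fst_comp hφ hι.smooth (hsub hq)]
  have hmfderiv : rdiff (E := E') κ q = rdiff (fun q => (φ (ι q)).1) q :=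
    (heq.eventuallyEq_of_mem (κ.open_source.mem_nhds hq)).mfderiv_eq
  exact congr($hmfderiv v).symm

variable [IsManifold 𝓘(ℝ, E) ∞ M]

theorem SmoothFieldAt.contMDiffAt_mfderiv (hι : ContMDiff 𝓘(ℝ, E') 𝓘(ℝ, E) ∞ ι)
    {X : TangentField E' L} {p : L} (hX : SmoothFieldAt X p) :
    ContMDiffAt 𝓘(ℝ, E') 𝓘(ℝ, E).tangent ∞ (fun q =>
      (⟨ι q, mfderiv 𝓘(ℝ, E') 𝓘(ℝ, E) ι q (X q)⟩ : TangentBundle 𝓘(ℝ, E) M)) p :=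
  ((hι.contMDiff_tangentMap (m := ∞) (by simp)).contMDiffAt).comp p hX

theorem fundamentalForm_eq_pullForm {g : RiemMetric E M} {J : AlmostComplex E M}
    (hJ : Compatible g J) {h : RiemMetric E' L} {j : AlmostComplex E' L} (hj : Compatible h j)
    (hmetric : ∀ (p : L) (v w : TangentSpace 𝓘(ℝ, E') p),
      h.inner p v w = g.inner (ι p) (mfderiv 𝓘(ℝ, E') 𝓘(ℝ, E) ι p v)
        (mfderiv 𝓘(ℝ, E') 𝓘(ℝ, E) ι p w))
    (hacs : ∀ (p : L) (v : TangentSpace 𝓘(ℝ, E') p), mfderiv 𝓘(ℝ, E') 𝓘(ℝ, E) ι p (j.J p v) =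
      J.J (ι p) (mfderiv 𝓘(ℝ, E') 𝓘(ℝ, E) ι p v)) :
    fundamentalForm h j hj = pullForm ι (fundamentalForm g J hJ) := by
  funext p
  ext v
  exact (hmetric p _ _).trans congr(g.inner (ι p) $(hacs p (v 0)) _)

variable [FiniteDimensional ℝ E']

theorem RiemMetric.exists_pullback (g : RiemMetric E M) (hι : ContMDiff 𝓘(ℝ, E') 𝓘(ℝ, E) ∞ ι)
    (hinj : ∀ p : L, Function.Injective (mfderiv 𝓘(ℝ, E') 𝓘(ℝ, E) ι p)) :
    ∃ h : RiemMetric E' L, ∀ (p : L) (v w : TangentSpace 𝓘(ℝ, E') p),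
      h.inner p v w = g.inner (ι p) (mfderiv 𝓘(ℝ, E') 𝓘(ℝ, E) ι p v)
        (mfderiv 𝓘(ℝ, E') 𝓘(ℝ, E) ι p w) := by
  let B : ∀ p : L, TangentSpace 𝓘(ℝ, E') p →L[ℝ] TangentSpace 𝓘(ℝ, E') p →L[ℝ] ℝ := fun p =>
    ContinuousLinearMap.bilinearComp (E := E) (F := E) (G := ℝ) (E' := E') (F' := E')
      (g.inner (ι p)) (mfderiv 𝓘(ℝ, E') 𝓘(ℝ, E) ι p) (mfderiv 𝓘(ℝ, E') 𝓘(ℝ, E) ι p)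
  have hB : ∀ (p : L) (v w : TangentSpace 𝓘(ℝ, E') p), B p v w =
      g.inner (ι p) (mfderiv 𝓘(ℝ, E') 𝓘(ℝ, E) ι p v) (mfderiv 𝓘(ℝ, E') 𝓘(ℝ, E) ι p w) :=
    fun _ _ _ => rfl
  refine ⟨⟨B, fun p v w => ?_, fun p v hv => ?_, fun p => ?_, fun p => ?_⟩, hB⟩
  · rw [hB, hB, g.symm]
  · rw [hB]
    exact g.pos _ _ fun h => hv ((injective_iff_map_eq_zero _).1 (hinj p) v h)
  · let T : E' →L[ℝ] E := mfderiv 𝓘(ℝ, E') 𝓘(ℝ, E) ι p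
    obtain ⟨K, -, hK⟩ := T.toLinearMap.exists_antilipschitzWith (LinearMap.ker_eq_bot.2 (hinj p))
    have hball : Bornology.IsBounded {v : E | g.inner (ι p) v v < 1} :=
      (NormedSpace.isVonNBounded_iff (E := E) ℝ).1 (g.isVonNBounded (ι p))
    exact (NormedSpace.isVonNBounded_iff (E := E') ℝ).2 (hK.isBounded_preimage hball)
  · refine contMDiffAt_bilinear fun X Y hX hY => ?_
    have hinner : ContMDiffAt 𝓘(ℝ, E') (𝓘(ℝ, E).prod 𝓘(ℝ)) ∞ (fun q =>
        Bundle.TotalSpace.mk' ℝ (E := Bundle.Trivial M ℝ) (ι q) (B q (X q) (Y q))) p :=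
      ContMDiffAt.clm_bundle_apply₂ (F₁ := E) (F₂ := E) ((g.contMDiff (ι p)).comp p (hι p))
        (hX.contMDiffAt_mfderiv hι) (hY.contMDiffAt_mfderiv hι)
    exact (Bundle.contMDiffAt_totalSpace.1 hinner).2

namespace IsIntegralManifold

variable {J : AlmostComplex E M}

theorem exists_isSmoothChart_rdiff_eq_I_smul (hι : IsIntegralManifold E' ι D)
    (hfol : IsHolomorphicFoliation J D)
    {j : ∀ p : L, TangentSpace 𝓘(ℝ, E') p →L[ℝ] TangentSpace 𝓘(ℝ, E') p}
    (hj : ∀ (p : L) (v : TangentSpace 𝓘(ℝ, E') p),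
      mfderiv 𝓘(ℝ, E') 𝓘(ℝ, E) ι p (j p v) = J.J (ι p) (mfderiv 𝓘(ℝ, E') 𝓘(ℝ, E) ι p v))
    (p : L) : ∃ (a : ℕ) (κ : OpenPartialHomeomorph L (Fin a → ℂ)), p ∈ κ.source ∧
      IsSmoothChart (E := E') κ ∧ ∀ q ∈ κ.source, ∀ v : TangentSpace 𝓘(ℝ, E') q,
        rdiff κ q (j q v) = Complex.I • rdiff κ q v := by
  obtain ⟨a, b, φ, hp, hφ, hD⟩ := hfol (ι p)
  obtain ⟨κ, hpκ, hκ⟩ := hι.exists_isLeafChart hφ.isSmoothChart hD hp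
  refine ⟨a, κ, hpκ, hκ.isSmoothChart, fun q hq v => ?_⟩
  have hjq := hκ.rdiff_eq q hq (j q v)
  rw [hj, hφ.rdiff_acs (hκ.mem_source q hq), hκ.rdiff_eq q hq] at hjq
  exact congr(Prod.fst $hjq).symm

theorem exists_almostComplex (hι : IsIntegralManifold E' ι D)
    (hDJ : ∀ x, ∀ v ∈ D x, J.J x v ∈ D x) (hfol : IsHolomorphicFoliation J D) :
    ∃ j : AlmostComplex E' L, (∀ (p : L) (v : TangentSpace 𝓘(ℝ, E') p),
      mfderiv 𝓘(ℝ, E') 𝓘(ℝ, E) ι p (j.J p v) =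
        J.J (ι p) (mfderiv 𝓘(ℝ, E') 𝓘(ℝ, E) ι p v)) ∧ j.Integrable := by
  choose j hj using hι.exists_mfderiv_apply_eq_acs hDJ
  have hchart := hι.exists_isSmoothChart_rdiff_eq_I_smul hfol hj
  have hsmooth : ∀ p : L, ∀ X : TangentField E' L, SmoothFieldAt X p →
      SmoothFieldAt (fun q => j q (X q)) p := by
    intro p X hX
    obtain ⟨a, κ, hp, hκ, hκj⟩ := hchart p
    have hpull : SmoothFieldAt (E := E') (pull κ fun z => Complex.I • push κ X z) p :=
      hκ.smoothFieldAt_pull hp ((hκ.contDiffAt_push hp hX).const_smul Complex.I)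
    refine hpull.congr (eventually_of_mem (κ.open_source.mem_nhds hp) fun q hq => ?_)
    apply hκ.rdiff_injective hq
    rw [hκ.rdiff_pull _ hq, hκj q hq, push_apply κ X hq]
  refine ⟨⟨j, fun p => contMDiffAt_endomorphism (hsmooth p), fun p v => ?_⟩, hj, fun p => ?_⟩
  · apply hι.injective p
    rw [hj, hj, J.sq, map_neg]
  · obtain ⟨a, κ, hp, hκ, hκj⟩ := hchart p
    exact ⟨a, κ, hp, hκ.smooth, hκ.smooth_symm, hκj⟩

end IsIntegralManifold

theorem IsCommutingPair.restrictsToKahler [FiniteDimensional ℝ E] {g : RiemMetric E M}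
    {J₁ J₂ : AlmostComplex E M} {ε : ℝ} (hJ : IsCommutingPair g J₁ J₂) (hε : ε * ε = 1)
    (hι : IsIntegralManifold E' ι (eigenbundle J₁ J₂ ε)) : RestrictsToKahler E' g J₁ ι := by
  obtain ⟨h, hh⟩ := g.exists_pullback hι.smooth hι.injective
  obtain ⟨j, hj, hint⟩ := hι.exists_almostComplex (fun _ _ hv => acs_mem_eigenbundle hJ.comm hv)
    (hJ.isHolomorphicFoliation hε)
  have hc : Compatible h j := fun p v w => by
    rw [hh, hh, hj, hj, hJ.compatible_left]
  refine ⟨h, j, hh, hj, hint, hc, ?_⟩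
  rw [fundamentalForm_eq_pullForm hJ.compatible_left hc hh hj,
    (isSmoothForm_fundamentalForm g J₁ hJ.compatible_left).extD_pullForm hι.smooth]
  funext p
  ext v
  have hzero := hJ.extD_fundamentalForm_eq_zero hε (hι.mfderiv_mem (v 0)) (hι.mfderiv_mem (v 1))
    (hι.mfderiv_mem (v 2))
  refine Eq.trans ?_ hzero
  refine congrArg (extD (fundamentalForm g J₁ hJ.compatible_left) (ι p)) (funext fun i => ?_)
  fin_cases i <;> rfl

end Leaves

end GenKahler

end

theorem theorem2_general {E : Type*} [NormedAddCommGroup E] [NormedSpace ℝ E]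
    [FiniteDimensional ℝ E] {M : Type*} [TopologicalSpace M] [ChartedSpace E M]
    [IsManifold 𝓘(ℝ, E) ∞ M] {g : GenKahler.RiemMetric E M} {J₁ J₂ : GenKahler.AlmostComplex E M}
    (h : GenKahler.IsCommutingPair g J₁ J₂) :
    (∀ x : M, IsCompl (GenKahler.eigenbundle J₁ J₂ 1 x) (GenKahler.eigenbundle J₁ J₂ (-1) x)) ∧
    (∀ x : M, ∀ v ∈ GenKahler.eigenbundle J₁ J₂ 1 x, ∀ w ∈ GenKahler.eigenbundle J₁ J₂ (-1) x,
      g.inner x v w = 0) ∧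
    ∀ ε : ℝ, ε = 1 ∨ ε = -1 →
      GenKahler.IsInvolutive (GenKahler.eigenbundle J₁ J₂ ε) ∧
      ∀ J : GenKahler.AlmostComplex E M, J = J₁ ∨ J = J₂ →
        GenKahler.IsHolomorphicSubbundle J (GenKahler.eigenbundle J₁ J₂ ε) ∧
        GenKahler.IsHolomorphicFoliation J (GenKahler.eigenbundle J₁ J₂ ε) ∧
        ∀ (E' : Type*) [NormedAddCommGroup E'] [NormedSpace ℝ E'] [FiniteDimensional ℝ E']
          (L : Type*) [TopologicalSpace L] [ChartedSpace E' L] [IsManifold 𝓘(ℝ, E') ∞ L]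
          (ι : L → M), GenKahler.IsIntegralManifold E' ι (GenKahler.eigenbundle J₁ J₂ ε) →
            GenKahler.RestrictsToKahler E' g J ι := by
  refine ⟨fun _ => GenKahler.isCompl_eigenbundle h.comm (one_mul 1), fun _ _ hv _ hw =>
    GenKahler.inner_eq_zero_of_mem_eigenbundle h.compatible_left h.compatible_right (one_mul 1)
      hv hw, fun ε hε => ?_⟩
  have hεε : ε * ε = 1 := mul_self_eq_one_iff.2 hε
  refine ⟨h.isInvolutive hεε, ?_⟩
  rintro J (rfl | rfl)
  · exact ⟨h.isHolomorphicSubbundle hεε, h.isHolomorphicFoliation hεε,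
      fun E' _ _ _ L _ _ _ ι hι => h.restrictsToKahler hεε hι⟩
  · rw [← GenKahler.eigenbundle_swap h.comm]
    exact ⟨h.symm.isHolomorphicSubbundle hεε, h.symm.isHolomorphicFoliation hεε,
      fun E' _ _ _ L _ _ _ ι hι => h.symm.restrictsToKahler hεε hι⟩

theorem theorem2 {E : Type*} [NormedAddCommGroup E] [NormedSpace ℝ E] [FiniteDimensional ℝ E]
    {M : Type*} [TopologicalSpace M] [T2Space M] [ChartedSpace E M] [IsManifold 𝓘(ℝ, E) ∞ M]
    (K : GenKahler.GeneralizedKahler E M)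
    (hcomm : ∀ (x : M) (v : TangentSpace 𝓘(ℝ, E) x),
      K.Jp.J x (K.Jm.J x v) = K.Jm.J x (K.Jp.J x v)) :
    (∀ x : M, IsCompl (K.T 1 x) (K.T (-1) x)) ∧
    (∀ x : M, ∀ v ∈ K.T 1 x, ∀ w ∈ K.T (-1) x, K.g.inner x v w = 0) ∧
    ∀ ε : ℝ, ε = 1 ∨ ε = -1 →
      GenKahler.IsInvolutive (K.T ε) ∧
      ∀ J : GenKahler.AlmostComplex E M, J = K.Jp ∨ J = K.Jm →
        GenKahler.IsHolomorphicSubbundle J (K.T ε) ∧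
        GenKahler.IsHolomorphicFoliation J (K.T ε) ∧
        ∀ (E' : Type*) [NormedAddCommGroup E'] [NormedSpace ℝ E'] [FiniteDimensional ℝ E']
          (L : Type*) [TopologicalSpace L] [ChartedSpace E' L] [IsManifold 𝓘(ℝ, E') ∞ L]
          (ι : L → M), GenKahler.IsIntegralManifold E' ι (K.T ε) → GenKahler.RestrictsToKahler E' K.g J ι :=
  theorem2_general (K.isCommutingPair hcomm)
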